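/- Let $S^1=\mathbb R/\mathbb Z$ and let $s>3/2$. Let $H^s(S^1)$ be the Sobolev space of real functions on $S^1$ with norm $\|f\|_{H^s}^2=\sum_{k\in\mathbb Z}(1+(2\pi k)^2)^s|\hat f(k)|^2$, and let $\mathcal D^s(S^1)$ be the group of orientation-preserving diffeomorphisms of $S^1$ of Sobolev class $H^s$, that is, of the maps $\eta(x)=x+\varphi(x)$ mod $1$ with $\varphi\in H^s(S^1)\subset C^1(S^1)$ and $1+\varphi_x>0$. It is a manifold modelled on $H^s(S^1)$, with the local inverses $\mathrm{id}+\varphi\mapsto\varphi$ as charts, and $T_\eta\mathcal D^s(S^1)=H^s(S^1)$ for every $\eta$. Equip $\mathcal D^s(S^1)$ with the right-invariant $\mu$HS metric $$\langle U,V\rangle_\eta=\int_{S^1}U\eta_x\,dx\int_{S^1}V\eta_x\,dx+\int_{S^1}\frac{U_xV_x}{\eta_x}\,dx ,$$ which at the identity is $\langle u,v\rangle=\int u\,dx\int v\,dx+\int u_xv_x\,dx$. A geodesic is a $C^2$ path $\gamma:[0,1]\to\mathcal D^s(S^1)$ that is a critical point of the energy $E(\gamma)=\frac12\int_0^1\langle\dot\gamma(t),\dot\gamma(t)\rangle_{\gamma(t)}\,dt$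 with respect to all $C^2$ variations with fixed end points. Then this metric has a well-defined Riemannian exponential map at the identity, which is a local $C^1$ diffeomorphism. More precisely: (i) for every $u\in T_{\mathrm{id}}\mathcal D^s(S^1)=H^s(S^1)$ there is at most one geodesic $\gamma:[0,1]\to\mathcal D^s(S^1)$ with $\gamma(0)=\mathrm{id}$ and $\dot\gamma(0)=u$; (ii) there is an open neighbourhood $U$ of $0$ in $T_{\mathrm{id}}\mathcal D^s(S^1)$ such that for every $u\in U$ this geodesic, $\gamma_u$, exists, and $\exp_{\mathrm{id}}:U\to\mathcal D^s(S^1)$, $\exp_{\mathrm{id}}(u)=\gamma_u(1)$, is a $C^1$ diffeomorphism from $U$ onto an open neighbourhood of the identity in $\mathcal D^s(S^1)$. -/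

import Mathlib

open Set Filter Topology MeasureTheory
open scoped Manifold ContDiff ENNReal

noncomputable section

namespace MuHS

/-! ### The Sobolev space `H^s(S¹)` of real functions on `S¹ = ℝ/ℤ` -/

/-- The `k`-th Fourier coefficient `∫ f(x) e^{-2πikx} dx` of a continuous real function on the
circle. -/
def fCoeff (f : C(UnitAddCircle, ℝ)) (k : ℤ) : ℂ :=
  fourierCoeff (fun x : UnitAddCircle => ((f x : ℝ) : ℂ)) k

/-- The symbol `(1 + (2πk)²)^{s/2}` of `(1 - ∂ₓ²)^{s/2}`. -/
def weight (s : ℝ) (k : ℤ) : ℝ := (1 + (2 * Real.pi * (k : ℝ)) ^ 2) ^ (s / 2)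

/-- The coefficients `(1 + (2πk)²)^{s/2} f̂(k)`. -/
def wCoeff (s : ℝ) (f : C(UnitAddCircle, ℝ)) (k : ℤ) : ℂ := weight s k • fCoeff f k

/-- `f ∈ H^s(S¹)`, i.e. `∑ₖ (1 + (2πk)²)^s |f̂(k)|² < ∞`.  The definition is used for `s > 3/2`,
where (as for all `s > 1/2`) every `H^s` function has a unique continuous representative. -/
def MemSobolev (s : ℝ) (f : C(UnitAddCircle, ℝ)) : Prop :=
  Summable fun k : ℤ => ‖wCoeff s f k‖ ^ 2

/-- A real function on the circle, regarded as a complex one. -/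
def toComplex (f : C(UnitAddCircle, ℝ)) : C(UnitAddCircle, ℂ) :=
  ⟨fun x => ((f x : ℝ) : ℂ), by fun_prop⟩

lemma fCoeff_eq (f : C(UnitAddCircle, ℝ)) : fCoeff f = fourierCoeff (toComplex f) := rfl

lemma integrable_toComplex (f : C(UnitAddCircle, ℝ)) :
    Integrable (toComplex f) (AddCircle.haarAddCircle (T := 1)) :=
  (toComplex f).continuous.integrable_of_hasCompactSupport
    (HasCompactSupport.of_compactSpace _)

lemma fCoeff_add (f g : C(UnitAddCircle, ℝ)) (k : ℤ) :
    fCoeff (f + g) k = fCoeff f k + fCoeff g k := by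
  have h : (toComplex (f + g) : UnitAddCircle → ℂ) = toComplex f + toComplex g := by
    ext x; simp [toComplex]
  rw [fCoeff_eq, h, fourierCoeff.add (integrable_toComplex f) (integrable_toComplex g)]
  rfl

lemma fCoeff_smul (c : ℝ) (f : C(UnitAddCircle, ℝ)) (k : ℤ) :
    fCoeff (c • f) k = c • fCoeff f k := by
  have h : (toComplex (c • f) : UnitAddCircle → ℂ) = (c : ℂ) • (toComplex f : UnitAddCircle → ℂ) := by
    ext x; simp [toComplex]
  rw [fCoeff_eq, h, fourierCoeff.const_smul]
  simp [fCoeff_eq]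

lemma wCoeff_add (s : ℝ) (f g : C(UnitAddCircle, ℝ)) :
    wCoeff s (f + g) = wCoeff s f + wCoeff s g := by
  ext k; simp [wCoeff, fCoeff_add]

lemma wCoeff_smul (s c : ℝ) (f : C(UnitAddCircle, ℝ)) :
    wCoeff s (c • f) = c • wCoeff s f := by
  ext k; simp [wCoeff, fCoeff_smul]; ring

lemma memSobolev_iff (s : ℝ) (f : C(UnitAddCircle, ℝ)) :
    MemSobolev s f ↔ Memℓp (wCoeff s f) 2 := by
  rw [memℓp_gen_iff (by norm_num)]
  simp [MemSobolev]

/-- `H^s(S¹)` as a real vector space of functions. -/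
def sobolevSubmodule (s : ℝ) : Submodule ℝ C(UnitAddCircle, ℝ) where
  carrier := {f | MemSobolev s f}
  zero_mem' := by
    have : wCoeff s 0 = 0 := by simpa using wCoeff_smul s 0 0
    simp [MemSobolev, this]
  add_mem' {f g} hf hg := by
    simp only [mem_ofPred_eq, memSobolev_iff, wCoeff_add] at *
    exact hf.add hg
  smul_mem' c f hf := by
    simp only [mem_ofPred_eq, memSobolev_iff, wCoeff_smul] at *
    exact hf.const_smul c

/-- The Sobolev space `H^s(S¹)`; it carries the `H^s` norm (not the sup norm), see `hs_norm_sq`. -/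
def Hs (s : ℝ) : Type := sobolevSubmodule s

instance (s : ℝ) : AddCommGroup (Hs s) := inferInstanceAs (AddCommGroup (sobolevSubmodule s))
instance (s : ℝ) : Module ℝ (Hs s) := inferInstanceAs (Module ℝ (sobolevSubmodule s))

/-- The underlying continuous function. -/
def Hs.toC {s : ℝ} : Hs s →ₗ[ℝ] C(UnitAddCircle, ℝ) := (sobolevSubmodule s).subtype

instance (s : ℝ) : CoeFun (Hs s) (fun _ => UnitAddCircle → ℝ) := ⟨fun f => Hs.toC f⟩

lemma Hs.toC_injective {s : ℝ} : Function.Injective (Hs.toC (s := s)) :=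
  (sobolevSubmodule s).injective_subtype

lemma Hs.mem {s : ℝ} (f : Hs s) : MemSobolev s (Hs.toC f) := f.2

/-- `f ↦ ((1 + (2πk)²)^{s/2} f̂(k))ₖ`, as a map to `ℓ²(ℤ, ℂ)`. -/
def Hs.toLp (s : ℝ) : Hs s →ₗ[ℝ] lp (fun _ : ℤ => ℂ) 2 where
  toFun f := ⟨wCoeff s (Hs.toC f), (memSobolev_iff s _).1 f.mem⟩
  map_add' f g := Subtype.ext
    ((congrArg (wCoeff s) (map_add Hs.toC f g)).trans (wCoeff_add s _ _))
  map_smul' c f := Subtype.ext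
    ((congrArg (wCoeff s) (map_smul Hs.toC c f)).trans (wCoeff_smul s c _))

lemma weight_pos (s : ℝ) (k : ℤ) : 0 < weight s k := Real.rpow_pos_of_pos (by positivity) _

lemma Hs.toLp_injective (s : ℝ) : Function.Injective (Hs.toLp s) := by
  rw [injective_iff_map_eq_zero]
  intro f hf
  have h0 : fourierCoeff (toComplex (Hs.toC f)) = 0 := by
    ext k
    have : wCoeff s (Hs.toC f) k = 0 := congrFun (congrArg Subtype.val hf) k
    rw [wCoeff, smul_eq_zero] at this
    exact this.resolve_left (weight_pos s k).ne'
  apply Hs.toC_injective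
  ext x
  have := has_pointwise_sum_fourier_series_of_summable (f := toComplex (Hs.toC f))
    (by rw [h0]; exact summable_zero) x
  rw [h0] at this
  simp only [Pi.zero_apply, zero_smul] at this
  have := this.unique hasSum_zero
  simpa [toComplex] using this

instance (s : ℝ) : NormedAddCommGroup (Hs s) :=
  NormedAddCommGroup.induced (Hs s) (lp (fun _ : ℤ => ℂ) 2) (Hs.toLp s) (Hs.toLp_injective s)

instance (s : ℝ) : NormedSpace ℝ (Hs s) :=
  NormedSpace.induced ℝ (Hs s) (lp (fun _ : ℤ => ℂ) 2) (Hs.toLp s)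

lemma hs_norm_sq {s : ℝ} (f : Hs s) :
    ‖f‖ ^ 2 = ∑' k : ℤ, (1 + (2 * Real.pi * (k : ℝ)) ^ 2) ^ s * ‖fCoeff (Hs.toC f) k‖ ^ 2 := by
  have h : ‖f‖ = ‖Hs.toLp s f‖ := rfl
  rw [h]
  have := lp.norm_rpow_eq_tsum (p := 2) (by norm_num) (Hs.toLp s f)
  simp only [ENNReal.toReal_ofNat, Real.rpow_two] at this
  rw [this]
  refine tsum_congr fun k => ?_
  change ‖wCoeff s (Hs.toC f) k‖ ^ 2 = _
  rw [wCoeff, norm_smul, mul_pow, Real.norm_of_nonneg (weight_pos s k).le, weight,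
    ← Real.rpow_natCast, ← Real.rpow_mul (by positivity)]
  congr 2; norm_num

/-- The derivative `∂ₓ f (x)` of a function on the circle `ℝ/ℤ`. -/
def dx (f : UnitAddCircle → ℝ) (x : UnitAddCircle) : ℝ :=
  deriv (fun y : ℝ => f (x + (y : UnitAddCircle))) 0

/-! ### The embedding `H^s ⊂ C¹` for `s > 3/2` -/

lemma summable_weight {s : ℝ} (hs : 3 / 2 < s) :
    Summable fun k : ℤ => (weight (1 - s) k) ^ (2 : ℝ) := by
  have h := Real.summable_abs_int_rpow (b := 2 * (s - 1)) (by linarith)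
  refine Summable.of_norm_bounded_eventually h ?_
  rw [eventually_cofinite]
  refine (finite_singleton (0 : ℤ)).subset ?_
  intro k hk
  by_contra hk0
  apply hk
  have hk0 : k ≠ 0 := hk0
  have hkpos : 0 < |(k : ℝ)| := by positivity
  rw [Real.norm_of_nonneg (Real.rpow_nonneg (weight_pos _ _).le _), weight,
    ← Real.rpow_mul (by positivity)]
  have e1 : |(k : ℝ)| ^ (-(2 * (s - 1))) = (|(k : ℝ)| ^ 2) ^ (1 - s) := by
    rw [← Real.rpow_natCast, ← Real.rpow_mul hkpos.le]; congr 1; push_cast; ring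
  rw [e1]
  have e2 : (1 - s) / 2 * 2 = 1 - s := by ring
  rw [e2]
  apply Real.rpow_le_rpow_of_nonpos (by positivity) _ (by linarith)
  rw [mul_pow, ← sq_abs (k : ℝ)]
  have : 1 ≤ (2 * Real.pi) ^ 2 := by nlinarith [Real.pi_gt_three]
  nlinarith [sq_nonneg |(k : ℝ)|]

/-- The constant of the embedding. -/
def embConst (s : ℝ) : ℝ := (∑' k : ℤ, (weight (1 - s) k) ^ (2 : ℝ)) ^ ((1 : ℝ) / 2)

lemma emb_aux {s : ℝ} (hs : 3 / 2 < s) (f : Hs s) :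
    (Summable fun k : ℤ => weight 1 k * ‖fCoeff (Hs.toC f) k‖) ∧
      ∑' k : ℤ, weight 1 k * ‖fCoeff (Hs.toC f) k‖ ≤ embConst s * ‖f‖ := by
  have hmem : Summable fun k : ℤ => ‖wCoeff s (Hs.toC f) k‖ ^ (2 : ℝ) := by
    simpa [MemSobolev] using f.mem
  have key := Real.summable_and_inner_le_Lp_mul_Lq_tsum_of_nonneg Real.HolderConjugate.two_two
    (fun k => (weight_pos (1 - s) k).le) (fun k => norm_nonneg (wCoeff s (Hs.toC f) k))
    (summable_weight hs) hmem
  have e : (fun k : ℤ => weight (1 - s) k * ‖wCoeff s (Hs.toC f) k‖) =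
      fun k => weight 1 k * ‖fCoeff (Hs.toC f) k‖ := by
    ext k
    rw [wCoeff, norm_smul, Real.norm_of_nonneg (weight_pos s k).le, ← mul_assoc]
    congr 1
    rw [weight, weight, weight, ← Real.rpow_add (by positivity)]
    congr 1; ring
  have hn : (∑' k : ℤ, ‖wCoeff s (Hs.toC f) k‖ ^ (2 : ℝ)) ^ ((1 : ℝ) / 2) = ‖f‖ := by
    have := lp.norm_eq_tsum_rpow (p := 2) (by norm_num) (Hs.toLp s f)
    simp only [ENNReal.toReal_ofNat] at this
    exact this.symm
  rw [e, hn] at key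
  exact ⟨key.1, key.2⟩

lemma abs_le_weight (k : ℤ) : ‖(2 * Real.pi * Complex.I * k : ℂ)‖ ≤ weight 1 k := by
  have : ‖(2 * Real.pi * Complex.I * k : ℂ)‖ = |2 * Real.pi * (k : ℝ)| := by
    simp [abs_mul]
  rw [this, weight, ← Real.sqrt_eq_rpow]
  apply Real.le_sqrt_of_sq_le
  rw [sq_abs]; linarith

lemma one_le_weight (k : ℤ) : 1 ≤ weight 1 k := by
  apply Real.one_le_rpow (by nlinarith [sq_nonneg (2 * Real.pi * (k : ℝ))]) (by norm_num)

/-- The Fourier series of the derivative. -/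
def dSeries {s : ℝ} (f : Hs s) (x : UnitAddCircle) : ℂ :=
  ∑' k : ℤ, fCoeff (Hs.toC f) k * (2 * Real.pi * Complex.I * k) * fourier k x

lemma norm_dSeries_term_le {s : ℝ} (f : Hs s) (x : UnitAddCircle) (k : ℤ) :
    ‖fCoeff (Hs.toC f) k * (2 * Real.pi * Complex.I * k) * fourier k x‖ ≤
      weight 1 k * ‖fCoeff (Hs.toC f) k‖ := by
  rw [norm_mul, norm_mul, fourier_apply, Circle.norm_coe, mul_one, mul_comm]
  gcongr
  exact abs_le_weight k

lemma hasDerivAt_hs {s : ℝ} (hs : 3 / 2 < s) (f : Hs s) (x : UnitAddCircle) :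
    HasDerivAt (fun y : ℝ => f (x + (y : UnitAddCircle))) (dSeries f x).re 0 := by
  obtain ⟨hsum, -⟩ := emb_aux hs f
  have hsum' : Summable (fourierCoeff (toComplex (Hs.toC f))) := by
    refine Summable.of_norm_bounded hsum fun k => ?_
    exact le_mul_of_one_le_left (norm_nonneg _) (one_le_weight k)
  have hF : ∀ x, HasSum (fun k => fCoeff (Hs.toC f) k * fourier k x) ((f x : ℝ) : ℂ) := fun x =>
    has_pointwise_sum_fourier_series_of_summable hsum' x
  have hd : HasDerivAt (fun y : ℝ => ∑' k : ℤ, fCoeff (Hs.toC f) k *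
      (fourier k x * fourier k (y : UnitAddCircle)))
      (∑' k : ℤ, fCoeff (Hs.toC f) k * (fourier k x *
        (2 * Real.pi * Complex.I * k / (1 : ℝ) * fourier k ((0 : ℝ) : UnitAddCircle)))) 0 := by
    refine hasDerivAt_tsum (u := fun k => weight 1 k * ‖fCoeff (Hs.toC f) k‖) hsum (g' := fun k (y : ℝ) =>
      fCoeff (Hs.toC f) k * (fourier k x *
        (2 * Real.pi * Complex.I * k / (1 : ℝ) * fourier k (y : UnitAddCircle)))) ?_ ?_
        (y₀ := (0 : ℝ)) ?_ 0
    · intro k y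
      exact ((hasDerivAt_fourier 1 k y).const_mul _).const_mul _
    · intro k y
      have := norm_dSeries_term_le f x k
      refine le_trans (le_of_eq ?_) this
      simp only [norm_mul, fourier_apply, Circle.norm_coe]
      simp
    · have := (hF x).summable
      simpa using this
  have e1 : (fun y : ℝ => ∑' k : ℤ, fCoeff (Hs.toC f) k *
      (fourier k x * fourier k (y : UnitAddCircle))) =
      fun y : ℝ => ((f (x + (y : UnitAddCircle)) : ℝ) : ℂ) := by
    ext y
    rw [← (hF (x + (y : UnitAddCircle))).tsum_eq]
    refine tsum_congr fun k => ?_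
    rw [fourier_apply, fourier_apply, fourier_apply, smul_add, AddCircle.toCircle_add]
    simp
  have e2 : (∑' k : ℤ, fCoeff (Hs.toC f) k * (fourier k x *
        (2 * Real.pi * Complex.I * k / (1 : ℝ) * fourier k ((0 : ℝ) : UnitAddCircle))))
      = dSeries f x := by
    refine tsum_congr fun k => ?_
    have : ((0 : ℝ) : UnitAddCircle) = 0 := rfl
    rw [this, fourier_eval_zero]
    push_cast; ring
  rw [e1, e2] at hd
  have := Complex.reCLM.hasFDerivAt.comp_hasDerivAt (0 : ℝ) hd
  simpa [Function.comp_def] using this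

lemma dx_eq {s : ℝ} (hs : 3 / 2 < s) (f : Hs s) (x : UnitAddCircle) : dx f x = (dSeries f x).re :=
  (hasDerivAt_hs hs f x).deriv

lemma abs_dx_le {s : ℝ} (hs : 3 / 2 < s) (f : Hs s) (x : UnitAddCircle) :
    |dx f x| ≤ embConst s * ‖f‖ := by
  obtain ⟨hsum, hle⟩ := emb_aux hs f
  rw [dx_eq hs]
  refine (Complex.abs_re_le_norm _).trans (le_trans ?_ hle)
  exact tsum_of_norm_bounded hsum.hasSum (norm_dSeries_term_le f x)

lemma continuous_dx {s : ℝ} (hs : 3 / 2 < s) (f : Hs s) : Continuous (dx f) := by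
  have : dx f = fun x => (dSeries f x).re := funext (dx_eq hs f)
  rw [this]
  apply Complex.continuous_re.comp
  refine continuous_tsum (fun k => ?_) (emb_aux hs f).1 fun k x => norm_dSeries_term_le f x k
  exact continuous_const.mul (fourier k).continuous

lemma dx_add {s : ℝ} (hs : 3 / 2 < s) (f g : Hs s) (x : UnitAddCircle) :
    dx (f + g : Hs s) x = dx f x + dx g x := by
  rw [dx_eq hs f, dx_eq hs g]
  refine HasDerivAt.deriv ?_
  exact (hasDerivAt_hs hs f x).add (hasDerivAt_hs hs g x)

/-! ### The group `𝒟^s(S¹)` as a manifold modelled on `H^s(S¹)` -/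

/-- The set of `φ ∈ H^s(S¹)` with `1 + φₓ > 0`: for `s > 3/2` these are exactly the periodic parts
of the lifts `x ↦ x + φ(x)` to `ℝ` of the orientation-preserving `H^s` diffeomorphisms of `S¹`. -/
def liftSet (s : ℝ) : Set (Hs s) := {φ | ∀ x : UnitAddCircle, 0 < 1 + dx φ x}

/-- The circle map `x ↦ x + φ(x)` mod `1`. -/
def circleMap {s : ℝ} (φ : Hs s) (x : UnitAddCircle) : UnitAddCircle :=
  x + ((φ x : ℝ) : UnitAddCircle)

/-- The set `𝒟^s(S¹)`, `s > 3/2`, of orientation-preserving diffeomorphisms of the circle of Sobolev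
class `H^s`: the maps `η : S¹ → S¹` with a lift `x ↦ x + φ(x)`, where `φ ∈ H^s(S¹) ⊂ C¹(S¹)` and
`1 + φₓ > 0`. -/
@[ext]
structure Ds (s : ℝ) where
  /-- The underlying map of the circle. -/
  toFun : UnitAddCircle → UnitAddCircle
  exists_lift : ∃ φ ∈ liftSet s, toFun = circleMap φ

/-- The projection from lifts to diffeomorphisms. -/
def proj {s : ℝ} (φ : liftSet s) : Ds s := ⟨circleMap φ.1, φ.1, φ.2, rfl⟩

lemma proj_surjective {s : ℝ} : Function.Surjective (proj (s := s)) := by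
  rintro ⟨η, φ, hφ, rfl⟩
  exact ⟨⟨φ, hφ⟩, rfl⟩

lemma dx_zero {s : ℝ} (x : UnitAddCircle) : dx (0 : Hs s) x = 0 := by
  have : (fun y : ℝ => (0 : Hs s) (x + (y : UnitAddCircle))) = fun _ => 0 := by
    ext y; simp
  rw [dx, this]; simp

lemma zero_mem_liftSet (s : ℝ) : (0 : Hs s) ∈ liftSet s := fun x => by
  rw [dx_zero]; norm_num

instance (s : ℝ) : Nonempty (liftSet s) := ⟨⟨0, zero_mem_liftSet s⟩⟩

/-- The identity diffeomorphism. -/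
def Ds.id (s : ℝ) : Ds s :=
  ⟨fun x => x, 0, zero_mem_liftSet s, by ext x; simp [circleMap]⟩

/-- The periodic part `φ` of a lift `x ↦ x + φ(x)` of `η`; it is unique up to integers. -/
def Ds.lift {s : ℝ} (η : Ds s) : liftSet s := (proj_surjective η).choose

lemma Ds.proj_lift {s : ℝ} (η : Ds s) : proj η.lift = η := (proj_surjective η).choose_spec

/-- The (positive) derivative `ηₓ` of a circle diffeomorphism. -/
def Ds.dx {s : ℝ} (η : Ds s) (x : UnitAddCircle) : ℝ := 1 + MuHS.dx (η.lift : Hs s) x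

/-- `𝒟^s(S¹)` is the quotient of the open subset `liftSet s` of `H^s(S¹)` by integer
translations. -/
instance (s : ℝ) : TopologicalSpace (Ds s) := TopologicalSpace.coinduced proj inferInstance

lemma continuous_proj {s : ℝ} : Continuous (proj (s := s)) := continuous_coinduced_rng

lemma fCoeff_const (c : ℝ) (k : ℤ) :
    fCoeff (ContinuousMap.const _ c) k = if k = 0 then (c : ℂ) else 0 := by
  have h : (toComplex (ContinuousMap.const _ c) : UnitAddCircle → ℂ) =
      (c : ℂ) • (fourier (T := 1) 0 : UnitAddCircle → ℂ) := by
    ext x; simp [toComplex]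
  rw [fCoeff_eq, h, fourierCoeff.const_smul, fourierCoeff_fourier]
  by_cases hk : k = 0
  · subst hk; simp
  · simp [hk]

/-- Constant functions. -/
def constHs (s : ℝ) (c : ℝ) : Hs s := ⟨ContinuousMap.const _ c, by
  change MemSobolev s _
  refine summable_of_hasFiniteSupport ((finite_singleton (0 : ℤ)).subset fun k hk => ?_)
  by_contra hk0
  apply hk
  have h0 : k ≠ 0 := hk0
  simp [wCoeff, fCoeff_const, h0]⟩

@[simp] lemma constHs_apply (s c : ℝ) (x : UnitAddCircle) : (constHs s c) x = c := rfl

lemma norm_constHs (s c : ℝ) : |c| ≤ ‖constHs s c‖ := by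
  have h1 : ‖wCoeff s (Hs.toC (constHs s c)) 0‖ ≤ ‖Hs.toLp s (constHs s c)‖ :=
    lp.norm_apply_le_norm (by norm_num) (Hs.toLp s (constHs s c)) 0
  have h2 : ‖wCoeff s (Hs.toC (constHs s c)) 0‖ = |c| := by
    have : Hs.toC (constHs s c) = ContinuousMap.const _ c := rfl
    rw [this]
    simp [wCoeff, fCoeff_const, weight]
  rw [← h2]; exact h1

lemma hs_ext {s : ℝ} {f g : Hs s} (h : ∀ x, f x = g x) : f = g :=
  Hs.toC_injective (ContinuousMap.ext h)

lemma dx_add_const {s : ℝ} (f : Hs s) (c : ℝ) (x : UnitAddCircle) :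
    dx (f + constHs s c : Hs s) x = dx f x := by
  simp [dx]

lemma add_const_mem {s : ℝ} {φ : Hs s} (hφ : φ ∈ liftSet s) (c : ℝ) :
    φ + constHs s c ∈ liftSet s := fun x => by
  rw [dx_add_const]; exact hφ x

lemma circleMap_add_int {s : ℝ} (φ : Hs s) (n : ℤ) :
    circleMap (φ + constHs s n) = circleMap φ := by
  ext x
  have : ((n : ℝ) : UnitAddCircle) = 0 := by
    rw [AddCircle.coe_eq_zero_iff]; exact ⟨n, by simp⟩
  simp [circleMap]

/-- Two lifts of the same diffeomorphism differ by an integer. -/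
lemma circleMap_eq_iff {s : ℝ} (φ ψ : Hs s) :
    circleMap φ = circleMap ψ ↔ ∃ n : ℤ, φ = ψ + constHs s n := by
  constructor
  · intro h
    have key : ∀ x : UnitAddCircle, ∃ n : ℤ, (n : ℝ) = φ x - ψ x := by
      intro x
      have hx := congrFun h x
      simp only [circleMap, add_right_inj] at hx
      have : ((φ x - ψ x : ℝ) : UnitAddCircle) = 0 := by
        rw [AddCircle.coe_sub, hx, sub_self]
      rw [AddCircle.coe_eq_zero_iff] at this
      obtain ⟨n, hn⟩ := this
      exact ⟨n, by simpa using hn⟩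
    choose N hN using key
    have hcont : Continuous N := by
      rw [Int.isClosedEmbedding_coe_real.isEmbedding.continuous_iff]
      have : (Int.cast ∘ N : UnitAddCircle → ℝ) = fun x => φ x - ψ x := funext hN
      rw [this]
      exact (Hs.toC φ).continuous.sub (Hs.toC ψ).continuous
    refine ⟨N 0, hs_ext fun x => ?_⟩
    have hconst : N x = N 0 := PreconnectedSpace.constant inferInstance hcont
    have := hN x
    rw [hconst] at this
    simp [this]
  · rintro ⟨n, rfl⟩
    exact circleMap_add_int ψ n

lemma isOpen_liftSet {s : ℝ} (hs : 3 / 2 < s) : IsOpen (liftSet s) := by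
  rw [Metric.isOpen_iff]
  intro φ hφ
  obtain ⟨x₀, -, hx₀⟩ := isCompact_univ.exists_isMinOn (univ_nonempty)
    (continuous_dx hs φ).continuousOn
  have hC : 0 ≤ embConst s := Real.rpow_nonneg
    (tsum_nonneg fun k => Real.rpow_nonneg (weight_pos _ k).le _) _
  have hδ : 0 < 1 + dx φ x₀ := hφ x₀
  refine ⟨(1 + dx φ x₀) / (embConst s + 1), by positivity, fun ψ hψ x => ?_⟩
  have h1 : dx φ x₀ ≤ dx φ x := hx₀ (mem_univ x)
  have h2 := abs_dx_le hs (ψ - φ) x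
  have h3 : dx ψ x = dx φ x + dx (ψ - φ : Hs s) x := by
    rw [← dx_add hs]; simp
  rw [mem_ball_iff_norm] at hψ
  have h4 : embConst s * ‖ψ - φ‖ < 1 + dx φ x₀ := by
    rw [lt_div_iff₀ (by positivity)] at hψ
    nlinarith [norm_nonneg (ψ - φ)]
  have h5 := neg_abs_le (dx (ψ - φ : Hs s) x)
  rw [h3]; linarith

lemma isOpenMap_proj {s : ℝ} : IsOpenMap (proj (s := s)) := by
  intro V hV
  rw [isOpen_coinduced]
  let T : ℤ → liftSet s → liftSet s := fun n φ => ⟨φ.1 + constHs s n, add_const_mem φ.2 n⟩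
  have hT : ∀ n, Continuous (T n) := fun n =>
    (continuous_subtype_val.add continuous_const).subtype_mk _
  have : proj ⁻¹' (proj '' V) = ⋃ n, T n ⁻¹' V := by
    ext φ
    simp only [mem_preimage, mem_image, mem_iUnion]
    constructor
    · rintro ⟨ψ, hψ, h⟩
      obtain ⟨n, hn⟩ := (circleMap_eq_iff _ _).1 (congrArg Ds.toFun h)
      refine ⟨n, ?_⟩
      have : T n φ = ψ := Subtype.ext hn.symm
      rwa [this]
    · rintro ⟨n, hn⟩
      exact ⟨T n φ, hn, Ds.ext (circleMap_add_int _ _)⟩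
  rw [this]
  exact isOpen_iUnion fun n => hV.preimage (hT n)

lemma injOn_proj {s : ℝ} (φ₀ : liftSet s) : InjOn proj (Metric.ball φ₀ (1 / 2)) := by
  intro φ hφ ψ hψ h
  obtain ⟨n, hn⟩ := (circleMap_eq_iff _ _).1 (congrArg Ds.toFun h)
  have hd : dist φ ψ < 1 := by
    have := dist_triangle_right φ ψ φ₀
    rw [Metric.mem_ball] at hφ hψ
    linarith
  have hn0 : n = 0 := by
    rw [Subtype.dist_eq, dist_eq_norm, hn, add_sub_cancel_left] at hd
    have := (norm_constHs s n).trans_lt hd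
    rw [← Int.cast_abs] at this
    have : |n| < 1 := by exact_mod_cast this
    simpa using this
  refine Subtype.ext ?_
  rw [hn, hn0]
  refine hs_ext fun x => by simp

/-- The projection is a homeomorphism of a ball of radius `1/2` in the set of lifts onto an open
subset of `𝒟^s(S¹)`. -/
def localProj {s : ℝ} (φ₀ : liftSet s) : OpenPartialHomeomorph (liftSet s) (Ds s) :=
  OpenPartialHomeomorph.ofContinuousOpen
    ((injOn_proj φ₀).toPartialEquiv proj (Metric.ball φ₀ (1 / 2)))
    continuous_proj.continuousOn isOpenMap_proj Metric.isOpen_ball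

/-- The chart `id + φ ↦ φ` of `𝒟^s(S¹)` near `id + φ₀`. -/
def dsChart {s : ℝ} [hs : Fact (3 / 2 < s)] (φ₀ : liftSet s) :
    OpenPartialHomeomorph (Ds s) (Hs s) :=
  (localProj φ₀).symm.trans
    ((isOpen_liftSet hs.out).isOpenEmbedding_subtypeVal.toOpenPartialHomeomorph _)

/-- The atlas of `𝒟^s(S¹)`: the local inverses `id + φ ↦ φ` of the projection from the open set
of lifts in `H^s(S¹)`. -/
instance (s : ℝ) [Fact (3 / 2 < s)] : ChartedSpace (Hs s) (Ds s) where
  atlas := range dsChart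
  chartAt η := dsChart η.lift
  mem_chart_source η := by
    have h : proj η.lift ∈ (localProj η.lift).target :=
      (localProj η.lift).map_source (Metric.mem_ball_self (by norm_num))
    rw [Ds.proj_lift] at h
    simpa [dsChart] using h
  chart_mem_atlas η := mem_range_self _

lemma dsChart_symm_apply {s : ℝ} [Fact (3 / 2 < s)] (φ₀ : liftSet s) {φ : Hs s}
    (h : φ ∈ (dsChart φ₀).target) : ((dsChart φ₀).symm φ).toFun = circleMap φ := by
  have h' : φ ∈ liftSet s := by
    have := h.1
    simpa using this
  have e : (((isOpen_liftSet (Fact.out : 3 / 2 < s)).isOpenEmbedding_subtypeVal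
      ).toOpenPartialHomeomorph _).symm φ = ⟨φ, h'⟩ :=
    Topology.IsOpenEmbedding.toOpenPartialHomeomorph_left_inv _ _ (x := (⟨φ, h'⟩ : liftSet s))
  change (proj ((((isOpen_liftSet (Fact.out : 3 / 2 < s)).isOpenEmbedding_subtypeVal
      ).toOpenPartialHomeomorph _).symm φ)).toFun = _
  rw [e]; rfl

lemma circleMap_dsChart {s : ℝ} [Fact (3 / 2 < s)] (φ₀ : liftSet s) {η : Ds s}
    (h : η ∈ (dsChart φ₀).source) : circleMap (dsChart φ₀ η) = η.toFun := by
  rw [← dsChart_symm_apply φ₀ ((dsChart φ₀).map_source h), (dsChart φ₀).left_inv h]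

lemma dsChart_trans {s : ℝ} [Fact (3 / 2 < s)] (φ₀ φ₁ : liftSet s) {φ : Hs s}
    (h : φ ∈ ((dsChart φ₀).symm.trans (dsChart φ₁)).source) :
    ∃ n : ℤ, ((dsChart φ₀).symm.trans (dsChart φ₁)) φ = φ + constHs s n := by
  rw [OpenPartialHomeomorph.trans_source, OpenPartialHomeomorph.symm_source] at h
  rw [← circleMap_eq_iff, OpenPartialHomeomorph.coe_trans, Function.comp_apply,
    circleMap_dsChart φ₁ h.2, dsChart_symm_apply φ₀ h.1]

lemma contDiffAt_add_constHs {s : ℝ} (n : ℤ) (φ : Hs s) :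
    ContDiffAt ℝ ∞ (fun ψ : Hs s => ψ + constHs s n) φ :=
  contDiffAt_id.add contDiffAt_const

lemma constHs_int_eq {s : ℝ} {m n : ℤ} (h : ‖constHs s m - constHs s n‖ < 1) : m = n := by
  have h3 : constHs s m - constHs s n = constHs s ((m - n : ℤ) : ℝ) :=
    hs_ext fun x => by simp
  rw [h3] at h
  have h4 := (norm_constHs s _).trans_lt h
  rw [← Int.cast_abs] at h4
  have h5 : |m - n| < 1 := by exact_mod_cast h4
  rw [Int.abs_lt_one_iff] at h5
  omega

lemma eventually_translation {s : ℝ} (e : OpenPartialHomeomorph (Hs s) (Hs s))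
    (key : ∀ φ ∈ e.source, ∃ n : ℤ, e φ = φ + constHs s n) {φ : Hs s} (hφ : φ ∈ e.source)
    {n : ℤ} (hn : e φ - φ = constHs s n) : ∀ᶠ ψ in 𝓝 φ, e ψ = ψ + constHs s n := by
  have hc : ContinuousAt (fun ψ => e ψ - ψ) φ :=
    (e.continuousAt hφ).sub continuousAt_id
  have h2 : ∀ᶠ ψ in 𝓝 φ, ‖(e ψ - ψ) - constHs s n‖ < 1 := by
    rw [← hn]
    have := hc.eventually (Metric.ball_mem_nhds _ one_pos)
    filter_upwards [this] with ψ hψ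
    exact mem_ball_iff_norm.1 hψ
  filter_upwards [e.open_source.mem_nhds hφ, h2] with ψ h1 h2
  obtain ⟨m, hm⟩ := key ψ h1
  have h6 : e ψ - ψ = constHs s m := by rw [hm, add_sub_cancel_left]
  rw [h6] at h2
  rw [hm, constHs_int_eq h2]

lemma contDiffOn_of_int_translation {s : ℝ} (e : OpenPartialHomeomorph (Hs s) (Hs s))
    (key : ∀ φ ∈ e.source, ∃ n : ℤ, e φ = φ + constHs s n) : ContDiffOn ℝ ∞ e e.source := by
  intro φ hφ
  obtain ⟨n, hn⟩ := key φ hφ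
  have hev := eventually_translation e key hφ (by rw [hn, add_sub_cancel_left])
  exact ((contDiffAt_add_constHs n φ).congr_of_eventuallyEq hev).contDiffWithinAt

/-- The changes of charts are locally translations by integers. -/
instance (s : ℝ) [Fact (3 / 2 < s)] : IsManifold 𝓘(ℝ, Hs s) ∞ (Ds s) := by
  refine isManifold_of_contDiffOn _ _ _ ?_
  rintro _ _ ⟨φ₀, rfl⟩ ⟨φ₁, rfl⟩
  simp only [modelWithCornersSelf_coe, modelWithCornersSelf_coe_symm, Function.comp_id,
    Function.id_comp, preimage_id, range_id, inter_univ]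
  exact contDiffOn_of_int_translation _ fun φ hφ => dsChart_trans φ₀ φ₁ hφ

/-! ### The `μ`HS metric, its energy, and its geodesics -/

/-- The right-invariant `μ`HS metric on `𝒟^s(S¹)`,
`⟨U, V⟩_η = ∫ U ηₓ dx ∫ V ηₓ dx + ∫ Uₓ Vₓ / ηₓ dx` for `U, V ∈ T_η 𝒟^s(S¹)`.  All charts of
`𝒟^s(S¹)` agree up to a constant, so the identification `T_η 𝒟^s(S¹) = H^s(S¹)` is canonical. -/
def metric {s : ℝ} [Fact (3 / 2 < s)] (η : Ds s) (U V : TangentSpace 𝓘(ℝ, Hs s) η) : ℝ :=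
  let U' : Hs s := U
  let V' : Hs s := V
  (∫ x, U' x * η.dx x) * (∫ x, V' x * η.dx x) + ∫ x, dx U' x * dx V' x / η.dx x

/-- The velocity `γ'(t)` of a path `γ : [0,1] → 𝒟^s(S¹)`. -/
def velocity {s : ℝ} [Fact (3 / 2 < s)] (γ : ℝ → Ds s) (t : ℝ) : TangentSpace 𝓘(ℝ, Hs s) (γ t) :=
  mfderivWithin 𝓘(ℝ, ℝ) 𝓘(ℝ, Hs s) γ (Icc 0 1) t (1 : ℝ)

/-- The energy `E(γ) = ½ ∫₀¹ ⟨γ'(t), γ'(t)⟩ dt` of a path. -/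
def energy {s : ℝ} [Fact (3 / 2 < s)] (γ : ℝ → Ds s) : ℝ :=
  1 / 2 * ∫ t in (0 : ℝ)..1, metric (γ t) (velocity γ t) (velocity γ t)

/-- `Γ` is a `C²` variation `(ε, t) ↦ Γ ε t`, `|ε| < δ`, `0 ≤ t ≤ 1`, with fixed end points, of
the path `γ`. -/
structure IsProperVariation {s : ℝ} [Fact (3 / 2 < s)] (γ : ℝ → Ds s) (Γ : ℝ → ℝ → Ds s)
    (δ : ℝ) : Prop where
  contMDiffOn : ContMDiffOn 𝓘(ℝ, ℝ × ℝ) 𝓘(ℝ, Hs s) 2 (fun p : ℝ × ℝ => Γ p.1 p.2)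
    (Ioo (-δ) δ ×ˢ Icc 0 1)
  zero : ∀ t ∈ Icc (0 : ℝ) 1, Γ 0 t = γ t
  left : ∀ ε ∈ Ioo (-δ) δ, Γ ε 0 = γ 0
  right : ∀ ε ∈ Ioo (-δ) δ, Γ ε 1 = γ 1

/-- A geodesic `γ : [0,1] → 𝒟^s(S¹)` of the `μ`HS metric: a `C²` path which is a critical point of
the energy among paths with the same end points.  (Only the values of `γ` on `[0,1]` matter.) -/
structure IsGeodesic {s : ℝ} [Fact (3 / 2 < s)] (γ : ℝ → Ds s) : Prop where
  contMDiffOn : ContMDiffOn 𝓘(ℝ, ℝ) 𝓘(ℝ, Hs s) 2 γ (Icc 0 1)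
  critical : ∀ δ > 0, ∀ Γ : ℝ → ℝ → Ds s, IsProperVariation γ Γ δ →
    HasDerivAt (fun ε => energy (Γ ε)) 0 0

/-- `γ` is a geodesic on `[0,1]` with `γ(0) = id` and initial velocity
`γ'(0) = u ∈ T_id 𝒟^s(S¹) = H^s(S¹)`. -/
structure IsGeodesicFromId {s : ℝ} [Fact (3 / 2 < s)] (u : Hs s) (γ : ℝ → Ds s) : Prop where
  isGeodesic : IsGeodesic γ
  initial : γ 0 = Ds.id s
  velocity_initial : velocity γ 0 = u

end MuHS

end

/-!
The energy is studied on lifts `id + φ(t)`, where `φ` is a path in the open subset `liftSet s` of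
`H^s(S¹)`; paths and their variations lift because `proj` is a covering map, and they are as smooth
as their lifts (`contMDiffWithinAt_iff_lift`). Write `V = φ_t`, `ηₓ = 1 + φₓ`, `p = ∫ V ηₓ` for the
mean of the Eulerian velocity and `q = Vₓ / ηₓ`, so that the speed squared is `p² + ∫ q Vₓ`. The
first variation of the energy, tested with products of functions of time and of space, shows that
the lifts of geodesics are the solutions of
`p' = 0`, `q' = 2 p V + c - q² / 2`,
where `c` depends on time only (`IsGeodesic.exists_solution`, `SolvesGeodesicEq.isGeodesic`). The
function `c` is determined by `∫ q ηₓ = ∫ Vₓ = 0`.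

*Uniqueness.* In the unknowns `(ηₓ, q)` this is an equation in the Banach algebra `C(S¹)` with a
locally Lipschitz right-hand side, as `V` is recovered from `Vₓ = q ηₓ` and `∫ V ηₓ = p`.
Grönwall's inequality applies (`SolvesGeodesicEq.eqOn`).

*Existence.* Equivalently, the acceleration `A = V_t` satisfies
`Aₓ = Vₓ² / (2 ηₓ) + (2 p V + c) ηₓ` and `∫ A ηₓ = 0`. No derivative is lost: as `s - 1 > 1/2`, the space `H^{s-1}(S¹)` is a Banach
algebra, by Young's inequality for the Fourier coefficients, the right-hand side belongs to it, and
integration in space leads back to `H^s(S¹)`. Hence `A` is a `C¹` function of the curve `V` in the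
Banach space `C([0, 1], H^s(S¹))`, near `V = 0`, and it vanishes to second order at `V = 0` since
`Aₓ` is quadratic in `V` to leading order (`isFlat_curveAcc`). The map `V ↦ V - ∫₀ᵗ A` is therefore
tangent to the identity at `0`, and the inverse function theorem gives the solution `V` with
initial velocity `u`, for small `u`, as a `C¹` function of `u`. Finally `u ↦ ∫₀¹ V` is the
exponential map in a chart, and it is again tangent to the identity at `0` (`exists_lift_exp`), so
that a second application of the inverse function theorem shows it to be a `C¹` diffeomorphism near
`0`.
-/

noncomputable section

namespace MuHS

/-! ### Fourier coefficients and Fourier synthesis -/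

open scoped ComplexConjugate

/-- The `k`-th Fourier coefficient as a continuous linear functional on `C(S¹, ℂ)`. -/
def fourierCoeffCLM (k : ℤ) : C(UnitAddCircle, ℂ) →L[ℂ] ℂ :=
  LinearMap.mkContinuous
    { toFun := fun f => fourierCoeff f k
      map_add' := fun f g => by
        have hi : ∀ f : C(UnitAddCircle, ℂ), Integrable f (AddCircle.haarAddCircle (T := 1)) :=
          fun f => f.continuous.integrable_of_hasCompactSupport
            (HasCompactSupport.of_compactSpace _)
        rw [ContinuousMap.coe_add, fourierCoeff.add (hi f) (hi g)]; rfl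
      map_smul' := fun c f => by
        rw [ContinuousMap.coe_smul, fourierCoeff.const_smul]; rfl } 1 (by
    intro f
    rw [one_mul, LinearMap.coe_mk, AddHom.coe_mk, fourierCoeff]
    refine (norm_integral_le_of_norm_le_const (C := ‖f‖) ?_).trans (by simp)
    refine Eventually.of_forall fun x => ?_
    rw [norm_smul, fourier_apply, Circle.norm_coe, one_mul]
    exact f.norm_coe_le_norm x)

lemma fourierCoeffCLM_apply (k : ℤ) (f : C(UnitAddCircle, ℂ)) :
    fourierCoeffCLM k f = fourierCoeff f k := rfl

/-- Complexification `C(S¹, ℝ) → C(S¹, ℂ)` as a continuous linear map. -/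
def toComplexCLM : C(UnitAddCircle, ℝ) →L[ℝ] C(UnitAddCircle, ℂ) :=
  Complex.ofRealCLM.compLeftContinuous ℝ UnitAddCircle

/-- The real part `C(S¹, ℂ) → C(S¹, ℝ)` as a continuous linear map. -/
def reCLM : C(UnitAddCircle, ℂ) →L[ℝ] C(UnitAddCircle, ℝ) :=
  Complex.reCLM.compLeftContinuous ℝ UnitAddCircle

/-- The `k`-th Fourier coefficient as a continuous linear functional on `C(S¹, ℝ)`. -/
def fCoeffCLM (k : ℤ) : C(UnitAddCircle, ℝ) →L[ℝ] ℂ :=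
  ((fourierCoeffCLM k).restrictScalars ℝ).comp toComplexCLM

lemma fCoeffCLM_apply (k : ℤ) (f : C(UnitAddCircle, ℝ)) : fCoeffCLM k f = fCoeff f k := rfl

lemma fCoeff_neg_index (f : C(UnitAddCircle, ℝ)) (k : ℤ) :
    fCoeff f (-k) = conj (fCoeff f k) := by
  rw [fCoeff, fCoeff, fourierCoeff, fourierCoeff, ← integral_conj]
  refine integral_congr_ae (Eventually.of_forall fun x => ?_)
  simp only [smul_eq_mul, map_mul, Complex.conj_ofReal]
  rw [← fourier_neg]

lemma volume_eq_haar : (volume : Measure UnitAddCircle) = AddCircle.haarAddCircle (T := 1) := by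
  rw [AddCircle.volume_eq_smul_haarAddCircle]; simp

lemma fCoeff_zero_index (f : C(UnitAddCircle, ℝ)) : fCoeff f 0 = ((∫ x, f x : ℝ) : ℂ) := by
  rw [fCoeff, fourierCoeff, ← volume_eq_haar]
  simp only [neg_zero, fourier_zero, one_smul]
  exact integral_ofReal

lemma summable_wCoeff_sq {r : ℝ} (f : Hs r) :
    Summable fun k => ‖wCoeff r (Hs.toC f) k‖ ^ 2 := f.mem

lemma norm_sq_eq_tsum_wCoeff {r : ℝ} (f : Hs r) :
    ‖f‖ ^ 2 = ∑' k, ‖wCoeff r (Hs.toC f) k‖ ^ 2 := by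
  have h : ‖f‖ = ‖Hs.toLp r f‖ := rfl
  have := lp.norm_rpow_eq_tsum (p := 2) (by norm_num) (Hs.toLp r f)
  simp only [ENNReal.toReal_ofNat, Real.rpow_two] at this
  rw [h, this]
  rfl

lemma norm_wCoeff (r : ℝ) (f : C(UnitAddCircle, ℝ)) (k : ℤ) :
    ‖wCoeff r f k‖ = weight r k * ‖fCoeff f k‖ := by
  rw [wCoeff, norm_smul, Real.norm_of_nonneg (weight_pos r k).le]

lemma weight_neg_index (r : ℝ) (k : ℤ) : weight r (-k) = weight r k := by simp [weight]

lemma weight_add (a b : ℝ) (k : ℤ) : weight (a + b) k = weight a k * weight b k := by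
  rw [weight, weight, weight, ← Real.rpow_add (by positivity)]; congr 1; ring

/-- A weighted square summable sequence is summable, if the weight has order `r > 1/2`, by the
Cauchy–Schwarz inequality. -/
lemma summable_of_weighted {r : ℝ} (hr : 1 / 2 < r) {c : ℤ → ℝ} (hc : ∀ k, 0 ≤ c k)
    (h : Summable fun k => (weight r k * c k) ^ 2) :
    Summable c ∧ ∑' k, c k ≤ embConst (r + 1) * (∑' k, (weight r k * c k) ^ 2) ^ ((1 : ℝ) / 2) := by
  have key := Real.summable_and_inner_le_Lp_mul_Lq_tsum_of_nonneg Real.HolderConjugate.two_two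
    (fun k => (weight_pos (1 - (r + 1)) k).le)
    (fun k => mul_nonneg (weight_pos r k).le (hc k))
    (summable_weight (s := r + 1) (by linarith)) (by simpa using h)
  have e : (fun k : ℤ => weight (1 - (r + 1)) k * (weight r k * c k)) = c := by
    ext k
    rw [← mul_assoc, ← weight_add]
    simp [weight]
  rw [e] at key
  simpa [embConst] using key

lemma embConst_nonneg (s : ℝ) : 0 ≤ embConst s := Real.rpow_nonneg
  (tsum_nonneg fun k => Real.rpow_nonneg (weight_pos _ k).le _) _

lemma summable_norm_fCoeff {r : ℝ} (hr : 1 / 2 < r) (f : Hs r) :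
    (Summable fun k => ‖fCoeff (Hs.toC f) k‖) ∧
      ∑' k, ‖fCoeff (Hs.toC f) k‖ ≤ embConst (r + 1) * ‖f‖ := by
  have h := summable_of_weighted hr (fun k => norm_nonneg (fCoeff (Hs.toC f) k))
    (by simpa only [← norm_wCoeff] using summable_wCoeff_sq f)
  refine ⟨h.1, h.2.trans (le_of_eq ?_)⟩
  simp only [← norm_wCoeff]
  rw [← norm_sq_eq_tsum_wCoeff, ← Real.sqrt_eq_rpow, Real.sqrt_sq (norm_nonneg _)]

lemma hs_ext_fCoeff {r : ℝ} {f g : Hs r}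
    (h : ∀ k, fCoeff (Hs.toC f) k = fCoeff (Hs.toC g) k) : f = g := by
  apply Hs.toLp_injective
  refine Subtype.ext ?_
  change wCoeff r (Hs.toC f) = wCoeff r (Hs.toC g)
  ext k
  simp [wCoeff, h]

/-- The Fourier coefficients of `Re (c e_k)`. -/
lemma fCoeff_re_smul_fourier (c : ℂ) (k n : ℤ) :
    fCoeff (reCLM (c • fourier k)) n =
      ((if n = k then c else 0) + (if -n = k then conj c else 0)) / 2 := by
  have h : toComplex (reCLM (c • fourier k)) =
      (1 / 2 : ℂ) • (c • fourier k + conj c • fourier (-k)) := by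
    ext x
    have : ((reCLM (c • fourier k) x : ℝ) : ℂ) = (((c * fourier k x).re : ℝ) : ℂ) := rfl
    rw [toComplex, ContinuousMap.coe_mk, this, Complex.re_eq_add_conj]
    simp
    ring
  have hk (m : ℤ) : fourierCoeffCLM n (fourier m) = if n = m then 1 else 0 := by
    rw [fourierCoeffCLM_apply, fourierCoeff_fourier, Pi.single_apply]
  rw [fCoeff_eq, ← fourierCoeffCLM_apply, h]
  simp only [map_smul, map_add, hk]
  have : (n = -k) ↔ (-n = k) := by omega
  simp only [this, smul_eq_mul]
  split_ifs <;> ring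

/-- Fourier synthesis: a conjugation symmetric sequence of weighted square summable coefficients
is the sequence of Fourier coefficients of an element of `H^r(S¹)`. -/
lemma exists_hs_of_coeff {r : ℝ} (hr : 1 / 2 < r) (c : ℤ → ℂ) (hc : ∀ k, c (-k) = conj (c k))
    (h : Summable fun k => (weight r k * ‖c k‖) ^ 2) :
    ∃ f : Hs r, ∀ k, fCoeff (Hs.toC f) k = c k := by
  have hs := (summable_of_weighted hr (fun k => norm_nonneg (c k)) h).1
  have hF : Summable fun k => reCLM (c k • fourier k) := by
    have h1 : Summable fun k => (c k • fourier k : C(UnitAddCircle, ℂ)) := by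
      refine Summable.of_norm ?_
      simpa [norm_smul, fourier_norm] using hs
    exact h1.map reCLM reCLM.continuous
  have hco : ∀ n, fCoeff (∑' k, reCLM (c k • fourier k)) n = c n := by
    intro n
    have h1 := hF.hasSum.mapL (fCoeffCLM n)
    simp only [fCoeffCLM_apply, fCoeff_re_smul_fourier] at h1
    have h2 : HasSum (fun k => ((if n = k then c k else 0) +
        (if -n = k then conj (c k) else 0)) / 2) ((c n + conj (c (-n))) / 2) := by
      refine HasSum.div_const (HasSum.add ?_ ?_) 2
      · refine (hasSum_ite_eq n (c n)).congr_fun fun k => ?_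
        by_cases hk : n = k
        · subst hk; simp
        · rw [if_neg hk, if_neg (Ne.symm hk)]
      · refine (hasSum_ite_eq (-n) (conj (c (-n)))).congr_fun fun k => ?_
        by_cases hk : -n = k
        · subst hk; simp
        · rw [if_neg hk, if_neg (Ne.symm hk)]
    rw [h1.unique h2, hc]; simp
  refine ⟨⟨∑' k, reCLM (c k • fourier k), ?_⟩, hco⟩
  change Summable _
  simp only [norm_wCoeff, hco]
  exact h

/-- The image of `H^r(S¹)` in `ℓ²` consists of the conjugation symmetric sequences. -/
lemma range_toLp {r : ℝ} (hr : 1 / 2 < r) :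
    range (Hs.toLp r) = {a | ∀ k : ℤ, a (-k) = conj (a k)} := by
  ext a
  constructor
  · rintro ⟨f, rfl⟩ k
    change wCoeff r (Hs.toC f) (-k) = conj (wCoeff r (Hs.toC f) k)
    simp [wCoeff, weight_neg_index, fCoeff_neg_index]
  · intro ha
    have hn (k : ℤ) : weight r k * ‖((weight r k)⁻¹ : ℝ) • a k‖ = ‖a k‖ := by
      rw [norm_smul, norm_inv, Real.norm_of_nonneg (weight_pos r k).le,
        mul_inv_cancel_left₀ (weight_pos r k).ne']
    obtain ⟨f, hf⟩ := exists_hs_of_coeff hr (fun k => ((weight r k)⁻¹ : ℝ) • a k)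
      (fun k => by
        have := ha k
        simp [weight_neg_index, this]) (by
        simp only [hn]
        simpa using (memℓp_gen_iff (p := 2) (by norm_num)).1 a.2)
    refine ⟨f, Subtype.ext (funext fun k => ?_)⟩
    change weight r k • fCoeff (Hs.toC f) k = a k
    rw [hf, smul_inv_smul₀ (weight_pos r k).ne']

lemma isometry_toLp (r : ℝ) : Isometry (Hs.toLp r) :=
  AddMonoidHomClass.isometry_of_norm _ fun _ => rfl

lemma completeSpace_hs {r : ℝ} (hr : 1 / 2 < r) : CompleteSpace (Hs r) := by
  rw [completeSpace_iff_isComplete_range (isometry_toLp r).isUniformInducing, range_toLp hr]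
  refine IsClosed.isComplete ?_
  simp only [ofPred_forall]
  refine isClosed_iInter fun k => isClosed_eq ?_ ?_
  · exact (lp.evalCLM ℝ _ 2 (-k)).continuous
  · exact Complex.continuous_conj.comp (lp.evalCLM ℝ (fun _ : ℤ => ℂ) 2 k).continuous

/-! ### The Banach algebra `H^r(S¹)`, `r > 1/2` -/

lemma memSobolev_of_le {r : ℝ} {h : C(UnitAddCircle, ℝ)} (y : lp (fun _ : ℤ => ℝ) 2)
    (hy : ∀ k, ‖wCoeff r h k‖ ≤ y k) : MemSobolev r h := by
  have hs : Summable fun k => ‖y k‖ ^ 2 := by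
    simpa using (memℓp_gen_iff (p := 2) (by norm_num)).1 y.2
  refine Summable.of_nonneg_of_le (fun k => by positivity) (fun k => ?_) hs
  have := (hy k).trans (le_abs_self _)
  exact pow_le_pow_left₀ (norm_nonneg _) this 2

lemma norm_le_of_wCoeff_le {r : ℝ} (h : Hs r) (y : lp (fun _ : ℤ => ℝ) 2)
    (hy : ∀ k, ‖wCoeff r (Hs.toC h) k‖ ≤ y k) : ‖h‖ ≤ ‖y‖ := by
  have hs : Summable fun k => ‖y k‖ ^ 2 := by
    simpa using (memℓp_gen_iff (p := 2) (by norm_num)).1 y.2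
  have h2 := lp.norm_rpow_eq_tsum (p := 2) (by norm_num) y
  simp only [ENNReal.toReal_ofNat, Real.rpow_two] at h2
  refine le_of_sq_le_sq ?_ (norm_nonneg _)
  rw [norm_sq_eq_tsum_wCoeff, h2]
  refine (summable_wCoeff_sq h).tsum_le_tsum (fun k => ?_) hs
  have := (hy k).trans (le_abs_self _)
  exact pow_le_pow_left₀ (norm_nonneg _) this 2

/-- The sequence of the absolute values of the weighted Fourier coefficients, in `ℓ²`. -/
def absCoeff {r : ℝ} (f : Hs r) : lp (fun _ : ℤ => ℝ) 2 :=
  ⟨fun k => ‖wCoeff r (Hs.toC f) k‖, (memℓp_gen_iff (by norm_num)).2 (by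
    simpa using summable_wCoeff_sq f)⟩

lemma absCoeff_apply {r : ℝ} (f : Hs r) (k : ℤ) :
    absCoeff f k = ‖wCoeff r (Hs.toC f) k‖ := rfl

lemma norm_absCoeff {r : ℝ} (f : Hs r) : ‖absCoeff f‖ = ‖f‖ := by
  have h2 := lp.norm_rpow_eq_tsum (p := 2) (by norm_num) (absCoeff f)
  simp only [ENNReal.toReal_ofNat, Real.rpow_two, absCoeff_apply, norm_norm] at h2
  rw [← norm_sq_eq_tsum_wCoeff] at h2
  exact (sq_eq_sq₀ (norm_nonneg _) (norm_nonneg _)).1 h2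

/-- Young's inequality `ℓ¹ * ℓ² ⊂ ℓ²`: the convolution is a superposition of translates. -/
lemma exists_convolution {a : ℤ → ℝ} (ha : Summable fun j => ‖a j‖) (b : lp (fun _ : ℤ => ℝ) 2) :
    ∃ y : lp (fun _ : ℤ => ℝ) 2, (∀ k, HasSum (fun j => a j * b (k - j)) (y k)) ∧
      ‖y‖ ≤ (∑' j, ‖a j‖) * ‖b‖ := by
  have hb : Summable fun k => ‖b k‖ ^ (2 : ℝ) := by
    simpa using (memℓp_gen_iff (p := 2) (by norm_num)).1 b.2
  let sh (j : ℤ) : lp (fun _ : ℤ => ℝ) 2 := ⟨fun k => b (k - j),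
    (memℓp_gen_iff (by norm_num)).2 <| by
      simpa [Function.comp_def] using (Equiv.subRight j).summable_iff.2 hb⟩
  have hsh (j : ℤ) : ‖sh j‖ = ‖b‖ := by
    rw [lp.norm_eq_tsum_rpow (by norm_num), lp.norm_eq_tsum_rpow (by norm_num)]
    congr 1
    exact (Equiv.subRight j).tsum_eq (fun k => ‖b k‖ ^ (2 : ℝ≥0∞).toReal)
  have hs : Summable fun j => ‖a j • sh j‖ := by
    simp only [norm_smul, hsh]
    exact ha.mul_right _
  refine ⟨∑' j, a j • sh j, fun k => ?_, ?_⟩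
  · exact hs.of_norm.hasSum.mapL (lp.evalCLM ℝ (fun _ : ℤ => ℝ) 2 k)
  · refine (norm_tsum_le_tsum_norm hs).trans (le_of_eq ?_)
    simp only [norm_smul, hsh]
    rw [tsum_mul_right]

/-- The Fourier coefficients of a product. -/
lemma hasSum_fCoeff_mul {f : C(UnitAddCircle, ℝ)} (hf : Summable fun k => ‖fCoeff f k‖)
    (g : C(UnitAddCircle, ℝ)) (k : ℤ) :
    HasSum (fun j => fCoeff f j * fCoeff g (k - j)) (fCoeff (f * g) k) := by
  have h1 : HasSum (fun j => fourierCoeff (toComplex f) j • fourier j) (toComplex f) :=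
    hasSum_fourier_series_of_summable hf.of_norm
  have h2 := (h1.mul_right (toComplex g)).mapL (fourierCoeffCLM k)
  have e : toComplex f * toComplex g = toComplex (f * g) := by
    ext x; simp [toComplex]
  rw [e] at h2
  convert! h2 using 2 with j
  rw [smul_mul_assoc, map_smul, smul_eq_mul, fourierCoeffCLM_apply]
  congr 1
  rw [fCoeff_eq, fourierCoeff, fourierCoeff]
  refine integral_congr_ae (Eventually.of_forall fun x => ?_)
  simp only [ContinuousMap.mul_apply, smul_eq_mul, ← mul_assoc, ← fourier_add]
  congr 3; ring

lemma weight_le_add {r : ℝ} (hr : 0 ≤ r) (j k : ℤ) :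
    weight r k ≤ 4 ^ (r / 2) * (weight r j + weight r (k - j)) := by
  have h : weight r k ≤ 4 ^ (r / 2) * max (weight r j) (weight r (k - j)) := by
    have hm : max (weight r j) (weight r (k - j)) =
        (max (1 + (2 * Real.pi * (j : ℝ)) ^ 2) (1 + (2 * Real.pi * ((k - j : ℤ) : ℝ)) ^ 2)) ^
          (r / 2) := by
      rcases le_total (1 + (2 * Real.pi * (j : ℝ)) ^ 2)
        (1 + (2 * Real.pi * ((k - j : ℤ) : ℝ)) ^ 2) with h | h
      · rw [max_eq_right h, max_eq_right]; rfl
        exact Real.rpow_le_rpow (by positivity) h (by linarith)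
      · rw [max_eq_left h, max_eq_left]; rfl
        exact Real.rpow_le_rpow (by positivity) h (by linarith)
    rw [hm, ← Real.mul_rpow (by norm_num) (by positivity)]
    refine Real.rpow_le_rpow (by positivity) ?_ (by linarith)
    have e : 2 * Real.pi * (k : ℝ) =
      2 * Real.pi * (j : ℝ) + 2 * Real.pi * ((k - j : ℤ) : ℝ) := by push_cast; ring
    rw [e]
    generalize 2 * Real.pi * (j : ℝ) = x
    generalize 2 * Real.pi * ((k - j : ℤ) : ℝ) = y
    have h1 := le_max_left (1 + x ^ 2) (1 + y ^ 2)
    have h2 := le_max_right (1 + x ^ 2) (1 + y ^ 2)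
    nlinarith [sq_nonneg (x - y)]
  refine h.trans ?_
  gcongr
  exact max_le (le_add_of_nonneg_right (weight_pos _ _).le)
    (le_add_of_nonneg_left (weight_pos _ _).le)

/-- The constant in the product estimate of `H^r(S¹)`; the summand `1` only serves to make it
positive. -/
def mulConst (r : ℝ) : ℝ := 4 ^ (r / 2) * (2 * embConst (r + 1)) + 1

lemma mulConst_pos (r : ℝ) : 0 < mulConst r := by
  have := embConst_nonneg (r + 1)
  unfold mulConst; positivity

/-- The product estimate: `⟨k⟩^r ≲ ⟨j⟩^r + ⟨k - j⟩^r`, Young's inequality and `H^r ⊂ ℓ¹`. -/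
lemma exists_mul_bound {r : ℝ} (hr : 1 / 2 < r) (f g : Hs r) :
    ∃ y : lp (fun _ : ℤ => ℝ) 2, (∀ k, ‖wCoeff r (Hs.toC f * Hs.toC g) k‖ ≤ y k) ∧
      ‖y‖ ≤ mulConst r * ‖f‖ * ‖g‖ := by
  obtain ⟨hf, hf'⟩ := summable_norm_fCoeff hr f
  obtain ⟨hg, hg'⟩ := summable_norm_fCoeff hr g
  obtain ⟨y, hy, hyn⟩ := exists_convolution hf.norm (absCoeff g)
  obtain ⟨z, hz, hzn⟩ := exists_convolution hg.norm (absCoeff f)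
  simp only [norm_norm, norm_absCoeff] at hyn hzn
  refine ⟨((4 : ℝ) ^ (r / 2)) • (y + z), fun k => ?_, ?_⟩
  · have hz' : HasSum (fun j => ‖fCoeff (Hs.toC g) (k - j)‖ * absCoeff f j) (z k) := by
      have := (Equiv.subLeft k).hasSum_iff.2 (hz k)
      simpa [Function.comp_def] using this
    have h1 := ((hy k).add hz').mul_left ((4 : ℝ) ^ (r / 2))
    have h2 := (hasSum_fCoeff_mul hf (Hs.toC g) k).const_smul (weight r k)
    refine le_trans (le_of_eq ?_) (tsum_of_norm_bounded h1 (fun j => ?_)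
      (f := fun j => weight r k • (fCoeff (Hs.toC f) j * fCoeff (Hs.toC g) (k - j))))
    · rw [h2.tsum_eq]; rfl
    · rw [norm_smul, norm_mul, Real.norm_of_nonneg (weight_pos r k).le, absCoeff_apply,
        absCoeff_apply, norm_wCoeff, norm_wCoeff]
      calc _ ≤ 4 ^ (r / 2) * (weight r j + weight r (k - j)) *
            (‖fCoeff (Hs.toC f) j‖ * ‖fCoeff (Hs.toC g) (k - j)‖) := by
            gcongr; exact weight_le_add (by linarith) j k
        _ = _ := by ring
  · rw [norm_smul, Real.norm_of_nonneg (by positivity)]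
    calc 4 ^ (r / 2) * ‖y + z‖
        ≤ 4 ^ (r / 2) * (embConst (r + 1) * ‖f‖ * ‖g‖ + embConst (r + 1) * ‖g‖ * ‖f‖) := by
          gcongr
          refine (norm_add_le _ _).trans (add_le_add (hyn.trans ?_) (hzn.trans ?_))
          · gcongr
          · gcongr
      _ ≤ mulConst r * ‖f‖ * ‖g‖ := by
          have : 0 ≤ ‖f‖ * ‖g‖ := by positivity
          unfold mulConst; nlinarith

lemma memSobolev_one (r : ℝ) : MemSobolev r 1 := (constHs r 1).mem

/-- `H^r(S¹)`, `r > 1/2`, as a subalgebra of `C(S¹)`. -/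
def sobolevSubalgebra (r : ℝ) [hr : Fact (1 / 2 < r)] : Subalgebra ℝ C(UnitAddCircle, ℝ) :=
  (sobolevSubmodule r).toSubalgebra (memSobolev_one r) fun f g hf hg =>
    memSobolev_of_le _ (exists_mul_bound hr.out (⟨f, hf⟩ : Hs r) ⟨g, hg⟩).choose_spec.1

/-- The Banach algebra `H^r(S¹)`, `r > 1/2`. Its norm is a multiple of the `H^r` norm, chosen such
that it is submultiplicative. -/
def HAlg (r : ℝ) [Fact (1 / 2 < r)] : Type := sobolevSubalgebra r

section HAlg

variable {r : ℝ} [hr : Fact (1 / 2 < r)]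

instance : CommRing (HAlg r) := inferInstanceAs (CommRing (sobolevSubalgebra r))
instance : Algebra ℝ (HAlg r) := inferInstanceAs (Algebra ℝ (sobolevSubalgebra r))

/-- The identity map `HAlg r → H^r(S¹)`. -/
def HAlg.toHsₗ : HAlg r ≃ₗ[ℝ] Hs r where
  toFun f := ⟨f.1, f.2⟩
  map_add' _ _ := rfl
  map_smul' _ _ := rfl
  invFun f := ⟨f.1, f.2⟩

instance : NormedAddCommGroup (HAlg r) :=
  NormedAddCommGroup.induced (HAlg r) (Hs r)
    ((mulConst r) • (HAlg.toHsₗ (r := r)).toLinearMap) fun f g h => by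
      have h' : mulConst r • HAlg.toHsₗ f = mulConst r • HAlg.toHsₗ g := h
      exact HAlg.toHsₗ.injective (smul_right_injective _ (mulConst_pos r).ne' h')

lemma HAlg.norm_def (f : HAlg r) : ‖f‖ = mulConst r * ‖HAlg.toHsₗ f‖ := by
  have : ‖f‖ = ‖mulConst r • HAlg.toHsₗ f‖ := rfl
  rw [this, norm_smul, Real.norm_of_nonneg (mulConst_pos r).le]

instance : NormedCommRing (HAlg r) where
  dist_eq := NormedAddCommGroup.dist_eq
  mul_comm := mul_comm
  norm_mul_le f g := by
    obtain ⟨y, hy, hyn⟩ := exists_mul_bound hr.out (HAlg.toHsₗ f) (HAlg.toHsₗ g)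
    have h := norm_le_of_wCoeff_le (HAlg.toHsₗ (f * g)) y hy
    rw [HAlg.norm_def, HAlg.norm_def, HAlg.norm_def]
    have := mulConst_pos r
    calc mulConst r * ‖HAlg.toHsₗ (f * g)‖
        ≤ mulConst r * (mulConst r * ‖HAlg.toHsₗ f‖ * ‖HAlg.toHsₗ g‖) := by
          gcongr; exact h.trans hyn
      _ = _ := by ring

instance : NormedAlgebra ℝ (HAlg r) where
  norm_smul_le c f := by
    rw [HAlg.norm_def, HAlg.norm_def, map_smul, norm_smul]
    exact le_of_eq (by ring)

/-- `HAlg r` and `H^r(S¹)` are the same topological vector space. -/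
def HAlg.toHs : HAlg r ≃L[ℝ] Hs r :=
  HAlg.toHsₗ.toContinuousLinearEquivOfBounds (mulConst r)⁻¹ (mulConst r)
    (fun f => by
      rw [HAlg.norm_def, inv_mul_cancel_left₀ (mulConst_pos r).ne'])
    (fun f => by
      rw [HAlg.norm_def]; simp)

instance : CompleteSpace (HAlg r) :=
  have := completeSpace_hs hr.out
  (completeSpace_congr (e := HAlg.toHs.toEquiv) HAlg.toHs.isUniformEmbedding).2 this

end HAlg

/-! ### Differentiation and integration between `H^s(S¹)` and `H^{s-1}(S¹)` -/

lemma hasSum_fourier_hs {r : ℝ} (hr : 1 / 2 < r) (f : Hs r) (x : UnitAddCircle) :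
    HasSum (fun k => fCoeff (Hs.toC f) k * fourier k x) ((f x : ℝ) : ℂ) := by
  have h : Summable (fourierCoeff (toComplex (Hs.toC f))) :=
    (summable_norm_fCoeff hr f).1.of_norm
  exact has_pointwise_sum_fourier_series_of_summable h x

lemma norm_toC_le {r : ℝ} (hr : 1 / 2 < r) (f : Hs r) :
    ‖Hs.toC f‖ ≤ embConst (r + 1) * ‖f‖ := by
  obtain ⟨h1, h2⟩ := summable_norm_fCoeff hr f
  refine (ContinuousMap.norm_le _ (by have := embConst_nonneg (r + 1); positivity)).2
    fun x => ?_
  have h3 := tsum_of_norm_bounded (f := fun k => fCoeff (Hs.toC f) k * fourier k x)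
    h1.hasSum (fun k => by
      rw [norm_mul, fourier_apply, Circle.norm_coe, mul_one])
  rw [(hasSum_fourier_hs hr f x).tsum_eq, Complex.norm_real] at h3
  exact h3.trans h2

/-- The embedding `H^r(S¹) ⊂ C(S¹)`, `r > 1/2`. -/
def Hs.toCCLM {r : ℝ} (hr : 1 / 2 < r) : Hs r →L[ℝ] C(UnitAddCircle, ℝ) :=
  LinearMap.mkContinuous Hs.toC (embConst (r + 1)) (norm_toC_le hr)

/-- Fourier multipliers `H^r(S¹) → H^{r'}(S¹)`. -/
lemma exists_multiplier {r r' C : ℝ} (hr' : 1 / 2 < r') (m : ℤ → ℂ)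
    (hm : ∀ k, m (-k) = conj (m k)) (hC : 0 ≤ C)
    (h : ∀ k, ‖m k‖ * weight r' k ≤ C * weight r k) :
    ∃ L : Hs r →L[ℝ] Hs r', ∀ f k, fCoeff (Hs.toC (L f)) k = m k * fCoeff (Hs.toC f) k := by
  have hle (f : Hs r) (k : ℤ) :
      weight r' k * ‖m k * fCoeff (Hs.toC f) k‖ ≤ (C • absCoeff f : lp (fun _ : ℤ => ℝ) 2) k := by
    have e : (C • absCoeff f : lp (fun _ : ℤ => ℝ) 2) k =
      C * (weight r k * ‖fCoeff (Hs.toC f) k‖) := by rw [← norm_wCoeff]; rfl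
    rw [e, norm_mul, ← mul_assoc, ← mul_assoc, mul_comm (weight r' k)]
    exact mul_le_mul_of_nonneg_right (h k) (norm_nonneg _)
  have hsum (f : Hs r) : Summable fun k => (weight r' k * ‖m k * fCoeff (Hs.toC f) k‖) ^ 2 := by
    have h1 := (summable_wCoeff_sq f).mul_left (C ^ 2)
    refine Summable.of_nonneg_of_le (fun k => by positivity) (fun k => ?_) h1
    rw [← mul_pow]
    have := (weight_pos r' k).le
    exact pow_le_pow_left₀ (by positivity) (hle f k) 2
  have hex (f : Hs r) := exists_hs_of_coeff hr' (fun k => m k * fCoeff (Hs.toC f) k)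
    (fun k => by simp [hm, fCoeff_neg_index]) (hsum f)
  choose L hL using hex
  refine ⟨LinearMap.mkContinuous
    { toFun := L
      map_add' := fun f g => hs_ext_fCoeff fun k => by
        simp only [hL, map_add, fCoeff_add, mul_add]
      map_smul' := fun c f => hs_ext_fCoeff fun k => by
        simp only [hL, map_smul, fCoeff_smul, RingHom.id_apply, mul_smul_comm] } C ?_, hL⟩
  intro f
  have := norm_le_of_wCoeff_le (L f) (C • absCoeff f) fun k => by
    rw [norm_wCoeff, hL]; exact hle f k
  rwa [norm_smul, norm_absCoeff, Real.norm_of_nonneg hC] at this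

lemma norm_two_pi_I_mul (k : ℤ) :
    ‖(2 * Real.pi * Complex.I * k : ℂ)‖ = |2 * Real.pi * (k : ℝ)| := by
  simp [abs_mul]

lemma weight_one_le {k : ℤ} (hk : k ≠ 0) : weight 1 k ≤ 2 * |2 * Real.pi * (k : ℝ)| := by
  rw [weight, ← Real.sqrt_eq_rpow]
  apply Real.sqrt_le_iff.2 ⟨by positivity, ?_⟩
  rw [mul_pow 2 |_|, sq_abs, mul_pow (2 * Real.pi)]
  have h1 : (1 : ℝ) ≤ (k : ℝ) ^ 2 := by
    have : 1 ≤ k ^ 2 := (one_le_sq_iff_one_le_abs _).2 (Int.one_le_abs hk)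
    exact_mod_cast this
  nlinarith [Real.pi_gt_three, mul_le_mul h1 (by nlinarith [Real.pi_gt_three] :
    (1 : ℝ) ≤ (2 * Real.pi) ^ 2) (by norm_num) (by positivity)]

lemma weight_eq_sub_one (s : ℝ) (k : ℤ) : weight s k = weight (s - 1) k * weight 1 k := by
  rw [← weight_add]; congr 1; ring

instance {s : ℝ} [hs : Fact (3 / 2 < s)] : Fact (1 / 2 < s - 1) := ⟨by linarith [hs.out]⟩

instance {s : ℝ} [hs : Fact (3 / 2 < s)] : CompleteSpace (Hs s) :=
  completeSpace_hs (by linarith [hs.out])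

lemma exists_inclusion {s : ℝ} (hs : 3 / 2 < s) : ∃ L : Hs s →L[ℝ] Hs (s - 1), ∀ f k,
    fCoeff (Hs.toC (L f)) k = 1 * fCoeff (Hs.toC f) k := by
  refine exists_multiplier (C := 1) (by linarith) (fun _ => 1) (fun k => by simp) zero_le_one
    fun k => ?_
  rw [one_mul, norm_one, one_mul, weight_eq_sub_one s]
  exact le_mul_of_one_le_right (weight_pos _ k).le (one_le_weight k)

lemma exists_derivative {s : ℝ} (hs : 3 / 2 < s) : ∃ L : Hs s →L[ℝ] Hs (s - 1), ∀ f k,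
    fCoeff (Hs.toC (L f)) k = (2 * Real.pi * Complex.I * k) * fCoeff (Hs.toC f) k := by
  refine exists_multiplier (C := 1) (by linarith) (fun k => 2 * Real.pi * Complex.I * k)
    (fun k => ?_) zero_le_one fun k => ?_
  · simp only [map_mul, Complex.conj_ofReal, Complex.conj_I, map_intCast, map_ofNat, Int.cast_neg]
    ring
  · rw [one_mul, weight_eq_sub_one s, mul_comm]
    exact mul_le_mul_of_nonneg_left (abs_le_weight k) (weight_pos _ k).le

/-- The multiplier `(2πik)⁻¹` is `0` for `k = 0`, so that it removes the mean. -/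
lemma exists_antiderivative {s : ℝ} (hs : 3 / 2 < s) : ∃ L : Hs (s - 1) →L[ℝ] Hs s, ∀ f k,
    fCoeff (Hs.toC (L f)) k = (2 * Real.pi * Complex.I * k)⁻¹ * fCoeff (Hs.toC f) k := by
  refine exists_multiplier (C := 2) (by linarith) (fun k => (2 * Real.pi * Complex.I * k)⁻¹)
    (fun k => ?_) zero_le_two fun k => ?_
  · simp only [map_inv₀, map_mul, Complex.conj_ofReal, Complex.conj_I, map_intCast, map_ofNat,
      Int.cast_neg]
    congr 1; ring
  · rcases eq_or_ne k 0 with rfl | hk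
    · have := weight_pos (s - 1) 0
      simp [this.le]
    · have h0 : 0 < |2 * Real.pi * (k : ℝ)| := by positivity
      rw [norm_inv, norm_two_pi_I_mul, weight_eq_sub_one s, inv_mul_le_iff₀ h0]
      have := weight_one_le hk
      have h1 := weight_pos (s - 1) k
      nlinarith

/-- The constant functions in `H^s(S¹)`. -/
def constH (s : ℝ) : ℝ →L[ℝ] Hs s :=
  LinearMap.toContinuousLinearMap
    { toFun := constHs s
      map_add' := fun _ _ => rfl
      map_smul' := fun _ _ => rfl }

lemma constH_apply {s : ℝ} (c : ℝ) (x : UnitAddCircle) : (constH s c) x = c := rfl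

section operators

variable (s : ℝ) [hs : Fact (3 / 2 < s)]

/-- The inclusion of `H^s(S¹)` in the Banach algebra `H^{s-1}(S¹)`. -/
def inclH : Hs s →L[ℝ] HAlg (s - 1) :=
  (HAlg.toHs (r := s - 1)).symm.toContinuousLinearMap.comp (exists_inclusion hs.out).choose

/-- The derivative `∂ₓ : H^s(S¹) → H^{s-1}(S¹)`. -/
def derivH : Hs s →L[ℝ] HAlg (s - 1) :=
  (HAlg.toHs (r := s - 1)).symm.toContinuousLinearMap.comp (exists_derivative hs.out).choose

/-- The antiderivative `H^{s-1}(S¹) → H^s(S¹)` of mean zero of `f - ∫ f`. -/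
def antiderivH : HAlg (s - 1) →L[ℝ] Hs s :=
  (exists_antiderivative hs.out).choose.comp (HAlg.toHs (r := s - 1)).toContinuousLinearMap

end operators

/-- The embedding of the Banach algebra `H^r(S¹)` in `C(S¹)`. -/
def HAlg.toC (r : ℝ) [hr : Fact (1 / 2 < r)] : HAlg r →L[ℝ] C(UnitAddCircle, ℝ) :=
  (Hs.toCCLM hr.out).comp (HAlg.toHs (r := r)).toContinuousLinearMap

lemma HAlg.toC_mul {r : ℝ} [Fact (1 / 2 < r)] (f g : HAlg r) :
    HAlg.toC r (f * g) = HAlg.toC r f * HAlg.toC r g := rfl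

lemma HAlg.toC_one {r : ℝ} [Fact (1 / 2 < r)] : HAlg.toC r 1 = 1 := rfl

/-- The integral over the circle, as the zeroth Fourier coefficient. -/
def integralC : C(UnitAddCircle, ℝ) →L[ℝ] ℝ :=
  Complex.reCLM.comp (fCoeffCLM 0)

lemma integralC_apply (f : C(UnitAddCircle, ℝ)) : integralC f = ∫ x, f x := by
  change (fCoeff f 0).re = _
  rw [fCoeff_zero_index]; simp

lemma coe_integralC (f : C(UnitAddCircle, ℝ)) : (integralC f : ℂ) = fCoeff f 0 := by
  rw [integralC_apply, fCoeff_zero_index]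

lemma integralC_one : integralC 1 = 1 := by
  have : integralC 1 = (fCoeff (ContinuousMap.const _ 1) 0).re := rfl
  rw [this, fCoeff_const]; simp

lemma continuousMap_ext_fCoeff {f g : C(UnitAddCircle, ℝ)} (h : ∀ k, fCoeff f k = fCoeff g k) :
    f = g := by
  have h0 : fourierCoeff (toComplex (f - g)) = 0 := by
    ext k
    have := map_sub (fCoeffCLM k) f g
    simp only [fCoeffCLM_apply, h k, sub_self] at this
    exact this
  ext x
  have := has_pointwise_sum_fourier_series_of_summable (f := toComplex (f - g))
    (by rw [h0]; exact summable_zero) x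
  rw [h0] at this
  simp only [Pi.zero_apply, zero_smul] at this
  have := this.unique hasSum_zero
  simpa [toComplex, sub_eq_zero] using this

section derivative

variable {s : ℝ} [hs : Fact (3 / 2 < s)]

/-- The inclusion `H^s(S¹) ⊂ C(S¹)`. -/
def inclC (s : ℝ) [Fact (3 / 2 < s)] : Hs s →L[ℝ] C(UnitAddCircle, ℝ) :=
  (HAlg.toC (s - 1)).comp (inclH s)

/-- The derivative `∂ₓ : H^s(S¹) → C(S¹)`. -/
def derivC (s : ℝ) [Fact (3 / 2 < s)] : Hs s →L[ℝ] C(UnitAddCircle, ℝ) :=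
  (HAlg.toC (s - 1)).comp (derivH s)

lemma toC_inclH (f : Hs s) : HAlg.toC (s - 1) (inclH s f) = inclC s f := rfl

lemma toC_derivH (f : Hs s) : HAlg.toC (s - 1) (derivH s f) = derivC s f := rfl

lemma fCoeff_derivC (f : Hs s) (k : ℤ) :
    fCoeff (derivC s f) k = (2 * Real.pi * Complex.I * k) * fCoeff (Hs.toC f) k :=
  (exists_derivative hs.out).choose_spec f k

lemma fCoeff_antiderivH (f : HAlg (s - 1)) (k : ℤ) :
    fCoeff (Hs.toC (antiderivH s f)) k =
      (2 * Real.pi * Complex.I * k)⁻¹ * fCoeff (HAlg.toC (s - 1) f) k :=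
  (exists_antiderivative hs.out).choose_spec _ k

lemma inclC_eq (f : Hs s) : inclC s f = Hs.toC f :=
  continuousMap_ext_fCoeff fun k =>
    ((exists_inclusion hs.out).choose_spec f k).trans (one_mul _)

lemma derivC_apply (f : Hs s) (x : UnitAddCircle) : derivC s f x = dx f x := by
  have h := hasSum_fourier_hs (r := s - 1) (by linarith [hs.out])
    ((exists_derivative hs.out).choose f) x
  rw [dx_eq hs.out, dSeries]
  simp only [(exists_derivative hs.out).choose_spec f] at h
  simp only [mul_comm (fCoeff _ _) _]
  rw [h.tsum_eq, Complex.ofReal_re]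
  rfl

lemma inclC_constH (c : ℝ) : inclC s (constH s c) = c • 1 := by
  rw [inclC_eq]; ext x; simp [constH_apply]

lemma derivC_constH (c : ℝ) : derivC s (constH s c) = 0 := by
  ext x
  rw [derivC_apply]
  simp [dx, constH_apply]

lemma fCoeff_one (k : ℤ) : fCoeff 1 k = if k = 0 then 1 else 0 := by
  have := fCoeff_const 1 k
  rwa [Complex.ofReal_one] at this

lemma derivC_antiderivH (f : HAlg (s - 1)) :
    derivC s (antiderivH s f) = HAlg.toC (s - 1) f - integralC (HAlg.toC (s - 1) f) • 1 := by
  refine continuousMap_ext_fCoeff fun k => ?_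
  rw [fCoeff_derivC, fCoeff_antiderivH]
  simp only [← fCoeffCLM_apply, map_sub, map_smul]
  simp only [fCoeffCLM_apply, fCoeff_one]
  rcases eq_or_ne k 0 with rfl | hk
  · simp [coe_integralC]
  · rw [mul_inv_cancel_left₀]
    · simp [hk]
    · simp [hk, Real.pi_ne_zero]

lemma integralC_derivC (f : Hs s) : integralC (derivC s f) = 0 := by
  have := coe_integralC (derivC s f)
  rw [fCoeff_derivC] at this
  simpa using this

lemma summable_norm_fCoeff_derivC (f : Hs s) : Summable fun k => ‖fCoeff (derivC s f) k‖ :=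
  (summable_norm_fCoeff (r := s - 1) (by linarith [hs.out]) ((exists_derivative hs.out).choose f)).1

/-- Integration by parts, from the formula for the zeroth Fourier coefficient of a product. -/
lemma integralC_mul_derivC (f g : Hs s) :
    integralC (inclC s f * derivC s g) = - integralC (derivC s f * inclC s g) := by
  have h1 := hasSum_fCoeff_mul (summable_norm_fCoeff (by linarith [hs.out]) f).1 (derivC s g) 0
  have h2 := hasSum_fCoeff_mul (summable_norm_fCoeff_derivC f) (Hs.toC g) 0
  have h3 := h1.add h2
  have h4 : HasSum (fun _ : ℤ => (0 : ℂ)) (fCoeff (Hs.toC f * derivC s g) 0 +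
      fCoeff (derivC s f * Hs.toC g) 0) := by
    refine h3.congr_fun fun k => ?_
    rw [fCoeff_derivC, fCoeff_derivC]
    push_cast; ring
  have h5 := h4.unique hasSum_zero
  rw [← coe_integralC, ← coe_integralC] at h5
  rw [inclC_eq, inclC_eq]
  exact eq_neg_of_add_eq_zero_left (by exact_mod_cast h5)

/-- The function `Re (c e_k)` in `H^r(S¹)`. -/
def trigHs (r : ℝ) (c : ℂ) (k : ℤ) : Hs r := ⟨reCLM (c • fourier k), by
  change MemSobolev r _
  refine summable_of_hasFiniteSupport ((Set.toFinite ({k, -k} : Set ℤ)).subset fun n hn => ?_)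
  by_contra hn0
  simp only [mem_insert_iff, mem_singleton_iff, not_or] at hn0
  refine hn ?_
  have h2 : ¬ -n = k := by omega
  simp [wCoeff, fCoeff_re_smul_fourier, hn0.1, h2]⟩

/-- A continuous function which is orthogonal to all derivatives is constant. -/
lemma eq_integralC_of_forall_integralC_mul_derivC {G : C(UnitAddCircle, ℝ)}
    (h : ∀ f : Hs s, integralC (derivC s f * G) = 0) : G = integralC G • 1 := by
  refine continuousMap_ext_fCoeff fun k => ?_
  have e : fCoeff (integralC G • 1) k = if k = 0 then fCoeff G 0 else 0 := by
    rw [fCoeff_smul, fCoeff_one, ← coe_integralC]; simp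
  rw [e]
  rcases eq_or_ne k 0 with rfl | hk
  · simp
  rw [if_neg hk]
  -- testing with `f = Re (i Ĝ(k) e_k)` gives `|Ĝ(k)|² = 0`
  set z := fCoeff G k with hz
  have hf (n : ℤ) : fCoeff (Hs.toC (trigHs s (Complex.I * z) k)) n = _ :=
    fCoeff_re_smul_fourier (Complex.I * z) k n
  have h1 := hasSum_fCoeff_mul (summable_norm_fCoeff_derivC (trigHs s (Complex.I * z) k)) G 0
  simp only [fCoeff_derivC, hf] at h1
  have hne : k ≠ -k := by omega
  have h2 := hasSum_sum_of_ne_finset_zero (L := SummationFilter.unconditional ℤ)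
    (s := ({k, -k} : Finset ℤ))
    (f := fun j : ℤ => (2 * Real.pi * Complex.I * j) *
      (((if j = k then Complex.I * z else 0) +
        (if -j = k then (starRingEnd ℂ) (Complex.I * z) else 0)) / 2) * fCoeff G (0 - j))
    (fun j hj => by
      simp only [Finset.mem_insert, Finset.mem_singleton, not_or] at hj
      have : ¬ -j = k := by omega
      simp [hj.1, this])
  have h3 := h2.unique h1
  rw [Finset.sum_pair hne, ← coe_integralC, h, zero_sub, zero_sub, neg_neg, fCoeff_neg_index,
    ← hz] at h3
  simp only [if_true, hne.symm, map_mul, Complex.conj_I, Complex.ofReal_zero] at h3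
  have h4 : (2 * Real.pi * k : ℂ) * (z * (starRingEnd ℂ) z) = 0 := by
    push_cast at h3
    linear_combination (-1) * h3 + (2 * Real.pi * k * (z * (starRingEnd ℂ) z)) * Complex.I_sq
  have h5 : (2 * Real.pi * k : ℂ) ≠ 0 := by simp [hk, Real.pi_ne_zero]
  rw [mul_eq_zero, or_iff_right h5, Complex.mul_conj] at h4
  exact Complex.normSq_eq_zero.1 (by exact_mod_cast h4)

end derivative

/-! ### Lifts of maps into `𝒟^s(S¹)` -/

section covering

variable {s : ℝ}

/-- The diffeomorphism with the lift `id + φ`; the identity, if there is none. -/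
def Ds.ofLift (φ : Hs s) : Ds s :=
  open Classical in if h : φ ∈ liftSet s then proj ⟨φ, h⟩ else Ds.id s

lemma Ds.ofLift_eq {φ : Hs s} (h : φ ∈ liftSet s) : Ds.ofLift φ = proj ⟨φ, h⟩ := dif_pos h

lemma Ds.ofLift_coe (φ : liftSet s) : Ds.ofLift (φ : Hs s) = proj φ := Ds.ofLift_eq φ.2

lemma Ds.ofLift_toFun {φ : Hs s} (h : φ ∈ liftSet s) : (Ds.ofLift φ).toFun = circleMap φ := by
  rw [Ds.ofLift_eq h]; rfl

lemma Ds.ofLift_zero : Ds.ofLift (0 : Hs s) = Ds.id s := by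
  refine Ds.ext ?_
  rw [Ds.ofLift_toFun (zero_mem_liftSet s)]
  ext x; simp [circleMap, Ds.id]

/-- Translations of lifts by integers, the deck transformations of `proj`. -/
instance : AddAction ℤ (liftSet s) where
  vadd n φ := ⟨φ.1 + constHs s n, add_const_mem φ.2 n⟩
  zero_vadd φ := Subtype.ext (hs_ext fun x => by
    change (φ.1 + constHs s ((0 : ℤ) : ℝ)) x = φ.1 x
    simp)
  add_vadd m n φ := Subtype.ext (hs_ext fun x => by
    change (φ.1 + constHs s ((m + n : ℤ) : ℝ)) x = (φ.1 + constHs s n + constHs s m) x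
    simp; ring)

lemma vadd_liftSet_coe (n : ℤ) (φ : liftSet s) :
    ((n +ᵥ φ : liftSet s) : Hs s) = φ + constHs s n := rfl

lemma isAddQuotientCoveringMap_proj : IsAddQuotientCoveringMap (proj (s := s)) ℤ where
  surjective := proj_surjective
  isCoinducing := ⟨rfl⟩
  continuous_const_vadd n :=
    (continuous_subtype_val.add continuous_const).subtype_mk _
  apply_eq_iff_mem_orbit {φ ψ} := by
    rw [AddAction.mem_orbit_iff]
    constructor
    · intro h
      obtain ⟨n, hn⟩ := (circleMap_eq_iff _ _).1 (congrArg Ds.toFun h)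
      exact ⟨n, Subtype.ext hn.symm⟩
    · rintro ⟨n, rfl⟩
      exact Ds.ext (circleMap_add_int _ _)
  disjoint φ := by
    refine ⟨Metric.ball φ (1 / 2), Metric.ball_mem_nhds _ (by norm_num), fun n => ?_⟩
    rintro ⟨_, ⟨ψ, hψ, rfl⟩, hψ'⟩
    have h : (n +ᵥ ψ : liftSet s) = ψ := injOn_proj φ hψ' hψ (Ds.ext (circleMap_add_int _ _))
    have h2 : constHs s n = constHs s (0 : ℤ) := by
      have h3 := congrArg Subtype.val h
      rw [vadd_liftSet_coe, add_eq_left] at h3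
      rw [h3]; exact hs_ext fun x => by simp
    have h3 := congrArg (fun f : Hs s => f 0) h2
    simpa using h3

lemma isCoveringMap_proj : IsCoveringMap (proj (s := s)) :=
  isAddQuotientCoveringMap_proj.isCoveringMap

/-- Lifting of a family of paths with a common starting point. -/
lemma exists_lift_strip {δ : ℝ} {Γ : ℝ × ℝ → Ds s}
    (hΓ : ContinuousOn Γ (Ioo (-δ) δ ×ˢ Icc 0 1)) (φ₀ : liftSet s)
    (h0 : ∀ ε ∈ Ioo (-δ) δ, Γ (ε, 0) = proj φ₀) :
    ∃ Φ : ℝ × ℝ → liftSet s, ContinuousOn Φ (Ioo (-δ) δ ×ˢ Icc 0 1) ∧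
      (∀ p ∈ Ioo (-δ) δ ×ˢ Icc 0 1, proj (Φ p) = Γ p) ∧ ∀ ε ∈ Ioo (-δ) δ, Φ (ε, 0) = φ₀ := by
  classical
  let H : C(unitInterval × Ioo (-δ) δ, Ds s) :=
    ⟨fun p => Γ (p.2, p.1), hΓ.comp_continuous
      ((continuous_subtype_val.comp continuous_snd).prodMk
        (continuous_subtype_val.comp continuous_fst)) fun p => ⟨p.2.2, p.1.2⟩⟩
  have H0 (ε : Ioo (-δ) δ) : H (0, ε) = proj ((ContinuousMap.const _ φ₀) ε) := h0 ε ε.2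
  let K := isCoveringMap_proj.liftHomotopy H (ContinuousMap.const _ φ₀) H0
  have hK := isCoveringMap_proj.liftHomotopy_lifts H (ContinuousMap.const _ φ₀) H0
  let Φ : ℝ × ℝ → liftSet s := fun p => if h : p.1 ∈ Ioo (-δ) δ ∧ p.2 ∈ Icc (0 : ℝ) 1 then
    K (⟨p.2, h.2⟩, ⟨p.1, h.1⟩) else φ₀
  have hΦ (p : ℝ × ℝ) (h : p.1 ∈ Ioo (-δ) δ ∧ p.2 ∈ Icc (0 : ℝ) 1) :
      Φ p = K (⟨p.2, h.2⟩, ⟨p.1, h.1⟩) := dif_pos h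
  refine ⟨Φ, ?_, fun p hp => ?_, fun ε hε => ?_⟩
  · rw [continuousOn_iff_continuous_domRestrict]
    have e : (Ioo (-δ) δ ×ˢ Icc (0 : ℝ) 1).domRestrict Φ =
        fun p => K (⟨p.1.2, p.2.2⟩, ⟨p.1.1, p.2.1⟩) := by
      ext1 p; exact hΦ p p.2
    rw [e]
    exact K.continuous.comp (((continuous_snd.comp continuous_subtype_val).subtype_mk _).prodMk
      ((continuous_fst.comp continuous_subtype_val).subtype_mk _))
  · rw [hΦ p hp]
    exact congrFun hK (⟨p.2, hp.2⟩, ⟨p.1, hp.1⟩)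
  · rw [hΦ (ε, 0) ⟨hε, by simp⟩]
    exact isCoveringMap_proj.liftHomotopy_zero H (ContinuousMap.const _ φ₀) H0 ⟨ε, hε⟩

end covering

section charts

variable {s : ℝ} [hs : Fact (3 / 2 < s)]

lemma dsChart_target_subset (φ₀ : liftSet s) : (dsChart φ₀).target ⊆ liftSet s := fun φ hφ => by
  have := hφ.1
  simpa using this

lemma dsChart_symm_eq_ofLift {φ₀ : liftSet s} {φ : Hs s} (hφ : φ ∈ (dsChart φ₀).target) :
    (dsChart φ₀).symm φ = Ds.ofLift φ :=
  Ds.ext (by rw [dsChart_symm_apply φ₀ hφ, Ds.ofLift_toFun (dsChart_target_subset φ₀ hφ)])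

lemma mem_dsChart_target (φ₀ : liftSet s) : (φ₀ : Hs s) ∈ (dsChart φ₀).target := by
  have h2 : proj φ₀ ∈ (dsChart φ₀).source := by
    have : proj φ₀ ∈ (localProj φ₀).target :=
      (localProj φ₀).map_source (Metric.mem_ball_self (by norm_num))
    simpa [dsChart] using this
  have h3 : dsChart φ₀ (proj φ₀) = φ₀ := by
    have : (localProj φ₀).symm (proj φ₀) = φ₀ :=
      (localProj φ₀).left_inv (Metric.mem_ball_self (by norm_num))
    simp [dsChart, this]
  rw [← h3]
  exact (dsChart φ₀).map_source h2

/-- In a chart, the projection from lifts is locally a translation by an integer. -/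
lemma eventually_dsChart_ofLift (φ₀ : liftSet s) {φ : Hs s} (hφ : φ ∈ liftSet s)
    (h : Ds.ofLift φ ∈ (dsChart φ₀).source) :
    ∃ n : ℤ, ∀ᶠ ψ in 𝓝 φ, dsChart φ₀ (Ds.ofLift ψ) = ψ + constHs s n := by
  set φ₁ : liftSet s := ⟨φ, hφ⟩
  have h1 : φ ∈ (dsChart φ₁).target := mem_dsChart_target φ₁
  have hsrc : φ ∈ ((dsChart φ₁).symm.trans (dsChart φ₀)).source := by
    rw [OpenPartialHomeomorph.trans_source]
    exact ⟨h1, by rw [mem_preimage, dsChart_symm_eq_ofLift h1]; exact h⟩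
  obtain ⟨n, hn⟩ := dsChart_trans φ₁ φ₀ hsrc
  refine ⟨n, ?_⟩
  filter_upwards [eventually_translation _ (fun ψ hψ => dsChart_trans φ₁ φ₀ hψ) hsrc
    (by rw [hn, add_sub_cancel_left]), (dsChart φ₁).open_target.mem_nhds h1] with ψ h4 h5
  rwa [OpenPartialHomeomorph.coe_trans, Function.comp_apply, dsChart_symm_eq_ofLift h5] at h4

lemma continuousAt_ofLift {φ : Hs s} (hφ : φ ∈ liftSet s) : ContinuousAt Ds.ofLift φ := by
  have h := (isOpen_liftSet hs.out).isOpenEmbedding_subtypeVal.continuousAt_iff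
    (f := (Subtype.val : liftSet s → Hs s)) (x := ⟨φ, hφ⟩) (g := Ds.ofLift)
  rw [← h]
  have : Ds.ofLift ∘ (Subtype.val : liftSet s → Hs s) = proj := funext Ds.ofLift_coe
  rw [this]
  exact continuous_proj.continuousAt

variable {M : Type*} [NormedAddCommGroup M]

lemma eventuallyEq_chart {g : M → Ds s} {f : M → Hs s} {S : Set M} {x : M} (hx : x ∈ S)
    (hf : f x ∈ liftSet s) (hc : ContinuousWithinAt f S x)
    (hg : ∀ y ∈ S, g y = Ds.ofLift (f y)) :
    ∃ n : ℤ, (chartAt (Hs s) (g x) ∘ g) =ᶠ[𝓝[S] x] fun y => f y + constHs s n := by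
  have hsrc : Ds.ofLift (f x) ∈ (dsChart (g x).lift).source := by
    rw [← hg x hx]; exact mem_chart_source (Hs s) (g x)
  obtain ⟨n, hn⟩ := eventually_dsChart_ofLift _ hf hsrc
  refine ⟨n, ?_⟩
  filter_upwards [hc.eventually hn, self_mem_nhdsWithin] with y hy hyS
  rw [Function.comp_apply, hg y hyS]
  exact hy

lemma continuousWithinAt_of_lift {g : M → Ds s} {f : M → Hs s} {S : Set M} {x : M} (hx : x ∈ S)
    (hf : f x ∈ liftSet s) (hc : ContinuousWithinAt f S x)
    (hg : ∀ y ∈ S, g y = Ds.ofLift (f y)) : ContinuousWithinAt g S x :=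
  ((continuousAt_ofLift hf).comp_continuousWithinAt hc).congr hg (hg x hx)

variable [NormedSpace ℝ M]

/-- A map into `𝒟^s(S¹)` with a continuous lift is as smooth as its lift. -/
lemma contMDiffWithinAt_iff_lift {g : M → Ds s} {f : M → Hs s} {S : Set M} {x : M} {n : ℕ∞ω}
    (hx : x ∈ S) (hf : f x ∈ liftSet s) (hc : ContinuousWithinAt f S x)
    (hg : ∀ y ∈ S, g y = Ds.ofLift (f y)) :
    ContMDiffWithinAt 𝓘(ℝ, M) 𝓘(ℝ, Hs s) n g S x ↔ ContDiffWithinAt ℝ n f S x := by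
  obtain ⟨k, hk⟩ := eventuallyEq_chart hx hf hc hg
  rw [contMDiffWithinAt_iff, and_iff_right (continuousWithinAt_of_lift hx hf hc hg)]
  simp only [mfld_simps]
  have h1 : ContDiffWithinAt ℝ n (chartAt (Hs s) (g x) ∘ g) S x ↔
      ContDiffWithinAt ℝ n (fun y => f y + constHs s k) S x :=
    ⟨fun h => h.congr_of_eventuallyEq hk.symm (hk.self_of_nhdsWithin hx).symm,
      fun h => h.congr_of_eventuallyEq hk (hk.self_of_nhdsWithin hx)⟩
  refine h1.trans ⟨fun h => ?_, fun h => h.add contDiffWithinAt_const⟩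
  simpa using h.sub (contDiffWithinAt_const (c := constHs s k))

lemma hasMFDerivWithinAt_of_lift {g : M → Ds s} {f : M → Hs s} {S : Set M} {x : M}
    {f' : M →L[ℝ] Hs s} (hx : x ∈ S) (hf : f x ∈ liftSet s) (hd : HasFDerivWithinAt f f' S x)
    (hg : ∀ y ∈ S, g y = Ds.ofLift (f y)) :
    HasMFDerivWithinAt 𝓘(ℝ, M) 𝓘(ℝ, Hs s) g S x f' := by
  obtain ⟨k, hk⟩ := eventuallyEq_chart hx hf hd.continuousWithinAt hg
  refine ⟨continuousWithinAt_of_lift hx hf hd.continuousWithinAt hg, ?_⟩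
  simp only [mfld_simps]
  exact (hd.add_const _).congr_of_eventuallyEq hk (hk.self_of_nhdsWithin hx)

lemma velocity_of_lift {γ : ℝ → Ds s} {f : ℝ → Hs s} {t : ℝ} {v : Hs s} (ht : t ∈ Icc (0 : ℝ) 1)
    (hf : f t ∈ liftSet s) (hd : HasDerivWithinAt f v (Icc 0 1) t)
    (hg : ∀ y ∈ Icc (0 : ℝ) 1, γ y = Ds.ofLift (f y)) : velocity γ t = v := by
  have h := hasMFDerivWithinAt_of_lift ht hf hd.hasFDerivWithinAt hg
  have hu : UniqueMDiffWithinAt 𝓘(ℝ, ℝ) (Icc (0 : ℝ) 1) t :=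
    (uniqueDiffOn_Icc zero_lt_one t ht).uniqueMDiffWithinAt
  rw [velocity, h.mfderivWithin hu]
  exact one_smul ℝ v

end charts

/-! ### The metric and its first variation in terms of lifts -/

section lagrangian

lemma dx_ofLift {s : ℝ} {φ : Hs s} (hφ : φ ∈ liftSet s) (x : UnitAddCircle) :
    (Ds.ofLift φ).dx x = 1 + dx φ x := by
  have h1 : circleMap ((Ds.ofLift φ).lift : Hs s) = circleMap φ := by
    rw [← Ds.ofLift_toFun hφ]
    exact congrArg Ds.toFun (Ds.proj_lift (Ds.ofLift φ))
  obtain ⟨n, hn⟩ := (circleMap_eq_iff _ _).1 h1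
  rw [Ds.dx, hn, dx_add_const]

variable {s : ℝ} [hs : Fact (3 / 2 < s)]

/-- The Jacobian `ηₓ = 1 + φₓ` of `η = id + φ`. -/
def jac (φ : Hs s) : C(UnitAddCircle, ℝ) := 1 + derivC s φ

/-- The function `q = Vₓ / ηₓ`, i.e. `uₓ ∘ η` for the Eulerian velocity `u = V ∘ η⁻¹`. -/
def strain (φ V : Hs s) : C(UnitAddCircle, ℝ) := derivC s V * Ring.inverse (jac φ)

/-- The mean `p = ∫ V ηₓ` of the Eulerian velocity. -/
def meanVel (φ V : Hs s) : ℝ := integralC (inclC s V * jac φ)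

/-- The inner product `⟨V, V⟩` at `id + φ`. -/
def speedSq (φ V : Hs s) : ℝ := meanVel φ V ^ 2 + integralC (strain φ V * derivC s V)

/-- The inner product `⟨V, k⟩` at `id + φ`, which is half the derivative of `speedSq` in the
velocity, in the direction `k`. -/
def momentum (φ V k : Hs s) : ℝ :=
  meanVel φ V * integralC (inclC s k * jac φ) + integralC (strain φ V * derivC s k)

/-- Half the derivative of `speedSq` in the position, in the direction `h`. -/
def force (φ V h : Hs s) : ℝ :=
  meanVel φ V * integralC (inclC s V * derivC s h) -
    1 / 2 * integralC (strain φ V * strain φ V * derivC s h)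

lemma jac_apply (φ : Hs s) (x : UnitAddCircle) : jac φ x = 1 + dx φ x := by
  simp [jac, derivC_apply]

lemma isUnit_jac {φ : Hs s} (hφ : φ ∈ liftSet s) : IsUnit (jac φ) := by
  rw [ContinuousMap.isUnit_iff_forall_ne_zero]
  intro x
  rw [jac_apply]
  exact (hφ x).ne'

lemma strain_mul_jac {φ : Hs s} (hφ : φ ∈ liftSet s) (V : Hs s) :
    strain φ V * jac φ = derivC s V := by
  rw [strain, mul_assoc, Ring.inverse_mul_cancel _ (isUnit_jac hφ), mul_one]

lemma strain_apply {φ : Hs s} (hφ : φ ∈ liftSet s) (V : Hs s) (x : UnitAddCircle) :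
    strain φ V x = dx V x / (1 + dx φ x) := by
  rw [eq_div_iff (hφ x).ne', ← jac_apply, ← derivC_apply, ← strain_mul_jac hφ V]; rfl

lemma integralC_jac (φ : Hs s) : integralC (jac φ) = 1 := by
  rw [jac, map_add, integralC_one, integralC_derivC, add_zero]

lemma metric_eq_speedSq {η : Ds s} {φ : Hs s} (hφ : φ ∈ liftSet s) (hη : η = Ds.ofLift φ)
    (V : Hs s) : metric η V V = speedSq φ V := by
  subst hη
  have h1 : ∫ x, V x * (Ds.ofLift φ).dx x = meanVel φ V := by
    rw [meanVel, integralC_apply]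
    refine integral_congr_ae (Eventually.of_forall fun x => ?_)
    simp only [ContinuousMap.mul_apply, inclC_eq, jac_apply, dx_ofLift hφ]
  have h2 : ∫ x, dx V x * dx V x / (Ds.ofLift φ).dx x = integralC (strain φ V * derivC s V) := by
    rw [integralC_apply]
    refine integral_congr_ae (Eventually.of_forall fun x => ?_)
    simp only [ContinuousMap.mul_apply, derivC_apply, strain_apply hφ, dx_ofLift hφ]
    ring
  change (∫ x, V x * (Ds.ofLift φ).dx x) * (∫ x, V x * (Ds.ofLift φ).dx x) +
    ∫ x, dx V x * dx V x / (Ds.ofLift φ).dx x = _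
  rw [h1, h2, speedSq, sq]

variable {φ V : ℝ → Hs s} {φ' V' : Hs s} {S : Set ℝ} {t : ℝ}

lemma hasDerivWithinAt_jac (hφ : HasDerivWithinAt φ φ' S t) :
    HasDerivWithinAt (fun t => jac (φ t)) (derivC s φ') S t :=
  ((derivC s).hasFDerivAt.comp_hasDerivWithinAt t hφ).const_add 1

lemma hasDerivWithinAt_meanVel (hφ : HasDerivWithinAt φ φ' S t) (hV : HasDerivWithinAt V V' S t) :
    HasDerivWithinAt (fun t => meanVel (φ t) (V t))
      (integralC (inclC s V' * jac (φ t)) + integralC (inclC s (V t) * derivC s φ')) S t := by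
  have h := integralC.hasFDerivAt.comp_hasDerivWithinAt t
    (((inclC s).hasFDerivAt.comp_hasDerivWithinAt t hV).mul (hasDerivWithinAt_jac hφ))
  rw [map_add] at h
  exact h

lemma hasDerivWithinAt_strain (hmem : φ t ∈ liftSet s) (hφ : HasDerivWithinAt φ φ' S t)
    (hV : HasDerivWithinAt V V' S t) :
    HasDerivWithinAt (fun t => strain (φ t) (V t))
      ((derivC s V' - strain (φ t) (V t) * derivC s φ') * Ring.inverse (jac (φ t))) S t := by
  obtain ⟨u, hu⟩ := isUnit_jac hmem
  have hi := (hasFDerivAt_ringInverse (𝕜 := ℝ) u)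
  rw [hu] at hi
  have h1 := hi.comp_hasDerivWithinAt t (hasDerivWithinAt_jac hφ)
  have h2 := ((derivC s).hasFDerivAt.comp_hasDerivWithinAt t hV).mul h1
  refine h2.congr_deriv ?_
  have e : (↑u⁻¹ : C(UnitAddCircle, ℝ)) = Ring.inverse (jac (φ t)) := by
    rw [← hu, Ring.inverse_unit]
  simp only [neg_apply, ContinuousLinearMap.mulLeftRight_apply, e, strain, Function.comp_apply]
  ring

lemma hasDerivWithinAt_speedSq (hmem : φ t ∈ liftSet s) (hφ : HasDerivWithinAt φ φ' S t)
    (hV : HasDerivWithinAt V V' S t) :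
    HasDerivWithinAt (fun t => speedSq (φ t) (V t))
      (2 * (momentum (φ t) (V t) V' + force (φ t) (V t) φ')) S t := by
  have h1 := (hasDerivWithinAt_meanVel hφ hV).pow 2
  have h2 := integralC.hasFDerivAt.comp_hasDerivWithinAt t
    ((hasDerivWithinAt_strain hmem hφ hV).mul ((derivC s).hasFDerivAt.comp_hasDerivWithinAt t hV))
  refine (h1.add h2).congr_deriv ?_
  have e : (derivC s V' - strain (φ t) (V t) * derivC s φ') * Ring.inverse (jac (φ t)) *
      derivC s (V t) + strain (φ t) (V t) * derivC s V' =
      (2 : ℝ) • (strain (φ t) (V t) * derivC s V') -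
        strain (φ t) (V t) * strain (φ t) (V t) * derivC s φ' := by
    rw [two_smul]; simp only [strain]; ring
  simp only [Function.comp_apply]
  rw [e, map_sub, map_smul, momentum, force]
  simp
  ring

end lagrangian

section continuity

variable {s : ℝ} [hs : Fact (3 / 2 < s)] {X : Type*} [TopologicalSpace X] {S : Set X}
  {φ V h k : X → Hs s}

lemma continuousOn_jac (hφ : ContinuousOn φ S) : ContinuousOn (fun x => jac (φ x)) S :=
  continuousOn_const.add ((derivC s).continuous.comp_continuousOn hφ)

lemma continuousOn_meanVel (hφ : ContinuousOn φ S) (hV : ContinuousOn V S) :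
    ContinuousOn (fun x => meanVel (φ x) (V x)) S :=
  integralC.continuous.comp_continuousOn
    (((inclC s).continuous.comp_continuousOn hV).mul (continuousOn_jac hφ))

lemma continuousOn_strain (hφ : ContinuousOn φ S) (hV : ContinuousOn V S)
    (hmem : ∀ x ∈ S, φ x ∈ liftSet s) : ContinuousOn (fun x => strain (φ x) (V x)) S := by
  refine ((derivC s).continuous.comp_continuousOn hV).mul fun x hx => ?_
  obtain ⟨u, hu⟩ := isUnit_jac (hmem x hx)
  have h := NormedRing.inverse_continuousAt u
  rw [hu] at h
  exact ContinuousAt.comp_continuousWithinAt (f := fun x => jac (φ x)) h (continuousOn_jac hφ x hx)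

lemma continuousOn_speedSq (hφ : ContinuousOn φ S) (hV : ContinuousOn V S)
    (hmem : ∀ x ∈ S, φ x ∈ liftSet s) : ContinuousOn (fun x => speedSq (φ x) (V x)) S :=
  ((continuousOn_meanVel hφ hV).pow 2).add (integralC.continuous.comp_continuousOn
    ((continuousOn_strain hφ hV hmem).mul ((derivC s).continuous.comp_continuousOn hV)))

lemma continuousOn_momentum (hφ : ContinuousOn φ S) (hV : ContinuousOn V S)
    (hk : ContinuousOn k S) (hmem : ∀ x ∈ S, φ x ∈ liftSet s) :
    ContinuousOn (fun x => momentum (φ x) (V x) (k x)) S :=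
  ((continuousOn_meanVel hφ hV).mul (continuousOn_meanVel hφ hk)).add
    (integralC.continuous.comp_continuousOn
      ((continuousOn_strain hφ hV hmem).mul ((derivC s).continuous.comp_continuousOn hk)))

lemma continuousOn_force (hφ : ContinuousOn φ S) (hV : ContinuousOn V S)
    (hh : ContinuousOn h S) (hmem : ∀ x ∈ S, φ x ∈ liftSet s) :
    ContinuousOn (fun x => force (φ x) (V x) (h x)) S :=
  have hq := continuousOn_strain hφ hV hmem
  have hd := (derivC s).continuous.comp_continuousOn hh
  ((continuousOn_meanVel hφ hV).mul (integralC.continuous.comp_continuousOn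
    (((inclC s).continuous.comp_continuousOn hV).mul hd))).sub
    (continuousOn_const.mul (integralC.continuous.comp_continuousOn ((hq.mul hq).mul hd)))

end continuity

section variation

variable {s : ℝ} [hs : Fact (3 / 2 < s)]

lemma energy_eq_of_lift {γ : ℝ → Ds s} {φ V : ℝ → Hs s}
    (hmem : ∀ t ∈ Icc (0 : ℝ) 1, φ t ∈ liftSet s) (hγ : ∀ t ∈ Icc (0 : ℝ) 1, γ t = Ds.ofLift (φ t))
    (hφ : ∀ t ∈ Icc (0 : ℝ) 1, HasDerivWithinAt φ (V t) (Icc 0 1) t) :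
    energy γ = 1 / 2 * ∫ t in (0 : ℝ)..1, speedSq (φ t) (V t) := by
  rw [energy]
  congr 1
  refine intervalIntegral.integral_congr fun t ht => ?_
  rw [uIcc_of_le zero_le_one] at ht
  have hv := velocity_of_lift ht (hmem t ht) (hφ t ht) hγ
  exact (metric_eq_speedSq (hmem t ht) (hγ t ht) (velocity γ t : Hs s)).trans (by rw [hv])

/-- Differentiation under the integral sign on a strip. -/
lemma hasDerivAt_integral_strip {δ : ℝ} (hδ : 0 < δ) {F F' : ℝ → ℝ → ℝ}
    (hF : ContinuousOn (fun p : ℝ × ℝ => F p.1 p.2) (Ioo (-δ) δ ×ˢ Icc 0 1))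
    (hF' : ContinuousOn (fun p : ℝ × ℝ => F' p.1 p.2) (Ioo (-δ) δ ×ˢ Icc 0 1))
    (hd : ∀ ε ∈ Ioo (-δ) δ, ∀ t ∈ Icc (0 : ℝ) 1, HasDerivAt (fun ε => F ε t) (F' ε t) ε) :
    HasDerivAt (fun ε => ∫ t in (0 : ℝ)..1, F ε t) (∫ t in (0 : ℝ)..1, F' 0 t) 0 := by
  have h0 : (0 : ℝ) ∈ Ioo (-δ) δ := ⟨by linarith, hδ⟩
  have hslice {G : ℝ → ℝ → ℝ} {ε : ℝ} (hε : ε ∈ Ioo (-δ) δ)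
      (hG : ContinuousOn (fun p : ℝ × ℝ => G p.1 p.2) (Ioo (-δ) δ ×ˢ Icc 0 1)) :
      IntervalIntegrable (G ε) volume 0 1 := by
    refine ContinuousOn.intervalIntegrable ?_
    rw [uIcc_of_le zero_le_one]
    exact hG.comp (f := fun t : ℝ => (ε, t)) (by fun_prop) fun t ht => ⟨hε, ht⟩
  have hsub : Icc (-(δ / 2)) (δ / 2) ⊆ Ioo (-δ) δ :=
    fun x hx => ⟨by linarith [hx.1], by linarith [hx.2]⟩
  obtain ⟨B, hB⟩ := (isCompact_Icc.prod isCompact_Icc).exists_bound_of_continuousOn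
    (hF'.mono (prod_mono hsub subset_rfl))
  have hsub' : ∀ t, t ∈ uIoc (0 : ℝ) 1 → t ∈ Icc (0 : ℝ) 1 := fun t ht => by
    rw [uIoc_of_le zero_le_one] at ht; exact Ioc_subset_Icc_self ht
  exact (intervalIntegral.hasDerivAt_integral_of_dominated_loc_of_deriv_le
    (s := Icc (-(δ / 2)) (δ / 2)) (bound := fun _ => B)
    (Icc_mem_nhds (by linarith) (by linarith))
    (by
      filter_upwards [isOpen_Ioo.mem_nhds h0] with ε hε
      exact (intervalIntegrable_iff.1 (hslice hε hF)).aestronglyMeasurable)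
    (hslice h0 hF) (intervalIntegrable_iff.1 (hslice h0 hF')).aestronglyMeasurable
    (Eventually.of_forall fun t ht ε hε => hB (ε, t) ⟨hε, hsub' t ht⟩)
    (by simp)
    (Eventually.of_forall fun t ht ε hε => hd ε (hsub hε) t (hsub' t ht))).2

/-- The first variation of the energy, in terms of a lift `Φ` of the variation with the variation
field `h`. -/
lemma exists_hasDerivAt_energy {δ : ℝ} (hδ : 0 < δ) {Γ : ℝ → ℝ → Ds s} {Φ : ℝ × ℝ → Hs s}
    {V : ℝ → Hs s} (hΦ : ContDiffOn ℝ 2 Φ (Ioo (-δ) δ ×ˢ Icc 0 1))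
    (hmem : ∀ p ∈ Ioo (-δ) δ ×ˢ Icc 0 1, Φ p ∈ liftSet s)
    (hΓ : ∀ p ∈ Ioo (-δ) δ ×ˢ Icc 0 1, Γ p.1 p.2 = Ds.ofLift (Φ p))
    (hV : ∀ t ∈ Icc (0 : ℝ) 1, HasDerivWithinAt (fun t => Φ (0, t)) (V t) (Icc 0 1) t) :
    ∃ h k : ℝ → Hs s, ContinuousOn k (Icc 0 1) ∧
      (∀ t ∈ Icc (0 : ℝ) 1, HasDerivAt (fun ε => Φ (ε, t)) (h t) 0) ∧
      (∀ t ∈ Icc (0 : ℝ) 1, HasDerivWithinAt h (k t) (Icc 0 1) t) ∧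
      HasDerivAt (fun ε => energy (Γ ε))
        (∫ t in (0 : ℝ)..1,
          (momentum (Φ (0, t)) (V t) (k t) + force (Φ (0, t)) (V t) (h t))) 0 := by
  set S : Set (ℝ × ℝ) := Ioo (-δ) δ ×ˢ Icc 0 1 with hS
  have hu1 : UniqueDiffOn ℝ (Icc (0 : ℝ) 1) := uniqueDiffOn_Icc zero_lt_one
  have hu : UniqueDiffOn ℝ S := isOpen_Ioo.uniqueDiffOn.prod hu1
  let D : ℝ × ℝ → ℝ × ℝ →L[ℝ] Hs s := fderivWithin ℝ Φ S
  have hD : ContDiffOn ℝ 1 D S := hΦ.fderivWithin hu (by norm_num)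
  let D2 : ℝ × ℝ → ℝ × ℝ →L[ℝ] ℝ × ℝ →L[ℝ] Hs s := fderivWithin ℝ D S
  have hD2 : ContinuousOn D2 S := hD.continuousOn_fderivWithin hu le_rfl
  have hΦd : ∀ p ∈ S, HasFDerivWithinAt Φ (D p) S p := fun p hp =>
    ((hΦ.differentiableOn (by norm_num)) p hp).hasFDerivWithinAt
  have hDd : ∀ p ∈ S, HasFDerivWithinAt D (D2 p) S p := fun p hp =>
    ((hD.differentiableOn (by norm_num)) p hp).hasFDerivWithinAt
  have hsymm : ∀ p ∈ S, ∀ v w, D2 p v w = D2 p w v := by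
    intro p hp v w
    refine (hΦ p hp).isSymmSndFDerivWithinAt (by simp) hu ?_ hp v w
    have hint : interior S = Ioo (-δ) δ ×ˢ Ioo 0 1 := by
      rw [hS, interior_prod_eq, interior_Ioo, interior_Icc]
    rw [hint, closure_prod_eq, closure_Ioo zero_ne_one]
    exact ⟨subset_closure hp.1, hp.2⟩
  -- derivatives along the coordinate lines
  have line1 {E : Type _} [NormedAddCommGroup E] [NormedSpace ℝ E] {F : ℝ × ℝ → E}
      {F' : ℝ × ℝ →L[ℝ] E} {ε t : ℝ} (hε : ε ∈ Ioo (-δ) δ) (ht : t ∈ Icc (0 : ℝ) 1)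
      (hF : HasFDerivWithinAt F F' S (ε, t)) : HasDerivAt (fun ε => F (ε, t)) (F' (1, 0)) ε := by
    have h1 : HasDerivWithinAt (fun ε : ℝ => (ε, t)) ((1 : ℝ), (0 : ℝ)) (Ioo (-δ) δ) ε :=
      ((hasDerivAt_id ε).prodMk (hasDerivAt_const ε t)).hasDerivWithinAt
    have h2 : MapsTo (fun ε : ℝ => (ε, t)) (Ioo (-δ) δ) S := fun x hx => ⟨hx, ht⟩
    exact (hF.comp_hasDerivWithinAt ε h1 h2).hasDerivAt (isOpen_Ioo.mem_nhds hε)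
  have line2 {E : Type _} [NormedAddCommGroup E] [NormedSpace ℝ E] {F : ℝ × ℝ → E}
      {F' : ℝ × ℝ →L[ℝ] E} {ε t : ℝ} (hε : ε ∈ Ioo (-δ) δ)
      (hF : HasFDerivWithinAt F F' S (ε, t)) :
      HasDerivWithinAt (fun t => F (ε, t)) (F' (0, 1)) (Icc 0 1) t := by
    have h1 : HasDerivWithinAt (fun t : ℝ => (ε, t)) ((0 : ℝ), (1 : ℝ)) (Icc 0 1) t :=
      ((hasDerivAt_const t ε).prodMk (hasDerivAt_id t)).hasDerivWithinAt
    have h2 : MapsTo (fun t : ℝ => (ε, t)) (Icc 0 1) S := fun x hx => ⟨hε, hx⟩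
    exact hF.comp_hasDerivWithinAt t h1 h2
  have h0 : (0 : ℝ) ∈ Ioo (-δ) δ := ⟨by linarith, hδ⟩
  have hVD : ∀ t ∈ Icc (0 : ℝ) 1, V t = D (0, t) (0, 1) := fun t ht =>
    (hu1 t ht).eq_deriv _ (hV t ht) (line2 h0 (hΦd _ ⟨h0, ht⟩))
  have hline : ContinuousOn (fun t : ℝ => ((0 : ℝ), t)) (Icc 0 1) := by fun_prop
  have hmaps : MapsTo (fun t : ℝ => ((0 : ℝ), t)) (Icc 0 1) S := fun t ht => ⟨h0, ht⟩
  refine ⟨fun t => D (0, t) (1, 0), fun t => D2 (0, t) (0, 1) (1, 0), ?_, ?_, ?_, ?_⟩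
  · exact ((hD2.comp hline hmaps).clm_apply continuousOn_const).clm_apply continuousOn_const
  · exact fun t ht => line1 h0 ht (hΦd _ ⟨h0, ht⟩)
  · intro t ht
    have h1 := (hDd (0, t) ⟨h0, ht⟩).clm_apply (hasFDerivWithinAt_const ((1 : ℝ), (0 : ℝ)) (0, t) S)
    have h2 := line2 h0 h1
    simpa using h2
  · have hW : ContinuousOn (fun p => D p (0, 1)) S := hD.continuousOn.clm_apply continuousOn_const
    have hH : ContinuousOn (fun p => D p (1, 0)) S := hD.continuousOn.clm_apply continuousOn_const
    have hK : ContinuousOn (fun p => D2 p (1, 0) (0, 1)) S :=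
      (hD2.clm_apply continuousOn_const).clm_apply continuousOn_const
    let F : ℝ → ℝ → ℝ := fun ε t => speedSq (Φ (ε, t)) (D (ε, t) (0, 1))
    let F' : ℝ → ℝ → ℝ := fun ε t => 2 * (momentum (Φ (ε, t)) (D (ε, t) (0, 1))
      (D2 (ε, t) (1, 0) (0, 1)) + force (Φ (ε, t)) (D (ε, t) (0, 1)) (D (ε, t) (1, 0)))
    have hFc : ContinuousOn (fun p : ℝ × ℝ => F p.1 p.2) S :=
      continuousOn_speedSq hΦ.continuousOn hW hmem
    have hF'c : ContinuousOn (fun p : ℝ × ℝ => F' p.1 p.2) S :=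
      continuousOn_const.mul ((continuousOn_momentum hΦ.continuousOn hW hK hmem).add
        (continuousOn_force hΦ.continuousOn hW hH hmem))
    have hFd : ∀ ε ∈ Ioo (-δ) δ, ∀ t ∈ Icc (0 : ℝ) 1,
        HasDerivAt (fun ε => F ε t) (F' ε t) ε := by
      intro ε hε t ht
      have h1 := line1 hε ht (hΦd _ ⟨hε, ht⟩)
      have h2 := line1 hε ht ((hDd (ε, t) ⟨hε, ht⟩).clm_apply
        (hasFDerivWithinAt_const ((0 : ℝ), (1 : ℝ)) (ε, t) S))
      have h3 := hasDerivWithinAt_speedSq (hmem _ ⟨hε, ht⟩) h1.hasDerivWithinAt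
        (S := univ) h2.hasDerivWithinAt
      rw [hasDerivWithinAt_univ] at h3
      simpa using h3
    have key := hasDerivAt_integral_strip hδ hFc hF'c hFd
    refine ((key.const_mul (1 / 2)).congr_of_eventuallyEq ?_).congr_deriv ?_
    · filter_upwards [isOpen_Ioo.mem_nhds h0] with ε hε
      exact energy_eq_of_lift (φ := fun t => Φ (ε, t)) (V := fun t => D (ε, t) (0, 1))
        (fun t ht => hmem _ ⟨hε, ht⟩) (fun t ht => hΓ (ε, t) ⟨hε, ht⟩)
        fun t ht => line2 hε (hΦd _ ⟨hε, ht⟩)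
    · rw [← intervalIntegral.integral_const_mul]
      refine intervalIntegral.integral_congr fun t ht => ?_
      rw [uIcc_of_le zero_le_one] at ht
      simp only [F', hVD t ht, hsymm _ (⟨h0, ht⟩ : (0, t) ∈ S) (1, 0) (0, 1)]
      ring

end variation

/-! ### The geodesic equation -/

section geodesicEquation

variable {s : ℝ} [hs : Fact (3 / 2 < s)]

/-- The geodesic equation for a lift `id + φ(t)` with velocity `V(t)`: the mean `p` of the Eulerian
velocity is conserved, and `q = Vₓ / ηₓ` satisfies `q' = 2 p V + c - q² / 2` with a function `c` of
time. -/
structure SolvesGeodesicEq (φ V : ℝ → Hs s) (c : ℝ → ℝ) : Prop where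
  mem : ∀ t ∈ Icc (0 : ℝ) 1, φ t ∈ liftSet s
  continuousOn_velocity : ContinuousOn V (Icc 0 1)
  deriv_lift : ∀ t ∈ Icc (0 : ℝ) 1, HasDerivWithinAt φ (V t) (Icc 0 1) t
  deriv_meanVel : ∀ t ∈ Icc (0 : ℝ) 1,
    HasDerivWithinAt (fun t => meanVel (φ t) (V t)) 0 (Icc 0 1) t
  deriv_strain : ∀ t ∈ Icc (0 : ℝ) 1, HasDerivWithinAt (fun t => strain (φ t) (V t))
    ((2 * meanVel (φ t) (V t)) • inclC s (V t) + c t • 1 -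
      (1 / 2 : ℝ) • (strain (φ t) (V t) * strain (φ t) (V t))) (Icc 0 1) t

lemma SolvesGeodesicEq.continuousOn_lift {φ V : ℝ → Hs s} {c : ℝ → ℝ}
    (h : SolvesGeodesicEq φ V c) : ContinuousOn φ (Icc 0 1) :=
  fun t ht => (h.deriv_lift t ht).continuousWithinAt

lemma hasDerivWithinAt_momentum {φ V h : ℝ → Hs s} {φ' h' : Hs s} {p' : ℝ}
    {q' : C(UnitAddCircle, ℝ)} {S : Set ℝ} {t : ℝ} (hφ : HasDerivWithinAt φ φ' S t)
    (hh : HasDerivWithinAt h h' S t)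
    (hp : HasDerivWithinAt (fun t => meanVel (φ t) (V t)) p' S t)
    (hq : HasDerivWithinAt (fun t => strain (φ t) (V t)) q' S t) :
    HasDerivWithinAt (fun t => momentum (φ t) (V t) (h t))
      (momentum (φ t) (V t) h' + (p' * integralC (inclC s (h t) * jac (φ t)) +
        meanVel (φ t) (V t) * integralC (inclC s (h t) * derivC s φ') +
        integralC (q' * derivC s (h t)))) S t := by
  have h1 := hp.mul (hasDerivWithinAt_meanVel hφ hh)
  have h2 := integralC.hasFDerivAt.comp_hasDerivWithinAt t
    (hq.mul ((derivC s).hasFDerivAt.comp_hasDerivWithinAt t hh))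
  refine (h1.add h2).congr_deriv ?_
  simp only [map_add, momentum, meanVel, Function.comp_apply]
  ring

/-- Along solutions of the geodesic equation, the Euler–Lagrange equation holds. -/
lemma SolvesGeodesicEq.hasDerivWithinAt_momentum {φ V h k : ℝ → Hs s} {c : ℝ → ℝ}
    (hsol : SolvesGeodesicEq φ V c) {t : ℝ} (ht : t ∈ Icc (0 : ℝ) 1)
    (hh : HasDerivWithinAt h (k t) (Icc 0 1) t) :
    HasDerivWithinAt (fun t => momentum (φ t) (V t) (h t))
      (momentum (φ t) (V t) (k t) + force (φ t) (V t) (h t)) (Icc 0 1) t := by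
  refine (MuHS.hasDerivWithinAt_momentum (hsol.deriv_lift t ht) hh (hsol.deriv_meanVel t ht)
    (hsol.deriv_strain t ht)).congr_deriv ?_
  rw [integralC_mul_derivC, mul_comm (derivC s (h t))]
  simp only [sub_mul, add_mul, smul_mul_assoc, map_sub, map_add, map_smul, one_mul,
    integralC_derivC, force, smul_eq_mul]
  ring

lemma integral_deriv_Icc {f f' : ℝ → ℝ} (hf' : ContinuousOn f' (Icc 0 1))
    (h : ∀ t ∈ Icc (0 : ℝ) 1, HasDerivWithinAt f (f' t) (Icc 0 1) t) :
    ∫ t in (0 : ℝ)..1, f' t = f 1 - f 0 := by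
  refine intervalIntegral.integral_eq_sub_of_hasDerivAt_of_le zero_le_one
    (fun t ht => (h t ht).continuousWithinAt)
    (fun t ht => (h t (Ioo_subset_Icc_self ht)).hasDerivAt (Icc_mem_nhds ht.1 ht.2)) ?_
  refine ContinuousOn.intervalIntegrable ?_
  rwa [uIcc_of_le zero_le_one]

/-- Solutions of the geodesic equation are geodesics: by the Euler–Lagrange equation the first
variation is the integral of `∂ₜ ⟨V, h⟩`, and `h` vanishes at the end points. -/
lemma SolvesGeodesicEq.isGeodesic {φ V : ℝ → Hs s} {c : ℝ → ℝ} (hsol : SolvesGeodesicEq φ V c)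
    (hφ : ContDiffOn ℝ 2 φ (Icc 0 1)) {γ : ℝ → Ds s}
    (hγ : ∀ t ∈ Icc (0 : ℝ) 1, γ t = Ds.ofLift (φ t)) : IsGeodesic γ where
  contMDiffOn := fun t ht => (contMDiffWithinAt_iff_lift ht (hsol.mem t ht)
    (hsol.continuousOn_lift t ht) hγ).2 (hφ t ht)
  critical := by
    intro δ hδ Γ hΓ
    have h0 : (0 : ℝ) ∈ Ioo (-δ) δ := ⟨by linarith, hδ⟩
    have hz : (0 : ℝ) ∈ Icc (0 : ℝ) 1 := by simp
    have ho : (1 : ℝ) ∈ Icc (0 : ℝ) 1 := by simp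
    obtain ⟨Φ, hΦc, hΦ, hΦ0⟩ := exists_lift_strip (Γ := fun p => Γ p.1 p.2)
      hΓ.contMDiffOn.continuousOn ⟨φ 0, hsol.mem 0 hz⟩ fun ε hε => by
        rw [hΓ.left ε hε, hγ 0 hz, Ds.ofLift_eq (hsol.mem 0 hz)]
    -- the lift of the variation starts at `φ`, by uniqueness of lifts
    have hΦφ : ∀ t ∈ Icc (0 : ℝ) 1, (Φ (0, t) : Hs s) = φ t := by
      let ψ : ℝ → liftSet s := fun t => if ht : t ∈ Icc (0 : ℝ) 1 then ⟨φ t, hsol.mem t ht⟩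
        else ⟨0, zero_mem_liftSet s⟩
      have hψ : ∀ t ∈ Icc (0 : ℝ) 1, (ψ t : Hs s) = φ t := fun t ht => by simp only [ψ, dif_pos ht]
      have hψc : ContinuousOn ψ (Icc 0 1) := by
        rw [Topology.IsInducing.subtypeVal.continuousOn_iff]
        exact hsol.continuousOn_lift.congr hψ
      have := isCoveringMap_proj.eqOn_of_comp_eqOn (g₁ := fun t => Φ (0, t)) (g₂ := ψ)
        isPreconnected_Icc (hΦc.comp (f := fun t : ℝ => ((0 : ℝ), t)) (by fun_prop)
          fun t ht => ⟨h0, ht⟩) hψc (fun t ht => by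
            rw [Function.comp_apply, Function.comp_apply, hΦ _ ⟨h0, ht⟩, ← Ds.ofLift_coe, hψ t ht,
              ← hγ t ht]
            exact hΓ.zero t ht) hz (by
            rw [hΦ0 0 h0]; exact Subtype.ext (hψ 0 hz).symm)
      exact fun t ht => (congrArg Subtype.val (this ht)).trans (hψ t ht)
    -- the end points are fixed
    have hΦ1 : ∀ ε ∈ Ioo (-δ) δ, Φ (ε, 1) = Φ (0, 1) := fun ε hε =>
      isCoveringMap_proj.constOn_of_comp (g := fun ε => Φ (ε, 1)) isPreconnected_Ioo
        (hΦc.comp (f := fun ε : ℝ => (ε, (1 : ℝ))) (by fun_prop) fun ε hε => ⟨hε, ho⟩)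
        (fun a ha b hb => by
          rw [hΦ _ ⟨ha, ho⟩, hΦ _ ⟨hb, ho⟩, hΓ.right a ha, hΓ.right b hb]) hε h0
    have hlift : ∀ p ∈ Ioo (-δ) δ ×ˢ Icc (0 : ℝ) 1, Γ p.1 p.2 = Ds.ofLift (Φ p : Hs s) :=
      fun p hp => by rw [Ds.ofLift_coe, hΦ p hp]
    have hΦd : ContDiffOn ℝ 2 (fun p => (Φ p : Hs s)) (Ioo (-δ) δ ×ˢ Icc 0 1) := fun p hp =>
      (contMDiffWithinAt_iff_lift (g := fun p => Γ p.1 p.2) hp (Φ p).2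
        (continuous_subtype_val.comp_continuousOn hΦc p hp) hlift).1 (by
          have := hΓ.contMDiffOn p hp
          exact this)
    obtain ⟨h, k, hk, hh, hhk, hE⟩ := exists_hasDerivAt_energy hδ hΦd (fun p _ => (Φ p).2) hlift
      (V := V) fun t ht => (hsol.deriv_lift t ht).congr hΦφ (hΦφ t ht)
    have hend : ∀ t ∈ Icc (0 : ℝ) 1, (∀ ε ∈ Ioo (-δ) δ, Φ (ε, t) = Φ (0, t)) → h t = 0 := by
      intro t ht hc
      refine (hh t ht).unique
        ((hasDerivAt_const (0 : ℝ) (Φ (0, t) : Hs s)).congr_of_eventuallyEq ?_)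
      filter_upwards [isOpen_Ioo.mem_nhds h0] with ε hε
      rw [hc ε hε]
    have hh0 : h 0 = 0 := hend 0 hz fun ε hε => by rw [hΦ0 ε hε, hΦ0 0 h0]
    have hh1 : h 1 = 0 := hend 1 ho hΦ1
    have hhc : ContinuousOn h (Icc 0 1) := fun t ht => (hhk t ht).continuousWithinAt
    refine hE.congr_deriv ?_
    have hcont : ContinuousOn (fun t => momentum (φ t) (V t) (k t) + force (φ t) (V t) (h t))
        (Icc 0 1) :=
      (continuousOn_momentum hsol.continuousOn_lift hsol.continuousOn_velocity hk hsol.mem).add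
        (continuousOn_force hsol.continuousOn_lift hsol.continuousOn_velocity hhc hsol.mem)
    have key := integral_deriv_Icc hcont fun t ht => hsol.hasDerivWithinAt_momentum ht (hhk t ht)
    rw [hh0, hh1] at key
    have e : ∫ t in (0 : ℝ)..1, (momentum (Φ (0, t) : Hs s) (V t) (k t) +
        force (Φ (0, t) : Hs s) (V t) (h t)) =
        ∫ t in (0 : ℝ)..1, (momentum (φ t) (V t) (k t) + force (φ t) (V t) (h t)) := by
      refine intervalIntegral.integral_congr fun t ht => ?_
      rw [uIcc_of_le zero_le_one] at ht
      simp only [hΦφ t ht]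
    rw [e, key]
    simp [momentum]

end geodesicEquation

/-! ### Geodesics solve the geodesic equation -/

section geodesics

variable {s : ℝ} [hs : Fact (3 / 2 < s)]

lemma momentum_smul (φ V h : Hs s) (c : ℝ) : momentum φ V (c • h) = c * momentum φ V h := by
  simp only [momentum, map_smul, smul_mul_assoc, mul_smul_comm, smul_eq_mul]; ring

lemma force_smul (φ V h : Hs s) (c : ℝ) : force φ V (c • h) = c * force φ V h := by
  simp only [force, map_smul, mul_smul_comm, smul_eq_mul]; ring

/-- The variation `φ + ε g h` of a geodesic, for a test function `g` of time and a fixed `h`. -/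
lemma IsGeodesic.integral_eq_zero {γ : ℝ → Ds s} (hgeo : IsGeodesic γ) {φ V : ℝ → Hs s}
    (hmem : ∀ t ∈ Icc (0 : ℝ) 1, φ t ∈ liftSet s) (hφ : ContDiffOn ℝ 2 φ (Icc 0 1))
    (hV : ∀ t ∈ Icc (0 : ℝ) 1, HasDerivWithinAt φ (V t) (Icc 0 1) t)
    (hγ : ∀ t ∈ Icc (0 : ℝ) 1, γ t = Ds.ofLift (φ t)) {g : ℝ → ℝ} (hg : ContDiff ℝ ∞ g)
    (hg0 : g 0 = 0) (hg1 : g 1 = 0) (h : Hs s) :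
    ∫ t in (0 : ℝ)..1, (deriv g t * momentum (φ t) (V t) h + g t * force (φ t) (V t) h) = 0 := by
  have hcpt := isCompact_Icc.image_of_continuousOn hφ.continuousOn
  obtain ⟨ρ, hρ, hρS⟩ := hcpt.exists_cthickening_subset_open (isOpen_liftSet hs.out)
    (by rintro _ ⟨t, ht, rfl⟩; exact hmem t ht)
  obtain ⟨B, hB⟩ := isCompact_Icc.exists_bound_of_continuousOn (s := Icc (0 : ℝ) 1)
    (hg.continuous.smul (continuous_const (y := h))).continuousOn
  have hB0 : 0 ≤ B := (norm_nonneg _).trans (hB 0 (by simp))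
  set δ := ρ / (B + 1) with hδ
  have hδ0 : 0 < δ := by positivity
  let Φ : ℝ × ℝ → Hs s := fun p => φ p.2 + p.1 • (g p.2 • h)
  have hΦd : ContDiffOn ℝ 2 Φ (Ioo (-δ) δ ×ˢ Icc 0 1) := by
    refine (hφ.comp contDiffOn_snd fun p hp => hp.2).add (contDiffOn_fst.smul ?_)
    exact (((hg.of_le (WithTop.coe_le_coe.2 le_top)).comp contDiff_snd).smul
      contDiff_const).contDiffOn
  have hΦm : ∀ p ∈ Ioo (-δ) δ ×ˢ Icc (0 : ℝ) 1, Φ p ∈ liftSet s := by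
    intro p hp
    refine hρS (Metric.mem_cthickening_of_dist_le _ (φ p.2) _ _ ⟨p.2, hp.2, rfl⟩ ?_)
    rw [dist_eq_norm, add_sub_cancel_left, norm_smul, Real.norm_eq_abs]
    have h1 : |p.1| ≤ δ := (abs_lt.2 hp.1).le
    calc |p.1| * ‖g p.2 • h‖ ≤ δ * (B + 1) := by
          gcongr
          exact (hB p.2 hp.2).trans (by linarith)
      _ = ρ := by rw [hδ]; field_simp
  have hΓ : IsProperVariation γ (fun ε t => Ds.ofLift (Φ (ε, t))) δ :=
    { contMDiffOn := fun p hp => (contMDiffWithinAt_iff_lift hp (hΦm p hp)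
        (hΦd.continuousOn p hp) fun _ _ => rfl).2 (hΦd p hp)
      zero := fun t ht => by simp [Φ, hγ t ht]
      left := fun ε _ => by simp [Φ, hγ 0, hg0]
      right := fun ε _ => by simp [Φ, hγ 1, hg1] }
  have hΦ0 : (fun t => Φ (0, t)) = φ := by ext1 t; simp [Φ]
  obtain ⟨h', k, -, hh, hhk, hE⟩ := exists_hasDerivAt_energy hδ0 hΦd hΦm
    (Γ := fun ε t => Ds.ofLift (Φ (ε, t))) (fun _ _ => rfl) (V := V) (by rwa [hΦ0])
  have hh' : ∀ t ∈ Icc (0 : ℝ) 1, h' t = g t • h := fun t ht => by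
    refine (hh t ht).unique ?_
    exact (((hasDerivAt_id (0 : ℝ)).smul_const (g t • h)).const_add (φ t)).congr_deriv
      (one_smul ℝ _)
  have hk' : ∀ t ∈ Icc (0 : ℝ) 1, k t = deriv g t • h := fun t ht => by
    refine (uniqueDiffOn_Icc zero_lt_one t ht).eq_deriv _ (hhk t ht) ?_
    exact (((hg.differentiable (by simp) t).hasDerivAt.smul_const h).hasDerivWithinAt).congr hh'
      (hh' t ht)
  refine Eq.trans ?_ ((hgeo.critical δ hδ0 _ hΓ).unique hE).symm
  refine intervalIntegral.integral_congr fun t ht => ?_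
  rw [uIcc_of_le zero_le_one] at ht
  have e : Φ (0, t) = φ t := congrFun hΦ0 t
  simp only [e, hh' t ht, hk' t ht, momentum_smul, force_smul]

/-- The fundamental lemma of the calculus of variations on `[0, 1]`. -/
lemma eqOn_deriv_of_integral_eq_zero {m m' f : ℝ → ℝ}
    (hm : ∀ t ∈ Icc (0 : ℝ) 1, HasDerivWithinAt m (m' t) (Icc 0 1) t)
    (hm' : ContinuousOn m' (Icc 0 1)) (hf : ContinuousOn f (Icc 0 1))
    (h : ∀ g : ℝ → ℝ, ContDiff ℝ ∞ g → g 0 = 0 → g 1 = 0 →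
      ∫ t in (0 : ℝ)..1, (deriv g t * m t + g t * f t) = 0) : EqOn m' f (Icc 0 1) := by
  have hmc : ContinuousOn m (Icc 0 1) := fun t ht => (hm t ht).continuousWithinAt
  have hint {F : ℝ → ℝ} (hF : ContinuousOn F (Icc 0 1)) : IntervalIntegrable F volume 0 1 := by
    refine ContinuousOn.intervalIntegrable ?_
    rwa [uIcc_of_le zero_le_one]
  have hae : ∀ᵐ t, t ∈ Ioo (0 : ℝ) 1 → m' t - f t = 0 := by
    refine isOpen_Ioo.ae_eq_zero_of_integral_contDiff_smul_eq_zero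
      (((hm'.sub hf).mono Ioo_subset_Icc_self).locallyIntegrableOn measurableSet_Ioo) ?_
    intro g hg hgc hgs
    have hg0 : g 0 = 0 := image_eq_zero_of_notMem_tsupport fun h => lt_irrefl _ (hgs h).1
    have hg1 : g 1 = 0 := image_eq_zero_of_notMem_tsupport fun h => lt_irrefl _ (hgs h).2
    have hgd : Continuous (deriv g) := hg.continuous_deriv (by simp)
    have hgcon : ContinuousOn g (Icc 0 1) := hg.continuous.continuousOn
    have h1 := integral_deriv_Icc (f := fun t => g t * m t)
      (f' := fun t => deriv g t * m t + g t * m' t)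
      ((hgd.continuousOn.mul hmc).add (hgcon.mul hm'))
      fun t ht => ((hg.differentiable (by simp) t).hasDerivAt.hasDerivWithinAt).mul (hm t ht)
    have h2 := h g hg hg0 hg1
    have h3 := intervalIntegral.integral_sub
      (hint ((hgd.continuousOn.mul hmc).add (hgcon.mul hm')))
      (hint ((hgd.continuousOn.mul hmc).add (hgcon.mul hf)))
    simp only [hg0, hg1, zero_mul, sub_zero] at h1
    have h3 : ∫ t in (0 : ℝ)..1, ((deriv g t * m t + g t * m' t) - (deriv g t * m t + g t * f t)) =
      (∫ t in (0 : ℝ)..1, (deriv g t * m t + g t * m' t)) -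
        ∫ t in (0 : ℝ)..1, (deriv g t * m t + g t * f t) := h3
    rw [h1, h2, sub_zero] at h3
    have h4 : ∫ t, g t • (m' t - f t) = ∫ t in (0 : ℝ)..1, g t • (m' t - f t) := by
      rw [intervalIntegral.integral_of_le zero_le_one]
      refine (setIntegral_eq_integral_of_forall_compl_eq_zero fun t ht => ?_).symm
      have : t ∉ tsupport g := fun h => ht (Ioo_subset_Ioc_self (hgs h))
      rw [image_eq_zero_of_notMem_tsupport this, zero_smul]
    rw [h4, ← h3]
    congr 1 with t
    simp only [smul_eq_mul]; ring
  have : ∀ᵐ t ∂volume.restrict (Ioo (0 : ℝ) 1), m' t = f t := by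
    rw [ae_restrict_iff' measurableSet_Ioo]
    filter_upwards [hae] with t ht h
    exact sub_eq_zero.1 (ht h)
  rw [restrict_Ioo_eq_restrict_Icc] at this
  exact Measure.eqOn_Icc_of_ae_eq volume zero_ne_one this hm' hf

/-- A geodesic has a lift which solves the geodesic equation. -/
lemma IsGeodesic.exists_solution {γ : ℝ → Ds s} (hgeo : IsGeodesic γ) (φ₀ : liftSet s)
    (h0 : γ 0 = proj φ₀) : ∃ (φ V : ℝ → Hs s) (c : ℝ → ℝ), SolvesGeodesicEq φ V c ∧ φ 0 = φ₀ ∧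
      ∀ t ∈ Icc (0 : ℝ) 1, γ t = Ds.ofLift (φ t) := by
  have hz : (0 : ℝ) ∈ Ioo (-1 : ℝ) 1 := by simp
  obtain ⟨Φ, hΦc, hΦ, hΦ0⟩ := exists_lift_strip (δ := 1) (Γ := fun p => γ p.2)
    (hgeo.contMDiffOn.continuousOn.comp continuousOn_snd fun p hp => hp.2) φ₀ fun _ _ => h0
  let φ : ℝ → Hs s := fun t => Φ (0, t)
  have hmem : ∀ t ∈ Icc (0 : ℝ) 1, φ t ∈ liftSet s := fun t _ => (Φ (0, t)).2
  have hφc : ContinuousOn φ (Icc 0 1) := continuous_subtype_val.comp_continuousOn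
    (hΦc.comp (f := fun t : ℝ => ((0 : ℝ), t)) (by fun_prop) fun t ht => ⟨hz, ht⟩)
  have hγ : ∀ t ∈ Icc (0 : ℝ) 1, γ t = Ds.ofLift (φ t) := fun t ht => by
    rw [Ds.ofLift_coe]; exact (hΦ (0, t) ⟨hz, ht⟩).symm
  have hu : UniqueDiffOn ℝ (Icc (0 : ℝ) 1) := uniqueDiffOn_Icc zero_lt_one
  have hφ : ContDiffOn ℝ 2 φ (Icc 0 1) := fun t ht =>
    (contMDiffWithinAt_iff_lift ht (hmem t ht) (hφc t ht) hγ).1 (hgeo.contMDiffOn t ht)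
  let V : ℝ → Hs s := derivWithin φ (Icc 0 1)
  have hV1 : ContDiffOn ℝ 1 V (Icc 0 1) := hφ.derivWithin hu (by norm_num)
  let A : ℝ → Hs s := derivWithin V (Icc 0 1)
  have hA : ContinuousOn A (Icc 0 1) := hV1.continuousOn_derivWithin hu le_rfl
  have hV : ∀ t ∈ Icc (0 : ℝ) 1, HasDerivWithinAt φ (V t) (Icc 0 1) t := fun t ht =>
    (hφ.differentiableOn (by norm_num) t ht).hasDerivWithinAt
  have hAd : ∀ t ∈ Icc (0 : ℝ) 1, HasDerivWithinAt V (A t) (Icc 0 1) t := fun t ht =>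
    (hV1.differentiableOn (by norm_num) t ht).hasDerivWithinAt
  let p' : ℝ → ℝ := fun t => integralC (inclC s (A t) * jac (φ t)) +
    integralC (inclC s (V t) * derivC s (V t))
  let q' : ℝ → C(UnitAddCircle, ℝ) := fun t =>
    (derivC s (A t) - strain (φ t) (V t) * derivC s (V t)) * Ring.inverse (jac (φ t))
  have hp : ∀ t ∈ Icc (0 : ℝ) 1, HasDerivWithinAt (fun t => meanVel (φ t) (V t)) (p' t)
    (Icc 0 1) t := fun t ht => hasDerivWithinAt_meanVel (hV t ht) (hAd t ht)
  have hq : ∀ t ∈ Icc (0 : ℝ) 1, HasDerivWithinAt (fun t => strain (φ t) (V t)) (q' t)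
    (Icc 0 1) t := fun t ht => hasDerivWithinAt_strain (hmem t ht) (hV t ht) (hAd t ht)
  have hVc := hV1.continuousOn
  have hp'c : ContinuousOn p' (Icc 0 1) := (continuousOn_meanVel hφc hA).add
    (integralC.continuous.comp_continuousOn (((inclC s).continuous.comp_continuousOn hVc).mul
      ((derivC s).continuous.comp_continuousOn hVc)))
  have hq'c : ContinuousOn q' (Icc 0 1) := by
    have e : q' = fun t => strain (φ t) (A t) - strain (φ t) (V t) * strain (φ t) (V t) := by
      ext1 t; simp only [q', strain]; ring
    rw [e]
    have h1 := continuousOn_strain hφc hVc hmem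
    exact (continuousOn_strain hφc hA hmem).sub (h1.mul h1)
  -- the Euler–Lagrange equation, weak in space
  have hEL : ∀ h : Hs s, ∀ t ∈ Icc (0 : ℝ) 1, p' t * integralC (inclC s h * jac (φ t)) +
      meanVel (φ t) (V t) * integralC (inclC s h * derivC s (V t)) +
        integralC (q' t * derivC s h) = force (φ t) (V t) h := by
    intro h
    refine eqOn_deriv_of_integral_eq_zero (m := fun t => momentum (φ t) (V t) h)
      (fun t ht => ?_) ?_ (continuousOn_force hφc hVc continuousOn_const hmem)
      fun g hg hg0 hg1 => hgeo.integral_eq_zero hmem hφ hV hγ hg hg0 hg1 h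
    · refine (MuHS.hasDerivWithinAt_momentum (hV t ht) (hasDerivWithinAt_const t _ h) (hp t ht)
        (hq t ht)).congr_deriv ?_
      have : momentum (φ t) (V t) 0 = 0 := by simp [momentum]
      rw [this, zero_add]
    · refine ((hp'c.mul (continuousOn_meanVel hφc continuousOn_const)).add
        ((continuousOn_meanVel hφc hVc).mul (integralC.continuous.comp_continuousOn
          (continuousOn_const.mul ((derivC s).continuous.comp_continuousOn hVc))))).add
        (integralC.continuous.comp_continuousOn (hq'c.mul continuousOn_const))
  -- constant test functions give the conservation of the mean velocity
  have hp0 : ∀ t ∈ Icc (0 : ℝ) 1, p' t = 0 := fun t ht => by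
    have := hEL (constH s 1) t ht
    simpa [inclC_constH, derivC_constH, integralC_jac, integralC_derivC, force] using this
  -- by the remaining test functions, `q' + q² / 2 - 2 p V` is constant in space
  let G : ℝ → C(UnitAddCircle, ℝ) := fun t => q' t +
    (1 / 2 : ℝ) • (strain (φ t) (V t) * strain (φ t) (V t)) -
      (2 * meanVel (φ t) (V t)) • inclC s (V t)
  refine ⟨φ, V, fun t => integralC (G t), ⟨hmem, hVc, hV, fun t ht => ?_, fun t ht => ?_⟩,
    congrArg Subtype.val (hΦ0 0 hz), hγ⟩
  · exact (hp t ht).congr_deriv (hp0 t ht)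
  · refine (hq t ht).congr_deriv ?_
    have hG : G t = integralC (G t) • 1 := by
      refine eq_integralC_of_forall_integralC_mul_derivC (s := s) fun h => ?_
      have h1 := hEL h t ht
      rw [hp0 t ht, integralC_mul_derivC, mul_comm (derivC s h), force] at h1
      rw [mul_comm]
      simp only [G, sub_mul, add_mul, smul_mul_assoc, map_sub, map_add, map_smul, smul_eq_mul]
      linarith
    rw [← hG]
    simp only [G]
    abel

end geodesics

/-! ### Uniqueness for the geodesic equation -/

section uniqueness

variable {s : ℝ} [hs : Fact (3 / 2 < s)]

lemma abs_integralC_le (f : C(UnitAddCircle, ℝ)) : |integralC f| ≤ ‖f‖ := by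
  rw [integralC_apply, ← Real.norm_eq_abs, volume_eq_haar]
  refine (norm_integral_le_of_norm_le_const (C := ‖f‖) ?_).trans (by simp)
  exact Eventually.of_forall fun x => f.norm_coe_le_norm x

/-- The mean value inequality on the circle. -/
lemma abs_sub_le_norm_derivC (f : Hs s) (x y : UnitAddCircle) : |f x - f y| ≤ ‖derivC s f‖ := by
  obtain ⟨u, hu, hxy⟩ : ∃ u ∈ Icc (0 : ℝ) 1, x = y + (u : UnitAddCircle) := by
    obtain ⟨u, hu, h⟩ := (AddCircle.coe_image_Icc_eq (p := (1 : ℝ)) 0 ▸ mem_univ (x - y) :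
      x - y ∈ ((↑) : ℝ → UnitAddCircle) '' Icc 0 (0 + 1))
    rw [zero_add] at hu
    exact ⟨u, hu, by rw [h]; abel⟩
  have hd (v : ℝ) : HasDerivAt (fun v : ℝ => f (y + (v : UnitAddCircle)))
      (derivC s f (y + (v : UnitAddCircle))) v := by
    have h1 := hasDerivAt_hs hs.out f (y + (v : UnitAddCircle))
    rw [← dx_eq hs.out, ← derivC_apply] at h1
    have h2 : HasDerivAt (fun w : ℝ => w - v) 1 v := (hasDerivAt_id v).sub_const v
    have h3 := h1.scomp_of_eq v h2 (sub_self v).symm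
    rw [one_smul] at h3
    convert! h3 using 1
    ext w
    simp only [Function.comp_apply, AddCircle.coe_sub]
    congr 1; abel
  have h := norm_image_sub_le_of_norm_deriv_le_segment'
    (f := fun v : ℝ => f (y + (v : UnitAddCircle)))
    (fun v _ => (hd v).hasDerivWithinAt) (C := ‖derivC s f‖) (a := 0) (b := 1)
    (fun v _ => (derivC s f).norm_coe_le_norm _) u hu
  have h0 : ((0 : ℝ) : UnitAddCircle) = 0 := rfl
  simp only [h0, add_zero, sub_zero, ← hxy, Real.norm_eq_abs] at h
  exact h.trans (mul_le_of_le_one_right (norm_nonneg _) hu.2)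

/-- A function is controlled by its derivative and its integral against a density of mass one. -/
lemma norm_inclC_le (f : Hs s) {a : C(UnitAddCircle, ℝ)} (ha : integralC a = 1) :
    ‖inclC s f‖ ≤ ‖derivC s f‖ * ‖a‖ + |integralC (inclC s f * a)| := by
  refine (ContinuousMap.norm_le _ (by positivity)).2 fun x => ?_
  have h1 : f x = integralC ((f x • 1 - inclC s f) * a) + integralC (inclC s f * a) := by
    rw [← map_add, ← add_mul, sub_add_cancel, smul_mul_assoc, one_mul, map_smul, ha]; simp
  have h2 : ‖f x • (1 : C(UnitAddCircle, ℝ)) - inclC s f‖ ≤ ‖derivC s f‖ :=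
    (ContinuousMap.norm_le _ (norm_nonneg _)).2 fun y => by
      rw [inclC_eq]
      simpa using abs_sub_le_norm_derivC f x y
  have h3 : |integralC ((f x • 1 - inclC s f) * a)| ≤ ‖derivC s f‖ * ‖a‖ :=
    (abs_integralC_le _).trans ((norm_mul_le _ _).trans (by gcongr))
  have h4 : ‖inclC s f x‖ = |f x| := by rw [inclC_eq]; rfl
  rw [h4]
  conv_lhs => rw [h1]
  exact (abs_add_le _ _).trans (by gcongr)

/-- The function `c` of the geodesic equation is determined by `∫ q ηₓ = ∫ Vₓ = 0`. -/
lemma SolvesGeodesicEq.const_eq {φ V : ℝ → Hs s} {c : ℝ → ℝ} (h : SolvesGeodesicEq φ V c) {t : ℝ}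
    (ht : t ∈ Icc (0 : ℝ) 1) : c t = -(2 * meanVel (φ t) (V t) ^ 2) -
      1 / 2 * integralC (strain (φ t) (V t) * strain (φ t) (V t) * jac (φ t)) := by
  have h1 := integralC.hasFDerivAt.comp_hasDerivWithinAt t
    ((h.deriv_strain t ht).mul (hasDerivWithinAt_jac (h.deriv_lift t ht)))
  have h2 : HasDerivWithinAt (fun _ : ℝ => (0 : ℝ)) 0 (Icc 0 1) t := hasDerivWithinAt_const _ _ _
  have h3 := (uniqueDiffOn_Icc zero_lt_one t ht).eq_deriv _ h1 (h2.congr (fun t ht => by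
    simp only [Function.comp_apply, Pi.mul_apply]
    rw [strain_mul_jac (h.mem t ht), integralC_derivC]) (by
    simp only [Function.comp_apply, Pi.mul_apply]
    rw [strain_mul_jac (h.mem t ht), integralC_derivC]))
  rw [← strain_mul_jac (h.mem t ht) (V t), ← mul_assoc] at h3
  simp only [sub_mul, add_mul, smul_mul_assoc, map_sub, map_add, map_smul, one_mul,
    integralC_jac, smul_eq_mul] at h3
  rw [← meanVel] at h3
  linarith

lemma SolvesGeodesicEq.meanVel_eq {φ V : ℝ → Hs s} {c : ℝ → ℝ} (h : SolvesGeodesicEq φ V c) {t : ℝ}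
    (ht : t ∈ Icc (0 : ℝ) 1) : meanVel (φ t) (V t) = meanVel (φ 0) (V 0) :=
  constant_of_has_deriv_right_zero (fun t ht => (h.deriv_meanVel t ht).continuousWithinAt)
    (fun t ht => (h.deriv_meanVel t (Ico_subset_Icc_self ht)).mono_of_mem_nhdsWithin
      (Icc_mem_nhdsGE_of_mem ht)) t ht

lemma norm_mul_sub_mul_le {R : Type*} [NormedRing R] {M : ℝ} {a b a' b' : R} (hb : ‖b‖ ≤ M)
    (ha' : ‖a'‖ ≤ M) : ‖a * b - a' * b'‖ ≤ M * (‖a - a'‖ + ‖b - b'‖) := by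
  have e : a * b - a' * b' = (a - a') * b + a' * (b - b') := by noncomm_ring
  rw [e]
  calc _ ≤ ‖a - a'‖ * ‖b‖ + ‖a'‖ * ‖b - b'‖ :=
        (norm_add_le _ _).trans (add_le_add (norm_mul_le _ _) (norm_mul_le _ _))
    _ ≤ ‖a - a'‖ * M + M * ‖b - b'‖ := by gcongr
    _ = _ := by ring

/-- Grönwall's inequality for `(ηₓ, q)` in `C(S¹)`, in which the geodesic equation is polynomial,
with the velocity recovered from `Vₓ = q ηₓ` and `∫ V ηₓ = p`. -/
lemma SolvesGeodesicEq.eqOn {φ₁ V₁ φ₂ V₂ : ℝ → Hs s} {c₁ c₂ : ℝ → ℝ}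
    (h₁ : SolvesGeodesicEq φ₁ V₁ c₁) (h₂ : SolvesGeodesicEq φ₂ V₂ c₂) (hφ : φ₁ 0 = φ₂ 0)
    (hV : V₁ 0 = V₂ 0) : EqOn φ₁ φ₂ (Icc 0 1) := by
  set p := meanVel (φ₁ 0) (V₁ 0) with hp
  have hp₁ : ∀ t ∈ Icc (0 : ℝ) 1, meanVel (φ₁ t) (V₁ t) = p := fun t ht => h₁.meanVel_eq ht
  have hp₂ : ∀ t ∈ Icc (0 : ℝ) 1, meanVel (φ₂ t) (V₂ t) = p := fun t ht => by
    rw [h₂.meanVel_eq ht, ← hφ, ← hV]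
  let a₁ := fun t => jac (φ₁ t)
  let a₂ := fun t => jac (φ₂ t)
  let q₁ := fun t => strain (φ₁ t) (V₁ t)
  let q₂ := fun t => strain (φ₂ t) (V₂ t)
  have bdd {f : ℝ → C(UnitAddCircle, ℝ)} (hf : ContinuousOn f (Icc 0 1)) :=
    isCompact_Icc.exists_bound_of_continuousOn hf
  have hq₁ := continuousOn_strain h₁.continuousOn_lift h₁.continuousOn_velocity h₁.mem
  have hq₂ := continuousOn_strain h₂.continuousOn_lift h₂.continuousOn_velocity h₂.mem
  -- by compactness, a common bound
  obtain ⟨M, hM1, hMa₁, hMa₂, hMq₁, hMq₂, hMV⟩ : ∃ M : ℝ, 1 ≤ M ∧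
      (∀ t ∈ Icc (0 : ℝ) 1, ‖a₁ t‖ ≤ M) ∧ (∀ t ∈ Icc (0 : ℝ) 1, ‖a₂ t‖ ≤ M) ∧
      (∀ t ∈ Icc (0 : ℝ) 1, ‖q₁ t‖ ≤ M) ∧ (∀ t ∈ Icc (0 : ℝ) 1, ‖q₂ t‖ ≤ M) ∧
      (∀ t ∈ Icc (0 : ℝ) 1, ‖inclC s (V₂ t)‖ ≤ M) := by
    obtain ⟨M1, h1⟩ := bdd (continuousOn_jac h₁.continuousOn_lift)
    obtain ⟨M2, h2⟩ := bdd (continuousOn_jac h₂.continuousOn_lift)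
    obtain ⟨M3, h3⟩ := bdd hq₁
    obtain ⟨M4, h4⟩ := bdd hq₂
    obtain ⟨M5, h5⟩ := bdd ((inclC s).continuous.comp_continuousOn h₂.continuousOn_velocity)
    have n1 := le_abs_self M1
    have n2 := le_abs_self M2
    have n3 := le_abs_self M3
    have n4 := le_abs_self M4
    have n5 := le_abs_self M5
    have := abs_nonneg M1; have := abs_nonneg M2; have := abs_nonneg M3
    have := abs_nonneg M4; have := abs_nonneg M5
    refine ⟨1 + |M1| + |M2| + |M3| + |M4| + |M5|, by linarith, fun t ht => (h1 t ht).trans ?_,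
      fun t ht => (h2 t ht).trans ?_, fun t ht => (h3 t ht).trans ?_,
      fun t ht => (h4 t ht).trans ?_, fun t ht => (h5 t ht).trans ?_⟩ <;> linarith
  let f : ℝ → C(UnitAddCircle, ℝ) × C(UnitAddCircle, ℝ) := fun t => (a₁ t - a₂ t, q₁ t - q₂ t)
  let q' (φ V : ℝ → Hs s) (c : ℝ → ℝ) (t : ℝ) : C(UnitAddCircle, ℝ) :=
    (2 * meanVel (φ t) (V t)) • inclC s (V t) + c t • 1 -
      (1 / 2 : ℝ) • (strain (φ t) (V t) * strain (φ t) (V t))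
  let f' : ℝ → C(UnitAddCircle, ℝ) × C(UnitAddCircle, ℝ) := fun t =>
    (derivC s (V₁ t) - derivC s (V₂ t), q' φ₁ V₁ c₁ t - q' φ₂ V₂ c₂ t)
  have hf : ∀ t ∈ Icc (0 : ℝ) 1, HasDerivWithinAt f (f' t) (Icc 0 1) t := fun t ht =>
    ((hasDerivWithinAt_jac (h₁.deriv_lift t ht)).sub
      (hasDerivWithinAt_jac (h₂.deriv_lift t ht))).prodMk
      ((h₁.deriv_strain t ht).sub (h₂.deriv_strain t ht))
  have hfa (t : ℝ) : ‖a₁ t - a₂ t‖ ≤ ‖f t‖ := norm_fst_le (f t)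
  have hfq (t : ℝ) : ‖q₁ t - q₂ t‖ ≤ ‖f t‖ := norm_snd_le (f t)
  have hdV : ∀ t ∈ Icc (0 : ℝ) 1, ‖derivC s (V₁ t) - derivC s (V₂ t)‖ ≤ 2 * M * ‖f t‖ := by
    intro t ht
    rw [← strain_mul_jac (h₁.mem t ht), ← strain_mul_jac (h₂.mem t ht)]
    refine (norm_mul_sub_mul_le (hMa₁ t ht) (hMq₂ t ht)).trans ?_
    nlinarith [hfa t, hfq t]
  have hdiff : ∀ t ∈ Icc (0 : ℝ) 1, ‖inclC s (V₁ t - V₂ t)‖ ≤ 3 * M ^ 2 * ‖f t‖ := by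
    intro t ht
    refine (norm_inclC_le _ (integralC_jac (φ₁ t))).trans ?_
    have h1 : integralC (inclC s (V₁ t - V₂ t) * jac (φ₁ t)) =
        - integralC (inclC s (V₂ t) * (a₁ t - a₂ t)) := by
      have e1 := hp₁ t ht
      have e2 := hp₂ t ht
      rw [meanVel] at e1 e2
      simp only [a₁, a₂, map_sub, sub_mul, mul_sub]
      linarith
    have h2 : |integralC (inclC s (V₂ t) * (a₁ t - a₂ t))| ≤ M * ‖f t‖ :=
      (abs_integralC_le _).trans ((norm_mul_le _ _).trans
        (mul_le_mul (hMV t ht) (hfa t) (norm_nonneg _) (by linarith)))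
    have h3 : ‖derivC s (V₁ t - V₂ t)‖ * ‖jac (φ₁ t)‖ ≤ 2 * M * ‖f t‖ * M := by
      rw [map_sub]
      exact mul_le_mul (hdV t ht) (hMa₁ t ht) (norm_nonneg _)
        (by have := norm_nonneg (f t); positivity)
    rw [h1, abs_neg]
    nlinarith [norm_nonneg (f t), mul_nonneg (mul_nonneg (by linarith : 0 ≤ M) (norm_nonneg (f t)))
      (by linarith : 0 ≤ M - 1)]
  have hqq : ∀ t ∈ Icc (0 : ℝ) 1, ‖q₁ t * q₁ t - q₂ t * q₂ t‖ ≤ 2 * M * ‖f t‖ := by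
    intro t ht
    refine (norm_mul_sub_mul_le (hMq₁ t ht) (hMq₂ t ht)).trans ?_
    nlinarith [hfq t]
  have hc : ∀ t ∈ Icc (0 : ℝ) 1, |c₁ t - c₂ t| ≤ 2 * M ^ 2 * ‖f t‖ := by
    intro t ht
    rw [h₁.const_eq ht, h₂.const_eq ht, hp₁ t ht, hp₂ t ht]
    have e : -(2 * p ^ 2) - 1 / 2 * integralC (strain (φ₁ t) (V₁ t) * strain (φ₁ t) (V₁ t) *
        jac (φ₁ t)) - (-(2 * p ^ 2) - 1 / 2 * integralC (strain (φ₂ t) (V₂ t) *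
        strain (φ₂ t) (V₂ t) * jac (φ₂ t))) =
        -(1 / 2 * integralC (q₁ t * q₁ t * a₁ t - q₂ t * q₂ t * a₂ t)) := by
      simp only [q₁, q₂, a₁, a₂, map_sub]; ring
    rw [e, abs_neg, abs_mul, abs_of_pos (by norm_num : (0 : ℝ) < 1 / 2)]
    have hM2 : ‖q₂ t * q₂ t‖ ≤ M ^ 2 := by
      rw [sq]
      exact (norm_mul_le _ _).trans (mul_le_mul (hMq₂ t ht) (hMq₂ t ht) (norm_nonneg _)
        (by linarith))
    have h1 : ‖a₁ t‖ ≤ M ^ 2 := (hMa₁ t ht).trans (by nlinarith)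
    have h2 : ‖q₁ t * q₁ t * a₁ t - q₂ t * q₂ t * a₂ t‖ ≤
        ‖q₁ t * q₁ t - q₂ t * q₂ t‖ * M + M ^ 2 * ‖a₁ t - a₂ t‖ := by
      have e : q₁ t * q₁ t * a₁ t - q₂ t * q₂ t * a₂ t =
        (q₁ t * q₁ t - q₂ t * q₂ t) * a₁ t + (q₂ t * q₂ t) * (a₁ t - a₂ t) := by ring
      rw [e]
      refine (norm_add_le _ _).trans (add_le_add ((norm_mul_le _ _).trans ?_)
        ((norm_mul_le _ _).trans ?_))
      · gcongr; exact hMa₁ t ht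
      · gcongr
    have h3 := abs_integralC_le (q₁ t * q₁ t * a₁ t - q₂ t * q₂ t * a₂ t)
    have h4 := mul_le_mul_of_nonneg_right (hqq t ht) (by linarith : 0 ≤ M)
    have h5 := mul_le_mul_of_nonneg_left (hfa t) (by positivity : 0 ≤ M ^ 2)
    have h6 : 0 ≤ M ^ 2 * ‖f t‖ := by positivity
    nlinarith
  -- the first summand bounds `ηₓ'`, the second one `q'`
  set K := 2 * M + (2 * |p| * (3 * M ^ 2) + 2 * M ^ 2 + M) with hK
  have hbound : ∀ t ∈ Icc (0 : ℝ) 1, ‖f' t‖ ≤ K * ‖f t‖ := by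
    intro t ht
    have hn := norm_nonneg (f t)
    refine max_le ((hdV t ht).trans ?_) ?_
    · rw [hK, add_mul]
      have : 0 ≤ (2 * |p| * (3 * M ^ 2) + 2 * M ^ 2 + M) * ‖f t‖ := by positivity
      linarith
    · have e : q' φ₁ V₁ c₁ t - q' φ₂ V₂ c₂ t = (2 * p) • inclC s (V₁ t - V₂ t) +
          (c₁ t - c₂ t) • (1 : C(UnitAddCircle, ℝ)) -
            (1 / 2 : ℝ) • (q₁ t * q₁ t - q₂ t * q₂ t) := by
        simp only [q', hp₁ t ht, hp₂ t ht, q₁, q₂, map_sub, smul_sub, sub_smul]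
        abel
      change ‖q' φ₁ V₁ c₁ t - q' φ₂ V₂ c₂ t‖ ≤ _
      rw [e]
      have t1 : ‖(2 * p) • inclC s (V₁ t - V₂ t)‖ ≤ 2 * |p| * (3 * M ^ 2 * ‖f t‖) := by
        rw [norm_smul, Real.norm_eq_abs, abs_mul, abs_two]
        gcongr; exact hdiff t ht
      have t2 : ‖(c₁ t - c₂ t) • (1 : C(UnitAddCircle, ℝ))‖ ≤ 2 * M ^ 2 * ‖f t‖ := by
        rw [norm_smul, norm_one, mul_one]; exact hc t ht
      have t3 : ‖(1 / 2 : ℝ) • (q₁ t * q₁ t - q₂ t * q₂ t)‖ ≤ M * ‖f t‖ := by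
        rw [norm_smul, Real.norm_of_nonneg (by norm_num)]
        linarith [hqq t ht]
      have t4 := (norm_sub_le _ _).trans (add_le_add ((norm_add_le _ _).trans
        (add_le_add t1 t2)) t3)
      refine t4.trans ?_
      rw [hK]
      have : 0 ≤ 2 * M * ‖f t‖ := by positivity
      linarith
  have hright {t : ℝ} (ht : t ∈ Ico (0 : ℝ) 1) : Icc (0 : ℝ) 1 ∈ 𝓝[≥] t :=
    Icc_mem_nhdsGE_of_mem ht
  have hf0 : ∀ t ∈ Icc (0 : ℝ) 1, f t = 0 :=
    eq_zero_of_abs_deriv_le_mul_abs_self_of_eq_zero_right (f' := f') (K := K)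
      (fun t ht => (hf t ht).continuousWithinAt)
      (fun t ht => (hf t (Ico_subset_Icc_self ht)).mono_of_mem_nhdsWithin (hright ht))
      (by simp [f, a₁, a₂, q₁, q₂, hφ, hV]) fun t ht => hbound t (Ico_subset_Icc_self ht)
  have hVeq : ∀ t ∈ Icc (0 : ℝ) 1, V₁ t = V₂ t := by
    intro t ht
    have h1 := hdiff t ht
    rw [hf0 t ht, norm_zero, mul_zero, norm_le_zero_iff, inclC_eq] at h1
    exact sub_eq_zero.1 (Hs.toC_injective (by rw [h1, map_zero]))
  have hd : ∀ t ∈ Icc (0 : ℝ) 1, HasDerivWithinAt (fun t => φ₁ t - φ₂ t) 0 (Icc 0 1) t :=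
    fun t ht => ((h₁.deriv_lift t ht).sub (h₂.deriv_lift t ht)).congr_deriv
      (by rw [hVeq t ht, sub_self])
  intro t ht
  have := constant_of_has_deriv_right_zero (fun t ht => (hd t ht).continuousWithinAt)
    (fun t ht => (hd t (Ico_subset_Icc_self ht)).mono_of_mem_nhdsWithin (hright ht)) t ht
  rw [hφ, sub_self] at this
  exact sub_eq_zero.1 this

end uniqueness

/-! ### The inverse function theorem and functions vanishing to second order -/

section calculus

variable {E F G : Type*} [NormedAddCommGroup E] [NormedSpace ℝ E] [NormedAddCommGroup F]
  [NormedSpace ℝ F] [NormedAddCommGroup G] [NormedSpace ℝ G]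

/-- The inverse function theorem for `C¹` maps tangent to the identity at `0`, on a neighbourhood
on which a given property `P` holds. -/
lemma exists_openPartialHomeomorph [CompleteSpace E] {f : E → E} (hf : ContDiffAt ℝ 1 f 0)
    (hd : HasFDerivAt f (ContinuousLinearMap.id ℝ E) 0) {P : E → Prop}
    (hP : ∀ᶠ u in 𝓝 (0 : E), P u) :
    ∃ e : OpenPartialHomeomorph E E, (∀ u, e u = f u) ∧ (0 : E) ∈ e.source ∧
      ContDiffOn ℝ 1 f e.source ∧ ContDiffOn ℝ 1 e.symm e.target ∧ ∀ u ∈ e.source, P u := by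
  have hd' : HasFDerivAt f ((ContinuousLinearEquiv.refl ℝ E : E ≃L[ℝ] E) : E →L[ℝ] E) 0 := hd
  let e := hf.toOpenPartialHomeomorph f hd' one_ne_zero
  have he : ⇑e = f := rfl
  have he0 : (0 : E) ∈ e.source := hf.mem_toOpenPartialHomeomorph_source hd' one_ne_zero
  have hsymm : ContDiffAt ℝ 1 e.symm (f 0) := hf.to_localInverse hd' one_ne_zero
  have h3 : ∀ᶠ u in 𝓝 (0 : E), ContDiffAt ℝ 1 e.symm (f u) :=
    hf.continuousAt.eventually (hsymm.eventually (by simp))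
  obtain ⟨U, hU, hUo, hU0⟩ := eventually_nhds_iff.1 ((hf.eventually (by simp)).and (h3.and hP))
  refine ⟨e.restrOpen U hUo, fun u => rfl, ⟨he0, hU0⟩, fun u hu => ?_, fun y hy => ?_,
    fun u hu => (hU u hu.2).2.2⟩
  · exact (hU u hu.2).1.contDiffWithinAt
  · have h4 := (e.restrOpen U hUo).map_target hy
    have h5 := (hU _ h4.2).2.1
    have h6 : f ((e.restrOpen U hUo).symm y) = y := (e.restrOpen U hUo).right_inv hy
    rw [h6] at h5
    exact h5.contDiffWithinAt

/-- `C¹` functions which vanish to second order at `0`. -/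
structure IsFlat (f : E → F) : Prop where
  contDiffAt : ContDiffAt ℝ 1 f 0
  zero : f 0 = 0
  hasFDerivAt : HasFDerivAt f (0 : E →L[ℝ] F) 0

namespace IsFlat

lemma add {f g : E → F} (hf : IsFlat f) (hg : IsFlat g) : IsFlat fun v => f v + g v where
  contDiffAt := hf.contDiffAt.add hg.contDiffAt
  zero := by simp [hf.zero, hg.zero]
  hasFDerivAt := by simpa using hf.hasFDerivAt.fun_add hg.hasFDerivAt

lemma clm {f : E → F} (hf : IsFlat f) (L : F →L[ℝ] G) : IsFlat fun v => L (f v) where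
  contDiffAt := L.contDiff.contDiffAt.comp 0 hf.contDiffAt
  zero := by simp [hf.zero]
  hasFDerivAt := by
    have := L.hasFDerivAt.comp 0 hf.hasFDerivAt
    rw [ContinuousLinearMap.comp_zero] at this
    exact this

lemma const_smul {f : E → F} (hf : IsFlat f) (c : ℝ) : IsFlat fun v => c • f v :=
  hf.clm (c • ContinuousLinearMap.id ℝ F)

lemma sub {f g : E → F} (hf : IsFlat f) (hg : IsFlat g) : IsFlat fun v => f v - g v := by
  simpa [sub_eq_add_neg] using hf.add (hg.const_smul (-1))

variable {A : Type*} [NormedCommRing A] [NormedAlgebra ℝ A]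

lemma mul_contDiffAt {f g : E → A} (hf : IsFlat f) (hg : ContDiffAt ℝ 1 g 0) :
    IsFlat fun v => f v * g v where
  contDiffAt := hf.contDiffAt.mul hg
  zero := by simp [hf.zero]
  hasFDerivAt := by
    have := hf.hasFDerivAt.mul (hg.differentiableAt one_ne_zero).hasFDerivAt
    refine this.congr_fderiv ?_
    ext v
    simp [hf.zero]

lemma of_mul {f g : E → A} (hf : ContDiffAt ℝ 1 f 0) (hf0 : f 0 = 0) (hg : ContDiffAt ℝ 1 g 0)
    (hg0 : g 0 = 0) : IsFlat fun v => f v * g v where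
  contDiffAt := hf.mul hg
  zero := by simp [hf0]
  hasFDerivAt := by
    have := (hf.differentiableAt one_ne_zero).hasFDerivAt.mul
      (hg.differentiableAt one_ne_zero).hasFDerivAt
    refine this.congr_fderiv ?_
    ext v
    simp [hf0, hg0]

end IsFlat

end calculus

/-! ### Existence for the geodesic equation -/

lemma continuous_IccExtend {E : Type*} [TopologicalSpace E] (f : C(unitInterval, E)) :
    Continuous (IccExtend zero_le_one f) :=
  f.continuous.Icc_extend'

section timeIntegral

variable {E : Type*} [NormedAddCommGroup E] [NormedSpace ℝ E]

/-- The operator `f ↦ ∫₀ᵗ f` on `C([0, 1], E)`; curves are extended to `ℝ` by their end points. -/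
def timeIntegral (E : Type*) [NormedAddCommGroup E] [NormedSpace ℝ E] :
    C(unitInterval, E) →L[ℝ] C(unitInterval, E) :=
  LinearMap.mkContinuous
    { toFun := fun f => ⟨fun t => ∫ x in (0 : ℝ)..t, IccExtend zero_le_one f x,
        (intervalIntegral.continuous_primitive
          (fun a b => (continuous_IccExtend f).intervalIntegrable a b) 0).comp
          continuous_subtype_val⟩
      map_add' := fun f g => by
        ext t
        exact intervalIntegral.integral_add ((continuous_IccExtend f).intervalIntegrable _ _)
          ((continuous_IccExtend g).intervalIntegrable _ _)
      map_smul' := fun c f => by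
        ext t
        exact intervalIntegral.integral_smul c _ } 1 (by
    intro f
    rw [one_mul]
    refine (ContinuousMap.norm_le _ (norm_nonneg _)).2 fun t => ?_
    refine (intervalIntegral.norm_integral_le_of_norm_le_const (C := ‖f‖) fun x _ =>
      f.norm_coe_le_norm _).trans ?_
    rw [sub_zero, abs_of_nonneg t.2.1]
    exact mul_le_of_le_one_right (norm_nonneg _) t.2.2)

lemma hasDerivAt_primitive [CompleteSpace E] (f : C(unitInterval, E)) (t : ℝ) :
    HasDerivAt (fun t => ∫ x in (0 : ℝ)..t, IccExtend zero_le_one f x)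
      (IccExtend zero_le_one f t) t :=
  intervalIntegral.integral_hasDerivAt_right ((continuous_IccExtend f).intervalIntegrable _ _)
    ((continuous_IccExtend f).stronglyMeasurableAtFilter _ _) (continuous_IccExtend f).continuousAt

end timeIntegral

section picard

variable (s : ℝ) [hs : Fact (3 / 2 < s)]

/-- The projection of `H^{s-1}(S¹)` to the constants. -/
def meanH : HAlg (s - 1) →L[ℝ] HAlg (s - 1) :=
  (integralC.comp (HAlg.toC (s - 1))).smulRight 1

/-- The projection of `H^{s-1}(S¹)` to the constants, with values in `H^s(S¹)`. -/
def meanHs : HAlg (s - 1) →L[ℝ] Hs s :=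
  (constH s).comp (integralC.comp (HAlg.toC (s - 1)))

/-- Pointwise application of a continuous linear map to curves. -/
abbrev onCurves {E F : Type*} [NormedAddCommGroup E] [NormedSpace ℝ E] [NormedAddCommGroup F]
    [NormedSpace ℝ F] (L : E →L[ℝ] F) : C(unitInterval, E) →L[ℝ] C(unitInterval, F) :=
  L.compLeftContinuous ℝ unitInterval

variable {s}

/-- The Jacobian of the curve `id + ∫₀ᵗ V`. -/
def curveJac (V : C(unitInterval, Hs s)) : C(unitInterval, HAlg (s - 1)) :=
  1 + onCurves (derivH s) (timeIntegral _ V)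

/-- The mean of the Eulerian velocity, as a constant function at each time. -/
def curveMean (V : C(unitInterval, Hs s)) : C(unitInterval, HAlg (s - 1)) :=
  onCurves (meanH s) (onCurves (inclH s) V * curveJac V)

/-- The term `Vₓ² / ηₓ`. -/
def curveQuad (V : C(unitInterval, Hs s)) : C(unitInterval, HAlg (s - 1)) :=
  onCurves (derivH s) V * onCurves (derivH s) V * Ring.inverse (curveJac V)

/-- The derivative of the acceleration, `Vₓ² / (2 ηₓ) + (2 p V + c) ηₓ`, where the constant
`c = -2 p² - ½ ∫ Vₓ² / ηₓ` is such that its integral vanishes. -/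
def curveAccDeriv (V : C(unitInterval, Hs s)) : C(unitInterval, HAlg (s - 1)) :=
  (1 / 2 : ℝ) • curveQuad V + ((2 : ℝ) • (curveMean V * onCurves (inclH s) V) +
    ((-2 : ℝ) • (curveMean V * curveMean V) -
      (1 / 2 : ℝ) • onCurves (meanH s) (curveQuad V))) * curveJac V

/-- The acceleration `A` given by the geodesic equation along the curve `id + ∫₀ᵗ V`; its constant
of integration is determined by `∫ A ηₓ = 0`. -/
def curveAcc (V : C(unitInterval, Hs s)) : C(unitInterval, Hs s) :=
  onCurves (antiderivH s) (curveAccDeriv V) - onCurves (meanHs s)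
    (onCurves (inclH s) (onCurves (antiderivH s) (curveAccDeriv V)) * curveJac V)

lemma contDiff_curveJac : ContDiff ℝ 1 (curveJac (s := s)) :=
  contDiff_const.add ((onCurves (derivH s)).comp (timeIntegral (Hs s))).contDiff

lemma curveJac_zero : curveJac (0 : C(unitInterval, Hs s)) = 1 := by
  rw [curveJac, map_zero, map_zero, add_zero]

/-- The acceleration is a `C¹` function of the curve, quadratic to leading order. -/
lemma isFlat_curveAcc : IsFlat (curveAcc (s := s)) := by
  have hjac : ContDiffAt ℝ 1 (curveJac (s := s)) 0 := contDiff_curveJac.contDiffAt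
  have hinv : ContDiffAt ℝ 1 (fun V => Ring.inverse (curveJac (s := s) V)) 0 := by
    have := contDiffAt_ringInverse ℝ (n := 1) (1 : C(unitInterval, HAlg (s - 1))ˣ)
    rw [Units.val_one, ← curveJac_zero] at this
    exact this.comp 0 hjac
  have hincl : ContDiffAt ℝ 1 (fun V => onCurves (inclH s) V) 0 :=
    (onCurves (inclH s)).contDiff.contDiffAt
  have hderiv : ContDiffAt ℝ 1 (fun V => onCurves (derivH s) V) 0 :=
    (onCurves (derivH s)).contDiff.contDiffAt
  have hmean : ContDiffAt ℝ 1 (curveMean (s := s)) 0 :=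
    (onCurves (meanH s)).contDiff.contDiffAt.comp 0 (hincl.mul hjac)
  have hmean0 : curveMean (0 : C(unitInterval, Hs s)) = 0 := by
    rw [curveMean, map_zero, zero_mul, map_zero]
  have hquad : IsFlat (curveQuad (s := s)) :=
    (IsFlat.of_mul hderiv (map_zero _) hderiv (map_zero _)).mul_contDiffAt hinv
  have hacc : IsFlat (curveAccDeriv (s := s)) :=
    (hquad.const_smul _).add (((((IsFlat.of_mul hmean hmean0 hincl (map_zero _)).const_smul _).add
      (((IsFlat.of_mul hmean hmean0 hmean hmean0).const_smul _).sub
        ((hquad.clm _).const_smul _)))).mul_contDiffAt hjac)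
  exact (hacc.clm _).sub ((((hacc.clm _).clm _).mul_contDiffAt hjac).clm _)

end picard

section pointwise

variable {s : ℝ} [hs : Fact (3 / 2 < s)] (V : C(unitInterval, Hs s)) (t : unitInterval)

lemma toC_curveJac : HAlg.toC (s - 1) (curveJac V t) = jac (timeIntegral _ V t) := by
  change HAlg.toC (s - 1) (1 + derivH s (timeIntegral _ V t)) = _
  rw [map_add, HAlg.toC_one, toC_derivH, jac]

lemma toC_inverse_curveJac (h : IsUnit (curveJac V)) :
    HAlg.toC (s - 1) (Ring.inverse (curveJac V) t) = Ring.inverse (jac (timeIntegral _ V t)) := by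
  -- inverses are unique, and `toC` is multiplicative
  have h1 : curveJac V t * Ring.inverse (curveJac V) t = 1 :=
    DFunLike.congr_fun (Ring.mul_inverse_cancel _ h) t
  have h2 := congrArg (HAlg.toC (s - 1)) h1
  rw [HAlg.toC_mul, HAlg.toC_one, toC_curveJac] at h2
  exact (Ring.inverse_unit (Units.mkOfMulEqOne _ _ h2)).symm

lemma toC_meanH (f : HAlg (s - 1)) :
    HAlg.toC (s - 1) (meanH s f) = integralC (HAlg.toC (s - 1) f) • 1 := by
  change HAlg.toC (s - 1) (integralC (HAlg.toC (s - 1) f) • 1) = _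
  rw [map_smul, HAlg.toC_one]

lemma toC_curveMean :
    HAlg.toC (s - 1) (curveMean V t) = meanVel (timeIntegral _ V t) (V t) • 1 := by
  change HAlg.toC (s - 1) (meanH s (inclH s (V t) * curveJac V t)) = _
  rw [toC_meanH, HAlg.toC_mul, toC_inclH, toC_curveJac, meanVel]

lemma toC_curveQuad (h : IsUnit (curveJac V)) :
    HAlg.toC (s - 1) (curveQuad V t) = strain (timeIntegral _ V t) (V t) * derivC s (V t) := by
  change HAlg.toC (s - 1) (derivH s (V t) * derivH s (V t) * Ring.inverse (curveJac V) t) = _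
  rw [HAlg.toC_mul, HAlg.toC_mul, toC_derivH, toC_inverse_curveJac V t h, strain, mul_right_comm]

/-- The constant `c = -2 p² - ½ ∫ q Vₓ` in the geodesic equation. -/
def geodesicConst (φ v : Hs s) : ℝ :=
  -2 * meanVel φ v ^ 2 - 1 / 2 * integralC (strain φ v * derivC s v)

lemma toC_curveAccDeriv (h : IsUnit (curveJac V)) : HAlg.toC (s - 1) (curveAccDeriv V t) =
    (1 / 2 : ℝ) • (strain (timeIntegral _ V t) (V t) * derivC s (V t)) +
      ((2 * meanVel (timeIntegral _ V t) (V t)) • inclC s (V t) +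
        geodesicConst (timeIntegral _ V t) (V t) • 1) * jac (timeIntegral _ V t) := by
  change HAlg.toC (s - 1) ((1 / 2 : ℝ) • curveQuad V t +
    ((2 : ℝ) • (curveMean V t * inclH s (V t)) + ((-2 : ℝ) • (curveMean V t * curveMean V t) -
      (1 / 2 : ℝ) • meanH s (curveQuad V t))) * curveJac V t) = _
  rw [map_add, HAlg.toC_mul, map_add, map_sub]
  simp only [map_smul, HAlg.toC_mul]
  rw [toC_meanH, toC_curveQuad V t h, toC_curveMean, toC_inclH, toC_curveJac, geodesicConst]
  ext x
  simp only [ContinuousMap.add_apply, ContinuousMap.sub_apply, ContinuousMap.mul_apply,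
    ContinuousMap.smul_apply, ContinuousMap.one_apply, smul_eq_mul]
  ring

lemma derivC_curveAcc (h : IsUnit (curveJac V)) : derivC s (curveAcc V t) =
    (1 / 2 : ℝ) • (strain (timeIntegral _ V t) (V t) * derivC s (V t)) +
      ((2 * meanVel (timeIntegral _ V t) (V t)) • inclC s (V t) +
        geodesicConst (timeIntegral _ V t) (V t) • 1) * jac (timeIntegral _ V t) := by
  have h0 : integralC (HAlg.toC (s - 1) (curveAccDeriv V t)) = 0 := by
    rw [toC_curveAccDeriv V t h, add_mul, smul_mul_assoc, smul_mul_assoc, one_mul, map_add, map_add,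
      map_smul, map_smul, map_smul, integralC_jac, ← meanVel, geodesicConst]
    simp only [smul_eq_mul]
    ring
  change derivC s (antiderivH s (curveAccDeriv V t) - constH s _) = _
  rw [map_sub, derivC_constH, sub_zero, derivC_antiderivH, h0, zero_smul, sub_zero,
    toC_curveAccDeriv V t h]

lemma integralC_curveAcc_mul_jac :
    integralC (inclC s (curveAcc V t) * jac (timeIntegral _ V t)) = 0 := by
  change integralC (inclC s (antiderivH s (curveAccDeriv V t) - constH s (integralC
    (HAlg.toC (s - 1) (inclH s (antiderivH s (curveAccDeriv V t)) * curveJac V t)))) * _) = 0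
  rw [HAlg.toC_mul, toC_inclH, toC_curveJac, map_sub, inclC_constH, sub_mul, smul_mul_assoc,
    one_mul, map_sub, map_smul, integralC_jac, smul_eq_mul, mul_one, sub_self]

end pointwise

/-! ### The exponential map -/

section existence

variable {s : ℝ} [hs : Fact (3 / 2 < s)]

/-- A solution of the integrated geodesic equation `V = u + ∫₀ᵗ A` on a curve of lifts yields a
geodesic. -/
lemma exists_isGeodesicFromId {u : Hs s} {V : C(unitInterval, Hs s)}
    (hV : V - timeIntegral _ (curveAcc V) = ContinuousMap.const _ u)
    (hmem : ∀ t, timeIntegral _ V t ∈ liftSet s) (hunit : IsUnit (curveJac V)) :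
    ∃ γ : ℝ → Ds s, IsGeodesicFromId u γ ∧ γ 1 = Ds.ofLift (timeIntegral _ V 1) := by
  set φ : ℝ → Hs s := fun t => ∫ x in (0 : ℝ)..t, IccExtend zero_le_one V x
  set W : ℝ → Hs s := fun t => u + ∫ x in (0 : ℝ)..t, IccExtend zero_le_one (curveAcc V) x
  have hφ (t : unitInterval) : timeIntegral _ V t = φ t := rfl
  have hW (t : unitInterval) : V t = W t := by
    have := DFunLike.congr_fun hV t
    exact (sub_eq_iff_eq_add.1 this)
  have hdφ (t : ℝ) (ht : t ∈ Icc (0 : ℝ) 1) : HasDerivAt φ (W t) t := by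
    have := hasDerivAt_primitive V t
    rwa [IccExtend_of_mem _ _ ht, hW] at this
  have hdW (t : ℝ) : HasDerivAt W (IccExtend zero_le_one (curveAcc V) t) t :=
    (hasDerivAt_primitive (curveAcc V) t).const_add u
  have hW1 : ContDiff ℝ 1 W := by
    rw [contDiff_one_iff_deriv]
    refine ⟨fun t => (hdW t).differentiableAt, ?_⟩
    rw [funext fun t => (hdW t).deriv]
    exact continuous_IccExtend _
  have hφ2 : ContDiffOn ℝ 2 φ (Icc 0 1) := by
    have h2 : (2 : ℕ∞ω) = 1 + 1 := by norm_num
    rw [h2, contDiffOn_succ_iff_derivWithin (uniqueDiffOn_Icc zero_lt_one)]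
    refine ⟨fun t ht => (hdφ t ht).differentiableAt.differentiableWithinAt, by simp, ?_⟩
    exact hW1.contDiffOn.congr fun t ht =>
      (hdφ t ht).hasDerivWithinAt.derivWithin (uniqueDiffOn_Icc zero_lt_one t ht)
  have hmemφ (t : ℝ) (ht : t ∈ Icc (0 : ℝ) 1) : φ t ∈ liftSet s := hmem ⟨t, ht⟩
  have hdW' (t : ℝ) (ht : t ∈ Icc (0 : ℝ) 1) :
      HasDerivWithinAt W (curveAcc V ⟨t, ht⟩) (Icc 0 1) t := by
    have := hdW t
    rw [IccExtend_of_mem _ _ ht] at this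
    exact this.hasDerivWithinAt
  have hsol : SolvesGeodesicEq φ W fun t => geodesicConst (φ t) (W t) := by
    refine ⟨hmemφ, hW1.continuous.continuousOn, fun t ht => (hdφ t ht).hasDerivWithinAt,
      fun t ht => ?_, fun t ht => ?_⟩
    · have h := integralC_curveAcc_mul_jac V ⟨t, ht⟩
      rw [hφ] at h
      refine (hasDerivWithinAt_meanVel (hdφ t ht).hasDerivWithinAt (hdW' t ht)).congr_deriv ?_
      -- `∫ V Vₓ = 0`
      have h2 := integralC_mul_derivC (W t) (W t)
      rw [mul_comm (derivC s (W t))] at h2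
      linear_combination h + h2 / 2
    · have h := derivC_curveAcc V ⟨t, ht⟩ hunit
      rw [hφ, hW] at h
      refine (hasDerivWithinAt_strain (hmemφ t ht) (hdφ t ht).hasDerivWithinAt
        (hdW' t ht)).congr_deriv ?_
      have h1 := Ring.mul_inverse_cancel _ (isUnit_jac (hmemφ t ht))
      rw [h]
      ext x
      have h1x := DFunLike.congr_fun h1 x
      simp only [strain, ContinuousMap.add_apply, ContinuousMap.sub_apply, ContinuousMap.mul_apply,
        ContinuousMap.smul_apply, ContinuousMap.one_apply, smul_eq_mul] at h1x ⊢
      linear_combination (2 * meanVel (φ t) (W t) * inclC s (W t) x +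
        geodesicConst (φ t) (W t)) * h1x
  have h0 : φ 0 = 0 := intervalIntegral.integral_same
  have hzero : (0 : ℝ) ∈ Icc (0 : ℝ) 1 := ⟨le_rfl, zero_le_one⟩
  have hW0 : W 0 = u := by
    simp only [W, intervalIntegral.integral_same, add_zero]
  refine ⟨fun t => Ds.ofLift (φ t), ⟨hsol.isGeodesic hφ2 fun t _ => rfl, ?_, ?_⟩, rfl⟩
  · simp only [h0, Ds.ofLift_zero]
  · rw [← hW0]
    exact velocity_of_lift hzero (hmemφ 0 hzero) (hdφ 0 hzero).hasDerivWithinAt fun _ _ => rfl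

lemma IsGeodesicFromId.eqOn {u : Hs s} {γ₁ γ₂ : ℝ → Ds s} (h₁ : IsGeodesicFromId u γ₁)
    (h₂ : IsGeodesicFromId u γ₂) : EqOn γ₁ γ₂ (Icc 0 1) := by
  have hzero : (0 : ℝ) ∈ Icc (0 : ℝ) 1 := ⟨le_rfl, zero_le_one⟩
  have key (γ : ℝ → Ds s) (h : IsGeodesicFromId u γ) : ∃ φ V c, SolvesGeodesicEq φ V c ∧
      φ 0 = 0 ∧ V 0 = u ∧ ∀ t ∈ Icc (0 : ℝ) 1, γ t = Ds.ofLift (φ t) := by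
    obtain ⟨φ, V, c, hsol, h0, hγ⟩ := h.isGeodesic.exists_solution ⟨0, zero_mem_liftSet s⟩
      (by rw [h.initial, ← Ds.ofLift_zero, Ds.ofLift_eq (zero_mem_liftSet s)])
    refine ⟨φ, V, c, hsol, h0, ?_, hγ⟩
    rw [← velocity_of_lift hzero (hsol.mem 0 hzero) (hsol.deriv_lift 0 hzero) hγ]
    exact h.velocity_initial
  obtain ⟨φ₁, V₁, c₁, hsol₁, h0₁, hV₁, hγ₁⟩ := key γ₁ h₁
  obtain ⟨φ₂, V₂, c₂, hsol₂, h0₂, hV₂, hγ₂⟩ := key γ₂ h₂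
  intro t ht
  rw [hγ₁ t ht, hγ₂ t ht, hsol₁.eqOn hsol₂ (h0₁.trans h0₂.symm) (hV₁.trans hV₂.symm) ht]

/-- The lift of the exponential map, defined near `0`. -/
lemma exists_lift_exp (s : ℝ) [Fact (3 / 2 < s)] : ∃ E : Hs s → Hs s, ContDiffAt ℝ 1 E 0 ∧
    HasFDerivAt E (ContinuousLinearMap.id ℝ (Hs s)) 0 ∧ E 0 = 0 ∧
    ∀ᶠ u in 𝓝 (0 : Hs s), ∃ γ : ℝ → Ds s, IsGeodesicFromId u γ ∧ γ 1 = Ds.ofLift (E u) := by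
  have hflat := (isFlat_curveAcc (s := s)).clm (timeIntegral (Hs s))
  have hΦ : ContDiffAt ℝ 1 (fun V => V - timeIntegral _ (curveAcc (s := s) V)) 0 :=
    contDiffAt_id.sub hflat.contDiffAt
  have hdΦ : HasFDerivAt (fun V => V - timeIntegral _ (curveAcc (s := s) V))
      (ContinuousLinearMap.id ℝ _) 0 := by
    have := (hasFDerivAt_id (0 : C(unitInterval, Hs s))).sub hflat.hasFDerivAt
    rwa [sub_zero] at this
  obtain ⟨e, he, he0, -, he2, -⟩ := exists_openPartialHomeomorph hΦ hdΦ (P := fun _ => True)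
    (Eventually.of_forall fun _ => trivial)
  have heq0 : e 0 = 0 := by rw [he, hflat.zero, sub_zero]
  have ht0 : (0 : C(unitInterval, Hs s)) ∈ e.target := heq0 ▸ e.map_source he0
  have hs0 : e.symm 0 = 0 := by
    have := e.left_inv he0
    rwa [heq0] at this
  have hσ : ContDiffAt ℝ 1 e.symm 0 := he2.contDiffAt (e.open_target.mem_nhds ht0)
  have hdσ : HasFDerivAt e.symm (ContinuousLinearMap.id ℝ _) 0 := by
    refine e.hasFDerivAt_symm (f' := ContinuousLinearEquiv.refl ℝ _) ht0 ?_
    rw [hs0, funext he]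
    exact hdΦ
  -- `e.symm` is applied to the constant curves `u`
  let κ : Hs s →L[ℝ] C(unitInterval, Hs s) := ContinuousLinearMap.const ℝ unitInterval
  have hκ0 : κ 0 = 0 := map_zero κ
  have hσκ : ContDiffAt ℝ 1 (fun u => e.symm (κ u)) 0 := by
    rw [← hκ0] at hσ
    exact hσ.comp 0 κ.contDiff.contDiffAt
  have hdσκ : HasFDerivAt (fun u => e.symm (κ u)) κ 0 := by
    rw [← hκ0] at hdσ
    exact hdσ.comp 0 κ.hasFDerivAt
  have hlim : Tendsto (fun u => e.symm (κ u)) (𝓝 0) (𝓝 0) := by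
    have := hσκ.continuousAt.tendsto
    rwa [hκ0, hs0] at this
  let L : C(unitInterval, Hs s) →L[ℝ] Hs s :=
    (ContinuousMap.evalCLM ℝ (1 : unitInterval)).comp (timeIntegral (Hs s))
  have hL : L.comp κ = ContinuousLinearMap.id ℝ (Hs s) := by
    ext1 u
    change ∫ x in (0 : ℝ)..((1 : unitInterval) : ℝ), u = u
    simp
  refine ⟨fun u => L (e.symm (κ u)), L.contDiff.contDiffAt.comp 0 hσκ, ?_, ?_, ?_⟩
  · rw [← hL]
    exact L.hasFDerivAt.comp 0 hdσκ
  · simp only [hκ0, hs0, map_zero]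
  have h1 : ∀ᶠ u in 𝓝 (0 : Hs s), κ u ∈ e.target :=
    κ.continuous.continuousAt.eventually (by rw [hκ0]; exact e.open_target.mem_nhds ht0)
  have h2 : ∀ᶠ V in 𝓝 (0 : C(unitInterval, Hs s)), IsUnit (curveJac V) := by
    refine contDiff_curveJac.continuous.continuousAt.eventually
      (Units.isOpen.mem_nhds ?_)
    rw [curveJac_zero]
    exact isUnit_one
  have h3 : ∀ᶠ V in 𝓝 (0 : C(unitInterval, Hs s)), ∀ t, timeIntegral _ V t ∈ liftSet s := by
    obtain ⟨ε, hε, hball⟩ := Metric.isOpen_iff.1 (isOpen_liftSet (Fact.out : 3 / 2 < s)) 0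
      (zero_mem_liftSet s)
    have : Tendsto (timeIntegral (Hs s)) (𝓝 0) (𝓝 0) := by
      simpa using (timeIntegral (Hs s)).continuous.tendsto 0
    filter_upwards [this.eventually (Metric.ball_mem_nhds _ hε)] with V hV t
    rw [dist_zero_right] at hV
    exact hball (mem_ball_zero_iff.2 ((ContinuousMap.norm_coe_le_norm _ t).trans_lt hV))
  filter_upwards [h1, hlim.eventually (h2.and h3)] with u hu hV
  refine exists_isGeodesicFromId ?_ hV.2 hV.1
  rw [← he, e.right_inv hu]
  rfl

end existence

end MuHS

end

open MuHS in
theorem mainTheorem4 (s : ℝ) [Fact (3 / 2 < s)] :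
    (∀ (u : Hs s) (γ₁ γ₂ : ℝ → Ds s), IsGeodesicFromId u γ₁ → IsGeodesicFromId u γ₂ →
      EqOn γ₁ γ₂ (Icc 0 1)) ∧
    ∃ exp : OpenPartialHomeomorph (Hs s) (Ds s),
      0 ∈ exp.source ∧ Ds.id s ∈ exp.target ∧
      (∀ u ∈ exp.source, ∃ γ : ℝ → Ds s, IsGeodesicFromId u γ ∧ exp u = γ 1) ∧
      ContMDiffOn 𝓘(ℝ, Hs s) 𝓘(ℝ, Hs s) 1 exp exp.source ∧
      ContMDiffOn 𝓘(ℝ, Hs s) 𝓘(ℝ, Hs s) 1 exp.symm exp.target := by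
  refine ⟨fun u γ₁ γ₂ h₁ h₂ => h₁.eqOn h₂, ?_⟩
  obtain ⟨E, hE, hdE, hE0, hgeo⟩ := exists_lift_exp s
  obtain ⟨e, he, he0, he1, he2, heP⟩ := exists_openPartialHomeomorph hE hdE hgeo
  have he00 : e 0 = 0 := (he 0).trans hE0
  -- the exponential map is `E` in the chart at the identity
  let c := dsChart (⟨0, zero_mem_liftSet s⟩ : liftSet s)
  have hsub (u : Hs s) (hu : u ∈ (e.trans c.symm).source) :
      e u ∈ c.target ∧ c.symm (e u) = Ds.ofLift (e u) := by
    rw [OpenPartialHomeomorph.trans_source] at hu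
    exact ⟨hu.2, dsChart_symm_eq_ofLift hu.2⟩
  have hsrc0 : 0 ∈ (e.trans c.symm).source := by
    rw [OpenPartialHomeomorph.trans_source]
    refine ⟨he0, ?_⟩
    rw [mem_preimage, he00]
    exact mem_dsChart_target ⟨0, zero_mem_liftSet s⟩
  have hexp0 : e.trans c.symm 0 = Ds.id s := by
    rw [← Ds.ofLift_zero, OpenPartialHomeomorph.coe_trans, Function.comp_apply, (hsub 0 hsrc0).2,
      he00]
  refine ⟨e.trans c.symm, hsrc0, hexp0 ▸ (e.trans c.symm).map_source hsrc0, fun u hu => ?_,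
    fun u hu => ?_, ?_⟩
  · obtain ⟨γ, hγ, hγ1⟩ := heP u hu.1
    exact ⟨γ, hγ, by rw [hγ1, ← he]; exact (hsub u hu).2⟩
  · have hcd : ContDiffWithinAt ℝ 1 e (e.trans c.symm).source u := by
      rw [funext he]
      exact (he1 u hu.1).mono fun _ h => h.1
    exact (contMDiffWithinAt_iff_lift hu (dsChart_target_subset _ (hsub u hu).1)
      hcd.continuousWithinAt fun y hy => (hsub y hy).2).2 hcd
  · have : IsManifold 𝓘(ℝ, Hs s) 1 (Ds s) := IsManifold.of_le (n := ∞) (by simp)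
    have hc : ContMDiffOn 𝓘(ℝ, Hs s) 𝓘(ℝ, Hs s) 1 c c.source :=
      contMDiffOn_of_mem_maximalAtlas
        (IsManifold.subset_maximalAtlas (mem_range_self _))
    refine ContMDiffOn.comp (t := e.target) he2.contMDiffOn (hc.mono fun y hy => hy.1) ?_
    exact fun y hy => hy.2
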